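/- **Conventions.** For a Hermitian structure $(J,g)$ let $\omega(\cdot,\cdot)=g(J\cdot,\cdot)$ and $d^c\omega=\sqrt{-1}(\bar\partial-\partial)\omega=-d\omega(J\cdot,J\cdot,J\cdot)$; $g$ is SKT if $dd^c\omega=0$. In complex dimension $n$, the Lee form $\theta$ is the $1$-form with $d\omega^{n-1}=\theta\wedge\omega^{n-1}$, and $\theta^\sharp$ is its $g$-dual vector field. For a $3$-form $H$ let $H^2(U,V)=g(\iota_UH,\iota_VH)=\sum_{i,j}H(U,e_i,e_j)H(V,e_i,e_j)$ for an orthonormal frame, $\mathrm{Ric}^B_{g,H}=\mathrm{Ric}_g-\tfrac14H^2$, and $\Delta_g=-(dd^*_g+d^*_gd)$. Let $(\rho^B)^{1,1}$ be the $(1,1)$-part of the Bismut–Ricci form $\rho^B(U,V)=\tfrac12\mathrm{tr}(J\circ R^B(U,V))$, where $R^B$ is the curvature of the Bismut connection, i.e. the connection with $\nabla g=0$, $\nabla J=0$ and totally skew torsion. **Solitons.** A triple $(g,H,X)$ (a Riemannian metric, a closed $3$-form, a smooth vector field) is a *soliton for the generalized Ricci flow* if for some $\lambda\in\mathbb R$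 $$\mathrm{Ric}^B_{g,H}=\lambda g+\tfrac12\mathcal L_Xg,\qquad \Delta_gH=-2\lambda H-\mathcal L_XH .$$ A pair $(\omega,Y)$ is a *pluriclosed soliton* if $Y$ is holomorphic (that is, smooth with $\mathcal L_YJ=0$) and, for some $\lambda\in\mathbb R$, $(\rho^B)^{1,1}=\lambda\omega+\tfrac12\mathcal L_Y\omega$. A triple $(g,H,X)$ *is a pluriclosed soliton* if it is the triple $(g,d^c\omega,Y-\theta^\sharp)$ attached to a pluriclosed soliton $(\omega,Y)$. **Theorem.** (1) Let $(M,J)$ be a complex manifold with an SKT Hermitian metric $g$ and Lee form $\theta$. A soliton $(g,H,X)$ for the generalized Ricci flow is a pluriclosed soliton if and only if $H=d^c\omega$ and $X+\theta^\sharp$ is holomorphic. Moreover every triple $(g,H,X)$ that is a pluriclosed soliton, with constant $\lambda$, is a soliton for the generalized Ricci flow, with the same constant $\lambda$. (2) Let $(J,g)$ be a left-invariant SKT structure on a Lie group with Lie algebra $(\mathfrak g,\mu)$; left-invariant tensors are identified with tensors on $\mathfrak g$. Let $H\in\Lambda^3\mathfrak g^*$ and $D\in\mathrm{Der}(\mathfrak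 g)$. Call $(g,H,D)$ an *algebraic soliton for the generalized Ricci flow* if $dH=0$ and for some $\lambda\in\mathbb R$ $$\mathrm{Ric}^B_{\mu,H}=\lambda\,\mathrm{Id}+D,\qquad \Delta_\mu H=\lambda H+\rho(\mathrm{Ric}^B_{\mu,H})H,$$ where $(\rho(A)H)(U,V,W)=-H(AU,V,W)-H(U,AV,W)-H(U,V,AW)$. Call $(J,g)$ an *algebraic pluriclosed soliton with derivation $D'$* if $D'\in\mathrm{Der}(\mathfrak g)$ commutes with $J$ and, for some $\lambda\in\mathbb R$, $P=\lambda\,\mathrm{Id}+\tfrac12(D'+D'^t)$, where $\omega(P\cdot,\cdot)=(\rho^B)^{1,1}$; and say that $(g,H,D)$ *is an algebraic pluriclosed soliton* if $H=d^c\omega$ and $D=D'+\mathrm{ad}_{\theta^\sharp}$ for such a $D'$. Then an algebraic soliton $(g,H,D)$ for the generalized Ricci flow is an algebraic pluriclosed soliton if and only if $D-\mathrm{ad}_{\theta^\sharp}$ (which is a derivation) commutes with $J$ and $H=d^c\omega$. -/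

import Mathlib

open scoped Manifold ContDiff

namespace PluriSol

/-! ## Tensor calculus in a frame with constant structure coefficients

All local differential geometry is written once, in a frame indexed by a finite-dimensional vector
space `V` whose elements stand for vector fields with constant coefficients. It is used in exactly
two cases: coordinate vector fields in a chart (`chartCalc`: vectors differentiate functions, all
brackets vanish) and left-invariant vector fields on a Lie group (`lieCalc`: functions are constants,
the bracket is the Lie bracket). Covariant `k`-tensors are functions of `k` vectors. -/

/-- The operations of a frame: derivative of scalar functions and of vector-valued functions (given
by their components in the frame) along a frame field, and the bracket of two frame fields. -/
structure FrameCalculus (B V : Type*) where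
  derS : V → (B → ℝ) → B → ℝ
  derV : V → (B → V) → B → V
  br : V → V → V

/-- Coordinate vector fields on a normed space. -/
noncomputable def chartCalc (E : Type*) [NormedAddCommGroup E] [NormedSpace ℝ E] :
    FrameCalculus E E where
  derS u f x := fderiv ℝ f x u
  derV u Y x := fderiv ℝ Y x u
  br _ _ := 0

/-- Left-invariant vector fields and constant functions. -/
noncomputable def lieCalc (𝔤 : Type*) [LieRing 𝔤] : FrameCalculus Unit 𝔤 where
  derS _ _ _ := 0
  derV _ _ _ := 0
  br u v := ⁅u, v⁆

section Linear

variable {V : Type*} [AddCommGroup V] [Module ℝ V] [FiniteDimensional ℝ V]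

/-- The entry `g^{ij}` of the inverse of the Gram matrix of `g` in the basis `finBasis`. -/
noncomputable def ginv (g : V → V → ℝ) (i j : Fin (Module.finrank ℝ V)) : ℝ :=
  (Matrix.of fun a b => g (Module.finBasis ℝ V a) (Module.finBasis ℝ V b))⁻¹ i j

/-- `α^♯`, the vector with `g (α^♯, ·) = α`. -/
noncomputable def sharp (g : V → V → ℝ) (α : V → ℝ) : V :=
  ∑ i, ∑ j, (ginv g i j * α (Module.finBasis ℝ V j)) • Module.finBasis ℝ V i

/-- The trace of an endomorphism. -/
noncomputable def tr (A : V → V) : ℝ :=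
  ∑ i, (Module.finBasis ℝ V).coord i (A (Module.finBasis ℝ V i))

/-- The wedge product `θ ∧ α` of a `1`-form and a `k`-form. -/
noncomputable def wedgeOne {k : ℕ} (θ : V → ℝ) (α : (Fin k → V) → ℝ) (v : Fin (k + 1) → V) : ℝ :=
  ∑ j : Fin (k + 1), (-1) ^ (j : ℕ) * θ (v j) * α (j.removeNth v)

/-- The wedge product `β ∧ α` of a `2`-form and a `k`-form (the sum runs over ordered pairs of
arguments, hence the factor `1/2`). -/
noncomputable def wedgeTwo {k : ℕ} (β : (Fin 2 → V) → ℝ) (α : (Fin k → V) → ℝ)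
    (v : Fin (k + 2) → V) : ℝ :=
  (1 / 2) * ∑ j : Fin (k + 2), ∑ i : Fin (k + 1),
    (-1) ^ ((i : ℕ) + (j : ℕ)) * β ![v j, j.removeNth v i] * α (i.removeNth (j.removeNth v))

/-- The exterior power `β^k` of a `2`-form. -/
noncomputable def wedgePow (β : (Fin 2 → V) → ℝ) : (k : ℕ) → (Fin (2 * k) → V) → ℝ
  | 0 => fun _ => 1
  | k + 1 => wedgeTwo β (wedgePow β k)

/-- The inner product of two covariant `2`-tensors, `g^{ia} g^{jb} α_{ij} β_{ab}`. -/
noncomputable def innerTwo (g : V → V → ℝ) (α β : V → V → ℝ) : ℝ :=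
  ∑ i, ∑ j, ∑ a, ∑ b, ginv g i a * ginv g j b *
    α (Module.finBasis ℝ V i) (Module.finBasis ℝ V j) *
    β (Module.finBasis ℝ V a) (Module.finBasis ℝ V b)

end Linear

section Calculus

variable {B V : Type*} [AddCommGroup V] [Module ℝ V] [FiniteDimensional ℝ V]
  (C : FrameCalculus B V) (g : B → V → V → ℝ) (J : B → V → V)

/-- The exterior derivative. The bracket term
`∑_{i<j} (-1)^{i+j} α([v_i, v_j], …)` is written with `[v_i, v_j]` moved to the place of `v_i`. -/
noncomputable def extD {k : ℕ} (α : B → (Fin k → V) → ℝ) (x : B) (v : Fin (k + 1) → V) : ℝ :=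
  ∑ j : Fin (k + 1), (-1) ^ (j : ℕ) *
    (C.derS (v j) (fun y => α y (j.removeNth v)) x +
      ∑ i ∈ Finset.univ.filter (fun i => i < j),
        α x (j.removeNth (Function.update v i (C.br (v i) (v j)))))

/-- The Levi-Civita connection `∇_u v`, by the Koszul formula. -/
noncomputable def leviCivita (x : B) (u v : V) : V :=
  sharp (g x) fun w => (1 / 2) *
    (C.derS u (fun y => g y v w) x + C.derS v (fun y => g y u w) x - C.derS w (fun y => g y u v) x
      + g x (C.br u v) w - g x (C.br u w) v - g x (C.br v w) u)

/-- The curvature `R(u,v)w = ∇_u ∇_v w - ∇_v ∇_u w - ∇_{[u,v]} w` of the connection whose value on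
frame fields is `Γ`. -/
noncomputable def curvature (Γ : B → V → V → V) (x : B) (u v w : V) : V :=
  (C.derV u (fun y => Γ y v w) x + Γ x u (Γ x v w))
    - (C.derV v (fun y => Γ y u w) x + Γ x v (Γ x u w)) - Γ x (C.br u v) w

/-- The Ricci tensor of `g`. -/
noncomputable def ricci (x : B) (v w : V) : ℝ :=
  tr fun u => curvature C (leviCivita C g) x u v w

/-- `H²(u, v) = g(ι_u H, ι_v H)`. -/
noncomputable def hSq (H : B → (Fin 3 → V) → ℝ) (x : B) (u v : V) : ℝ :=
  innerTwo (g x) (fun a b => H x ![u, a, b]) (fun a b => H x ![v, a, b])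

/-- `Ric^B_{g,H} = Ric_g - H²/4`. -/
noncomputable def ricB (H : B → (Fin 3 → V) → ℝ) (x : B) (u v : V) : ℝ :=
  ricci C g x u v - (1 / 4) * hSq g H x u v

/-- The covariant derivative `∇_u α` of a covariant tensor for the Levi-Civita connection. -/
noncomputable def nabla {k : ℕ} (u : V) (α : B → (Fin k → V) → ℝ) (x : B) (v : Fin k → V) : ℝ :=
  C.derS u (fun y => α y v) x - ∑ i, α x (Function.update v i (leviCivita C g x u (v i)))

/-- The codifferential `d^*_g`. -/
noncomputable def codiff {k : ℕ} (α : B → (Fin (k + 1) → V) → ℝ) (x : B) (v : Fin k → V) : ℝ :=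
  -∑ i, ∑ j, ginv (g x) i j * nabla C g (Module.finBasis ℝ V i) α x
    (Fin.cons (Module.finBasis ℝ V j) v)

/-- The Laplacian `Δ_g = -(d d^* + d^* d)` on forms. -/
noncomputable def laplacian {k : ℕ} (α : B → (Fin (k + 1) → V) → ℝ) (x : B)
    (v : Fin (k + 1) → V) : ℝ :=
  -(extD C (codiff C g α) x v + codiff C g (extD C α) x v)

/-- The fundamental form `ω(u, v) = g(J u, v)`. -/
noncomputable def omega (x : B) (v : Fin 2 → V) : ℝ := g x (J x (v 0)) (v 1)

/-- `d^c ω = J⁻¹ d J ω`, where `J` acts on forms by `(J α)(v₁, …) = α(J v₁, …)`. Since `J ω = ω` and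
`J⁻¹ = -J` on vectors, `d^c ω = - dω(J·, J·, J·)`, that is `√-1 (∂̄ - ∂) ω`. -/
noncomputable def dcOmega (x : B) (v : Fin 3 → V) : ℝ :=
  -extD C (omega g J) x fun i => J x (v i)

/-- The Nijenhuis tensor `[u,v] + J[Ju,v] + J[u,Jv] - [Ju,Jv]`. -/
noncomputable def nijenhuis (x : B) (u v : V) : V :=
  C.br u v
    + J x (-C.derV v (fun y => J y u) x + C.br (J x u) v)
    + J x (C.derV u (fun y => J y v) x + C.br u (J x v))
    - (C.derV (J x u) (fun y => J y v) x - C.derV (J x v) (fun y => J y u) x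
        + C.br (J x u) (J x v))

/-- The Bismut connection: the connection with `∇g = 0`, `∇J = 0` and totally skew torsion. For
`ω = g(J·,·)` its torsion `3`-form is `dω(J·, J·, J·)`. -/
noncomputable def bismut (x : B) (u v : V) : V :=
  leviCivita C g x u v
    + (1 / 2 : ℝ) • sharp (g x) fun w => extD C (omega g J) x ![J x u, J x v, J x w]

/-- The Bismut-Ricci form `ρ^B(u, v) = tr (J ∘ R^B(u, v)) / 2`; for a Kähler metric it is the Ricci
form `Ric(J u, v)`. -/
noncomputable def rhoB (x : B) (u v : V) : ℝ :=
  (1 / 2) * tr fun w => J x (curvature C (bismut C g J) x u v w)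

/-- The `(1,1)`-part of the Bismut-Ricci form. -/
noncomputable def rhoB11 (x : B) (u v : V) : ℝ :=
  (1 / 2) * (rhoB C g J x u v + rhoB C g J x (J x u) (J x v))

/-- The identity `d(ω^{n-1}) = θ ∧ ω^{n-1}` at `x`. -/
def LeeAt (n : ℕ) (θ : B → V → ℝ) (x : B) : Prop :=
  ∀ v, extD C (fun y => wedgePow (omega g J y) (n - 1)) x v
    = wedgeOne (θ x) (wedgePow (omega g J x) (n - 1)) v

end Calculus

/-! ## Lie derivatives in a chart -/

section LieDerivative

variable {E : Type*} [NormedAddCommGroup E] [NormedSpace ℝ E]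

/-- The Lie derivative `L_X α` of a covariant `k`-tensor. -/
noncomputable def lieD {k : ℕ} (X : E → E) (α : E → (Fin k → E) → ℝ) (x : E) (v : Fin k → E) : ℝ :=
  fderiv ℝ (fun y => α y v) x (X x) + ∑ i, α x (Function.update v i (fderiv ℝ X x (v i)))

/-- The Lie derivative `(L_X J) u` of an endomorphism field. -/
noncomputable def lieDEnd (X : E → E) (J : E → E → E) (x u : E) : E :=
  fderiv ℝ (fun y => J y u) x (X x) - fderiv ℝ X x (J x u) + J x (fderiv ℝ X x u)

end LieDerivative

/-! ## Tensor fields on a manifold, read in charts -/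

section Manifold

variable {E : Type*} [NormedAddCommGroup E] [NormedSpace ℝ E]
  {M : Type*} [TopologicalSpace M] [ChartedSpace E M]

/-- The coordinate frame at the point with coordinates `x` in the chart at `p`: the differential of
the inverse of the chart. -/
noncomputable def frame (p : M) (x : E) : E →L[ℝ] TangentSpace 𝓘(ℝ, E) ((chartAt E p).symm x) :=
  mfderiv 𝓘(ℝ, E) 𝓘(ℝ, E) (chartAt E p).symm x

/-- Components of a bilinear form field. -/
noncomputable def chartBil (g : ∀ q : M, LinearMap.BilinForm ℝ (TangentSpace 𝓘(ℝ, E) q)) (p : M)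
    (x u v : E) : ℝ :=
  g ((chartAt E p).symm x) (frame p x u) (frame p x v)

/-- Components of an endomorphism field. -/
noncomputable def chartEnd (J : ∀ q : M, Module.End ℝ (TangentSpace 𝓘(ℝ, E) q)) (p : M)
    (x u : E) : E :=
  (frame p x).inverse (J ((chartAt E p).symm x) (frame p x u))

/-- Components of a vector field. -/
noncomputable def chartVec (X : ∀ q : M, TangentSpace 𝓘(ℝ, E) q) (p : M) (x : E) : E :=
  (frame p x).inverse (X ((chartAt E p).symm x))

/-- Components of a differential `k`-form. -/
noncomputable def chartForm {k : ℕ} (H : ∀ q : M, (TangentSpace 𝓘(ℝ, E) q) [⋀^Fin k]→ₗ[ℝ] ℝ)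
    (p : M) (x : E) (v : Fin k → E) : ℝ :=
  H ((chartAt E p).symm x) fun i => frame p x (v i)

/-- Components of a `1`-form. -/
noncomputable def chartOne (θ : ∀ q : M, Module.Dual ℝ (TangentSpace 𝓘(ℝ, E) q)) (p : M)
    (x u : E) : ℝ :=
  θ ((chartAt E p).symm x) (frame p x u)

/-- The property `P` holds at every point `x` of (the image of) every chart `chartAt E p`. -/
def InCharts (P : M → E → Prop) : Prop := ∀ p : M, ∀ x ∈ (chartAt E p).target, P p x

/-- A smooth vector field. -/
def IsSmoothVec (X : ∀ q : M, TangentSpace 𝓘(ℝ, E) q) : Prop :=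
  ∀ p : M, ContDiffOn ℝ ∞ (chartVec X p) (chartAt E p).target

/-- A smooth `1`-form. -/
def IsSmoothOne (θ : ∀ q : M, Module.Dual ℝ (TangentSpace 𝓘(ℝ, E) q)) : Prop :=
  ∀ p : M, ∀ u : E, ContDiffOn ℝ ∞ (fun x => chartOne θ p x u) (chartAt E p).target

/-- A smooth `k`-form. -/
def IsSmoothForm {k : ℕ} (H : ∀ q : M, (TangentSpace 𝓘(ℝ, E) q) [⋀^Fin k]→ₗ[ℝ] ℝ) : Prop :=
  ∀ p : M, ∀ v : Fin k → E, ContDiffOn ℝ ∞ (fun x => chartForm H p x v) (chartAt E p).target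

variable [FiniteDimensional ℝ E]

/-- An integrable almost complex structure. -/
structure IsComplexStructure (J : ∀ q : M, Module.End ℝ (TangentSpace 𝓘(ℝ, E) q)) : Prop where
  sq : ∀ q u, J q (J q u) = -u
  smooth : ∀ p : M, ∀ u : E, ContDiffOn ℝ ∞ (fun x => chartEnd J p x u) (chartAt E p).target
  integrable : InCharts fun (p : M) (x : E) =>
    ∀ u v, nijenhuis (chartCalc E) (chartEnd J p) x u v = 0

/-- A `J`-Hermitian Riemannian metric which is SKT: `d d^c ω = 0`. -/
structure IsSKT (J : ∀ q : M, Module.End ℝ (TangentSpace 𝓘(ℝ, E) q))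
    (g : ∀ q : M, LinearMap.BilinForm ℝ (TangentSpace 𝓘(ℝ, E) q)) : Prop where
  symm : ∀ q u v, g q u v = g q v u
  pos : ∀ q u, u ≠ 0 → 0 < g q u u
  smooth : ∀ p : M, ∀ u v : E, ContDiffOn ℝ ∞ (fun x => chartBil g p x u v) (chartAt E p).target
  hermitian : ∀ q u v, g q (J q u) (J q v) = g q u v
  skt : InCharts fun (p : M) (x : E) =>
    ∀ v, extD (chartCalc E) (dcOmega (chartCalc E) (chartBil g p) (chartEnd J p)) x v = 0

/-- `θ` is the Lee form of `(J, g)`, where `n` is the complex dimension: the `1`-form with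
`d ω^{n-1} = θ ∧ ω^{n-1}`. -/
structure IsLeeForm (n : ℕ) (J : ∀ q : M, Module.End ℝ (TangentSpace 𝓘(ℝ, E) q))
    (g : ∀ q : M, LinearMap.BilinForm ℝ (TangentSpace 𝓘(ℝ, E) q))
    (θ : ∀ q : M, Module.Dual ℝ (TangentSpace 𝓘(ℝ, E) q)) : Prop where
  smooth : IsSmoothOne θ
  eq : InCharts fun (p : M) (x : E) =>
    LeeAt (chartCalc E) (chartBil g p) (chartEnd J p) n (chartOne θ p) x

/-- The vector field `θ^♯`. -/
noncomputable def sharpField (g : ∀ q : M, LinearMap.BilinForm ℝ (TangentSpace 𝓘(ℝ, E) q))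
    (θ : ∀ q : M, Module.Dual ℝ (TangentSpace 𝓘(ℝ, E) q)) (q : M) : TangentSpace 𝓘(ℝ, E) q :=
  sharp (V := E) (fun u v => g q u v) (fun u => θ q u)

/-- `H = d^c ω`. -/
def IsDcOmega (J : ∀ q : M, Module.End ℝ (TangentSpace 𝓘(ℝ, E) q))
    (g : ∀ q : M, LinearMap.BilinForm ℝ (TangentSpace 𝓘(ℝ, E) q))
    (H : ∀ q : M, (TangentSpace 𝓘(ℝ, E) q) [⋀^Fin 3]→ₗ[ℝ] ℝ) : Prop :=
  InCharts fun (p : M) (x : E) =>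
    ∀ v, chartForm H p x v = dcOmega (chartCalc E) (chartBil g p) (chartEnd J p) x v

/-- `Y` is a (real) holomorphic vector field: it is smooth and `L_Y J = 0`. -/
structure IsHolomorphic (J : ∀ q : M, Module.End ℝ (TangentSpace 𝓘(ℝ, E) q))
    (Y : ∀ q : M, TangentSpace 𝓘(ℝ, E) q) : Prop where
  smooth : IsSmoothVec Y
  lie : InCharts fun (p : M) (x : E) => ∀ u, lieDEnd (chartVec Y p) (chartEnd J p) x u = 0

/-- `(g, H, X)` is a soliton of the generalized Ricci flow with constant `lam`: `H` is a closed
`3`-form, `Ric^B_{g,H} = lam g + L_X g / 2` and `Δ_g H = -2 lam H - L_X H`. -/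
structure IsGenSoliton (g : ∀ q : M, LinearMap.BilinForm ℝ (TangentSpace 𝓘(ℝ, E) q))
    (H : ∀ q : M, (TangentSpace 𝓘(ℝ, E) q) [⋀^Fin 3]→ₗ[ℝ] ℝ)
    (X : ∀ q : M, TangentSpace 𝓘(ℝ, E) q) (lam : ℝ) : Prop where
  smoothH : IsSmoothForm H
  smoothX : IsSmoothVec X
  closed : InCharts fun (p : M) (x : E) => ∀ v, extD (chartCalc E) (chartForm H p) x v = 0
  metric : InCharts fun (p : M) (x : E) => ∀ u v,
    ricB (chartCalc E) (chartBil g p) (chartForm H p) x u v = lam * chartBil g p x u v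
      + (1 / 2) * lieD (chartVec X p) (fun y w => chartBil g p y (w 0) (w 1)) x ![u, v]
  form : InCharts fun (p : M) (x : E) => ∀ v,
    laplacian (chartCalc E) (chartBil g p) (chartForm H p) x v = -2 * lam * chartForm H p x v
      - lieD (chartVec X p) (chartForm H p) x v

/-- `(ω, Y)` is a soliton of the pluriclosed flow with constant `lam`: `Y` is holomorphic and
`(ρ^B)^{1,1} = lam ω + L_Y ω / 2`. -/
structure IsPluriclosedSoliton (J : ∀ q : M, Module.End ℝ (TangentSpace 𝓘(ℝ, E) q))
    (g : ∀ q : M, LinearMap.BilinForm ℝ (TangentSpace 𝓘(ℝ, E) q))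
    (Y : ∀ q : M, TangentSpace 𝓘(ℝ, E) q) (lam : ℝ) : Prop where
  holomorphic : IsHolomorphic J Y
  eq : InCharts fun (p : M) (x : E) => ∀ u v,
    rhoB11 (chartCalc E) (chartBil g p) (chartEnd J p) x u v
      = lam * omega (chartBil g p) (chartEnd J p) x ![u, v]
        + (1 / 2) * lieD (chartVec Y p) (omega (chartBil g p) (chartEnd J p)) x ![u, v]

/-- The triple `(g, H, X)` is a pluriclosed soliton with constant `lam`: it is the triple
`(g, d^c ω, Y - θ^♯)` of a pluriclosed soliton `(ω, Y)`, where `θ` is the Lee form. -/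
def IsPluriclosedTriple (J : ∀ q : M, Module.End ℝ (TangentSpace 𝓘(ℝ, E) q))
    (g : ∀ q : M, LinearMap.BilinForm ℝ (TangentSpace 𝓘(ℝ, E) q))
    (θ : ∀ q : M, Module.Dual ℝ (TangentSpace 𝓘(ℝ, E) q))
    (H : ∀ q : M, (TangentSpace 𝓘(ℝ, E) q) [⋀^Fin 3]→ₗ[ℝ] ℝ)
    (X : ∀ q : M, TangentSpace 𝓘(ℝ, E) q) (lam : ℝ) : Prop :=
  ∃ Y : ∀ q : M, TangentSpace 𝓘(ℝ, E) q, IsPluriclosedSoliton J g Y lam ∧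
    IsDcOmega J g H ∧ ∀ q, X q = Y q - sharpField g θ q

end Manifold

/-! ## Left-invariant structures, as tensors on the Lie algebra -/

section LieAlgebra

variable {𝔤 : Type*} [LieRing 𝔤] [LieAlgebra ℝ 𝔤] [FiniteDimensional ℝ 𝔤]

/-- A left-invariant SKT structure: an integrable complex structure `J` and a `J`-Hermitian inner
product `g` with `d d^c ω = 0`. -/
structure IsLieSKT (J : Module.End ℝ 𝔤) (g : LinearMap.BilinForm ℝ 𝔤) : Prop where
  sq : ∀ u, J (J u) = -u
  integrable : ∀ u v, nijenhuis (lieCalc 𝔤) (fun _ => J) () u v = 0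
  symm : ∀ u v, g u v = g v u
  pos : ∀ u, u ≠ 0 → 0 < g u u
  hermitian : ∀ u v, g (J u) (J v) = g u v
  skt : ∀ v, extD (lieCalc 𝔤)
    (dcOmega (lieCalc 𝔤) (fun _ u v => g u v) (fun _ => J)) () v = 0

/-- `θ` is the Lee form: `d ω^{n-1} = θ ∧ ω^{n-1}`, with `n` the complex dimension. -/
def IsLieLeeForm (n : ℕ) (J : Module.End ℝ 𝔤) (g : LinearMap.BilinForm ℝ 𝔤)
    (θ : Module.Dual ℝ 𝔤) : Prop :=
  LeeAt (lieCalc 𝔤) (fun _ u v => g u v) (fun _ => J) n (fun _ u => θ u) ()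

/-- `H = d^c ω`. -/
def IsLieDcOmega (J : Module.End ℝ 𝔤) (g : LinearMap.BilinForm ℝ 𝔤)
    (H : 𝔤 [⋀^Fin 3]→ₗ[ℝ] ℝ) : Prop :=
  ∀ v, H v = dcOmega (lieCalc 𝔤) (fun _ u v => g u v) (fun _ => J) () v

/-- `Ric^B_{μ,H}` as an endomorphism. -/
noncomputable def lieRicB (g : LinearMap.BilinForm ℝ 𝔤) (H : 𝔤 [⋀^Fin 3]→ₗ[ℝ] ℝ) (u : 𝔤) : 𝔤 :=
  sharp (fun a b => g a b) fun w => ricB (lieCalc 𝔤) (fun _ a b => g a b) (fun _ => H) () u w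

/-- The action `(ρ(A) H)(u, v, w) = -H(Au, v, w) - H(u, Av, w) - H(u, v, Aw)`. -/
def rhoAct (A : 𝔤 → 𝔤) (H : 𝔤 [⋀^Fin 3]→ₗ[ℝ] ℝ) (v : Fin 3 → 𝔤) : ℝ :=
  -∑ i, H (Function.update v i (A (v i)))

/-- `(g, H, D)`, with `D` a derivation, is an algebraic soliton of the generalized Ricci flow:
`H` is closed and, for some real `lam`, `Ric^B_{μ,H} = lam Id + D` and
`Δ_μ H = lam H + ρ(Ric^B_{μ,H}) H`. -/
def IsAlgGenSoliton (g : LinearMap.BilinForm ℝ 𝔤) (H : 𝔤 [⋀^Fin 3]→ₗ[ℝ] ℝ)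
    (D : LieDerivation ℝ 𝔤 𝔤) (lam : ℝ) : Prop :=
  (∀ v, extD (lieCalc 𝔤) (fun _ => H) () v = 0) ∧
  (∀ u, lieRicB g H u = lam • u + D u) ∧
  ∀ v, laplacian (lieCalc 𝔤) (fun _ a b => g a b) (fun _ => H) () v
    = lam * H v + rhoAct (lieRicB g H) H v

/-- `(J, g)` is an algebraic pluriclosed soliton with data `D'`, `lam`: `D'` is a derivation
commuting with `J` and `P = lam Id + (D' + D'^t) / 2`, where `ω(P·,·) = (ρ^B)^{1,1}` and `D'^t` is
the `g`-transpose of `D'`. -/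
def IsAlgPluriclosedSoliton (J : Module.End ℝ 𝔤) (g : LinearMap.BilinForm ℝ 𝔤)
    (D' : LieDerivation ℝ 𝔤 𝔤) (lam : ℝ) : Prop :=
  (∀ u, D' (J u) = J (D' u)) ∧
  ∃ P : Module.End ℝ 𝔤,
    (∀ u v, omega (fun _ a b => g a b) (fun _ => J) () ![P u, v]
      = rhoB11 (lieCalc 𝔤) (fun _ a b => g a b) (fun _ => J) () u v) ∧
    ∀ u, P u = lam • u
      + (1 / 2 : ℝ) • (D' u + sharp (fun a b => g a b) fun w => g u (D' w))

/-- The vector `θ^♯`. -/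
noncomputable def lieSharp (g : LinearMap.BilinForm ℝ 𝔤) (θ : Module.Dual ℝ 𝔤) : 𝔤 :=
  sharp (fun a b => g a b) fun u => θ u

/-- The triple `(g, H, D)` is an algebraic pluriclosed soliton: it is the triple
`(g, d^c ω, D' + ad_{θ^♯})` of an algebraic pluriclosed soliton with derivation `D'`. -/
def IsAlgPluriclosedTriple (J : Module.End ℝ 𝔤) (g : LinearMap.BilinForm ℝ 𝔤)
    (θ : Module.Dual ℝ 𝔤) (H : 𝔤 [⋀^Fin 3]→ₗ[ℝ] ℝ) (D : LieDerivation ℝ 𝔤 𝔤) (lam : ℝ) : Prop :=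
  ∃ D' : LieDerivation ℝ 𝔤 𝔤, IsAlgPluriclosedSoliton J g D' lam ∧ IsLieDcOmega J g H ∧
    D = D' + LieDerivation.ad ℝ 𝔤 (lieSharp g θ)

end LieAlgebra

end PluriSol

open PluriSol

/-!
Both parts of the theorem are statements about components of tensor fields in a frame: the
coordinate frame of a chart, or a left-invariant frame on a Lie algebra. The structure
`SmoothCalculus` lists the rules of differentiation shared by the two situations
(`smoothCalculus_chartCalc`, `smoothCalculus_lieCalc`), and the arguments below use nothing else.
Lie derivatives and the closedness of the Bismut-Ricci form are only needed in charts, and there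
the frame commutes.

*The Lee form.* Evaluating `dω^{n-1} = θ ∧ ω^{n-1}` on `(u, e_2, J e_2, …, e_n, J e_n)`, for a
unitary frame which begins with a unit vector `u`, gives `θ(u) = ∑ dω(u, e_i, J e_i)`, so that `θ`
is a trace of the torsion of the Bismut connection (`lee_eq_leeTrace`).

*The Bismut-Ricci form.* Let `H = d^c ω`. The Bismut connection is metric, has torsion `T = -H`
and preserves `J` (`bismut_parallel`); the last point is the integrability of `J`. When `T` is
closed, exchanging the two pairs of arguments of its curvature gives the curvature of the
connection with torsion `-T`, and the first Bianchi identity of the latter, together with the fact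
that the curvature commutes with `J`, yields (`IsInner.trace_curvature_J`, `rho_torsConn`,
`rho_J`) `ρ^B(X, JZ) = Ric^B(X, Z) + d^*H(X, Z) / 2 + (∇_X θ)(Z) + H(X, Z, θ^♯) / 2`. Here
`Ric^B = Ric - H² / 4` is symmetric, and the terms in `H` are skew. The symmetric part of the
identity computes the `(1,1)`-part of `ρ^B` (`rho11_J`):
`(ρ^B)^{1,1}(X, JZ) = Ric^B(X, Z) + (L_{θ^♯} g)(X, Z) / 2`.

*The metric equations.* If `Y` is holomorphic, then `(L_Y ω)(X, JZ) = (L_Y g)(X, Z)`. Hence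
`(ρ^B)^{1,1} = λ ω + L_Y ω / 2` and `Ric^B = λ g + L_{Y - θ^♯} g / 2` are equivalent, with the
same `λ` (`soliton_metric_iff`). This settles the equivalence for solitons on a complex manifold.
The same identity settles it for algebraic solitons, since there the derivation `D` is symmetric,
because `Ric^B` is (`isAlgPluriclosedTriple_iff`).

*The equation for `H`.* It remains to see that a pluriclosed soliton satisfies
`ΔH = -2λH - L_{Y - θ^♯} H`, where `ΔH = -dd^*H`. As the Bismut connection preserves `J`, the
second Bianchi identity gives `dρ^B = 0` (`dTwo_tr_J_curvature`). Let `σ` be the part of `ρ^B` of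
type `(2,0) + (0,2)`; then `dσ = -d(λ ω + L_Y ω / 2)`. On one hand, the skew part of the identity
for `ρ^B` is `2 σ(·, J·) = d^*H + dθ + ι_{θ^♯} H`, whose exterior derivative is
`dd^*H + L_{θ^♯} H`, as `dH = 0`. On the other hand, type considerations (`dTwo_J_invariant`,
`dTwo_J_antiinvariant`) determine `d(σ(·, J·))` from `dσ`, and since `L_Y` commutes with `d` and
with `J` (`dTwo_lieTwo`, `lieThree_J`), it is `λ H + L_Y H / 2`. Comparing the two gives the
equation (`soliton_form`).
-/

set_option linter.unusedSectionVars false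

namespace PluriSol

/-! ### Linear algebra of an inner product -/

section LinearAlgebra

variable {V : Type*} [AddCommGroup V] [Module ℝ V] [FiniteDimensional ℝ V]

/-- A symmetric positive definite bilinear form. -/
structure IsInner (G : LinearMap.BilinForm ℝ V) : Prop where
  symm : ∀ u v, G u v = G v u
  pos : ∀ u, u ≠ 0 → 0 < G u u

/-- The metric trace `g^{ij} Q(b_i, b_j)` of a covariant `2`-tensor. -/
noncomputable def gtr (g Q : V → V → ℝ) : ℝ :=
  ∑ i, ∑ j, ginv g i j * Q (Module.finBasis ℝ V i) (Module.finBasis ℝ V j)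

/-- Bilinearity of a function of two vectors. -/
structure IsBilin {W : Type*} [AddCommGroup W] [Module ℝ W] (F : V → V → W) : Prop where
  left : ∀ b, IsLinearMap ℝ fun a => F a b
  right : ∀ a, IsLinearMap ℝ (F a)

omit [FiniteDimensional ℝ V] in
theorem IsInner.ext {G : LinearMap.BilinForm ℝ V} (hG : IsInner G) {u v : V}
    (h : ∀ w, G u w = G v w) : u = v := by
  by_contra hne
  have h1 := hG.pos (u - v) (sub_ne_zero.2 hne)
  have h2 := h (u - v)
  have h3 : G (u - v) (u - v) = G u (u - v) - G v (u - v) := by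
    simp only [map_sub, LinearMap.sub_apply]; ring
  rw [h3, h2, sub_self] at h1
  exact lt_irrefl _ h1

/-- The Gram matrix of a bilinear form in the basis `finBasis`. -/
noncomputable def gram (g : V → V → ℝ) :
    Matrix (Fin (Module.finrank ℝ V)) (Fin (Module.finrank ℝ V)) ℝ :=
  Matrix.of fun a b => g (Module.finBasis ℝ V a) (Module.finBasis ℝ V b)

theorem IsInner.gram_det_ne_zero {G : LinearMap.BilinForm ℝ V} (hG : IsInner G) :
    (gram fun u v => G u v).det ≠ 0 := by
  intro h0
  obtain ⟨c, hc, hc0⟩ := Matrix.exists_vecMul_eq_zero_iff.2 h0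
  set b := Module.finBasis ℝ V
  have key : ∀ w, G (∑ i, c i • b i) w = 0 := by
    intro w
    have hz : G (∑ i, c i • b i) = 0 := by
      refine b.ext fun j => ?_
      have := congrFun hc0 j
      simpa [Matrix.vecMul, dotProduct, gram, b] using this
    rw [hz]; rfl
  have hv : ∑ i, c i • b i = 0 := hG.ext fun w => by rw [key w]; simp
  apply hc
  funext i
  exact (Fintype.linearIndependent_iff.1 b.linearIndependent) c hv i

theorem ginv_eq (g : V → V → ℝ) (i j : Fin (Module.finrank ℝ V)) : ginv g i j = (gram g)⁻¹ i j := rfl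

theorem IsInner.gram_symm {G : LinearMap.BilinForm ℝ V} (hG : IsInner G) :
    (gram fun u v => G u v).transpose = gram fun u v => G u v := by
  ext i j; simp [gram, hG.symm]

theorem IsInner.ginv_symm {G : LinearMap.BilinForm ℝ V} (hG : IsInner G)
    (i j : Fin (Module.finrank ℝ V)) :
    ginv (fun u v => G u v) i j = ginv (fun u v => G u v) j i := by
  have h := Matrix.transpose_nonsing_inv (gram fun u v => G u v)
  rw [hG.gram_symm] at h
  exact congrFun (congrFun h j) i

theorem IsInner.sum_ginv {G : LinearMap.BilinForm ℝ V} (hG : IsInner G)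
    (i k : Fin (Module.finrank ℝ V)) :
    ∑ j, ginv (fun u v => G u v) i j * G (Module.finBasis ℝ V j) (Module.finBasis ℝ V k)
      = if i = k then 1 else 0 := by
  have := congrFun (congrFun (Matrix.nonsing_inv_mul _ (isUnit_iff_ne_zero.2 hG.gram_det_ne_zero)) i) k
  rw [Matrix.one_apply, Matrix.mul_apply] at this
  exact this

theorem IsInner.sharp_apply {G : LinearMap.BilinForm ℝ V} (hG : IsInner G) {α : V → ℝ}
    (hα : IsLinearMap ℝ α) (w : V) : G (sharp (fun u v => G u v) α) w = α w := by
  suffices h : G (sharp (fun u v => G u v) α) = hα.mk' α by rw [h]; rfl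
  refine (Module.finBasis ℝ V).ext fun k => ?_
  simp only [sharp, map_sum, LinearMap.sum_apply, map_smul, LinearMap.smul_apply, smul_eq_mul,
    IsLinearMap.mk'_apply]
  rw [Finset.sum_comm]
  have : ∀ j, ∑ i, ginv (fun u v => G u v) i j * α (Module.finBasis ℝ V j)
      * G (Module.finBasis ℝ V i) (Module.finBasis ℝ V k)
      = (if j = k then 1 else 0) * α (Module.finBasis ℝ V j) := by
    intro j
    rw [← hG.sum_ginv j k, Finset.sum_mul]
    refine Finset.sum_congr rfl fun i _ => ?_
    rw [hG.ginv_symm i j]; ring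
  simp [this]

theorem IsInner.sharp_eq {G : LinearMap.BilinForm ℝ V} (hG : IsInner G) {α : V → ℝ} {v : V}
    (h : ∀ w, G v w = α w) : sharp (fun u v => G u v) α = v := by
  have hα : IsLinearMap ℝ α := by
    have : α = G v := funext fun w => (h w).symm
    rw [this]; exact (G v).isLinear
  exact hG.ext fun w => by rw [hG.sharp_apply hα, h]

theorem sharp_add (g : V → V → ℝ) (α β : V → ℝ) :
    sharp g (fun w => α w + β w) = sharp g α + sharp g β := by
  simp [sharp, mul_add, add_smul, Finset.sum_add_distrib]

theorem sharp_smul (g : V → V → ℝ) (c : ℝ) (α : V → ℝ) :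
    sharp g (fun w => c * α w) = c • sharp g α := by
  simp only [sharp, Finset.smul_sum, smul_smul]
  refine Finset.sum_congr rfl fun i _ => Finset.sum_congr rfl fun j _ => ?_
  ring_nf

theorem tr_eq_trace (A : V →ₗ[ℝ] V) : tr (fun u => A u) = LinearMap.trace ℝ V A := by
  rw [LinearMap.trace_eq_matrix_trace ℝ (Module.finBasis ℝ V)]
  simp [tr, Matrix.trace, LinearMap.toMatrix_apply]

theorem gtr_eq_tr (g Q : V → V → ℝ) : gtr g Q = tr fun a => sharp g (Q a) := by
  simp only [gtr, tr, sharp, map_sum, map_smul, Module.Basis.coord_apply, Module.Basis.repr_self,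
    smul_eq_mul, Finsupp.single_apply]
  simp only [mul_ite, mul_one, mul_zero]
  refine Finset.sum_congr rfl fun i _ => ?_
  rw [Finset.sum_comm]
  simp

theorem gtr_add (g Q Q' : V → V → ℝ) :
    gtr g (fun a b => Q a b + Q' a b) = gtr g Q + gtr g Q' := by
  simp [gtr, mul_add, Finset.sum_add_distrib]

theorem gtr_smul (g Q : V → V → ℝ) (c : ℝ) : gtr g (fun a b => c * Q a b) = c * gtr g Q := by
  simp only [gtr, Finset.mul_sum]
  refine Finset.sum_congr rfl fun i _ => Finset.sum_congr rfl fun j _ => ?_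
  ring

theorem gtr_sub (g Q Q' : V → V → ℝ) :
    gtr g (fun a b => Q a b - Q' a b) = gtr g Q - gtr g Q' := by
  simp [gtr, mul_sub, Finset.sum_sub_distrib]

theorem gtr_neg (g Q : V → V → ℝ) : gtr g (fun a b => -Q a b) = -gtr g Q := by
  simp [gtr, Finset.sum_neg_distrib]

theorem IsInner.gtr_swap {G : LinearMap.BilinForm ℝ V} (hG : IsInner G) (Q : V → V → ℝ) :
    gtr (fun u v => G u v) (fun a b => Q b a) = gtr (fun u v => G u v) Q := by
  rw [gtr, Finset.sum_comm, gtr]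
  refine Finset.sum_congr rfl fun i _ => Finset.sum_congr rfl fun j _ => ?_
  rw [hG.ginv_symm]

theorem IsInner.gtr_eq_zero {G : LinearMap.BilinForm ℝ V} (hG : IsInner G) {Q : V → V → ℝ}
    (hQ : ∀ a b, Q b a = -Q a b) : gtr (fun u v => G u v) Q = 0 := by
  have h1 := hG.gtr_swap Q
  have h2 : (fun a b => Q b a) = fun a b => -Q a b := by funext a b; exact hQ a b
  rw [h2, gtr_neg] at h1
  linarith

/-- The endomorphism representing a bilinear form in an inner product. -/
noncomputable def IsBilin.endo {Q : V → V → ℝ} (hQ : IsBilin Q) (G : LinearMap.BilinForm ℝ V) :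
    Module.End ℝ V where
  toFun a := sharp (fun u v => G u v) (Q a)
  map_add' a b := by
    rw [← sharp_add]; congr 1; funext w; exact (hQ.left w).map_add a b
  map_smul' c a := by
    simp only [RingHom.id_apply]
    rw [← sharp_smul]; congr 1; funext w; exact (hQ.left w).map_smul c a

theorem IsInner.gtr_eq_trace {G : LinearMap.BilinForm ℝ V} (hG : IsInner G) {Q : V → V → ℝ}
    (A : Module.End ℝ V) (hA : ∀ a b, Q a b = G (A a) b) :
    gtr (fun u v => G u v) Q = LinearMap.trace ℝ V A := by
  rw [gtr_eq_tr, ← tr_eq_trace]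
  congr 1; funext a
  exact hG.sharp_eq fun w => (hA a w).symm

theorem IsInner.endo_apply {G : LinearMap.BilinForm ℝ V} (hG : IsInner G) {Q : V → V → ℝ}
    (hQ : IsBilin Q) (a b : V) : G (hQ.endo G a) b = Q a b :=
  hG.sharp_apply (hQ.right a) b

/-- The metric trace is invariant under an isometry `J` with `J² = -1`. -/
theorem IsInner.gtr_J_J {G : LinearMap.BilinForm ℝ V} (hG : IsInner G) {J : Module.End ℝ V}
    (hJ : ∀ u, J (J u) = -u) (hH : ∀ u v, G (J u) (J v) = G u v) {Q : V → V → ℝ}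
    (hQ : IsBilin Q) :
    gtr (fun u v => G u v) (fun a b => Q (J a) (J b)) = gtr (fun u v => G u v) Q := by
  have hsk : ∀ u v, G u (J v) = -G (J u) v := by
    intro u v
    have := hH (J u) v
    rw [hJ] at this
    simp at this; linarith
  set A := hQ.endo G
  rw [hG.gtr_eq_trace (-(J * (A * J))), hG.gtr_eq_trace A]
  · rw [map_neg, LinearMap.trace_mul_comm, mul_assoc]
    have : J * J = -1 := by ext u; simp [hJ]
    rw [this]; simp
  · intro a b; exact (hG.endo_apply hQ a b).symm
  · intro a b
    rw [← hG.endo_apply hQ (J a) (J b), hsk]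
    simp [A]

/-- The trace `g^{ab} Q(a, J b)` changes sign when `J` is moved to the other argument. -/
theorem IsInner.gtr_right_J {G : LinearMap.BilinForm ℝ V} (hG : IsInner G) {J : Module.End ℝ V}
    (hJ : ∀ u, J (J u) = -u) (hH : ∀ u v, G (J u) (J v) = G u v) {Q : V → V → ℝ}
    (hQ : IsBilin Q) :
    gtr (fun u v => G u v) (fun a b => Q a (J b))
      = -gtr (fun u v => G u v) (fun a b => Q (J b) a) := by
  have hQ' : IsBilin fun a b => Q a (J b) :=
    ⟨fun b => hQ.left _, fun a => ⟨fun x y => by simp [(hQ.right _).map_add], fun c x => by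
      simp only [map_smul]; exact (hQ.right _).map_smul c _⟩⟩
  rw [← hG.gtr_J_J hJ hH hQ', ← gtr_neg, ← hG.gtr_swap (fun a b => -Q (J b) a)]
  congr 1; funext a b
  rw [hJ]; simpa using (hQ.right (J a)).map_neg b

/-- Parseval's identity for the metric trace. -/
theorem IsInner.gtr_mul {G : LinearMap.BilinForm ℝ V} (hG : IsInner G) {α : V → ℝ}
    (hα : IsLinearMap ℝ α) (β : V → ℝ) :
    gtr (fun u v => G u v) (fun a b => α a * β b)
      = G (sharp (fun u v => G u v) α) (sharp (fun u v => G u v) β) := by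
  rw [hG.sharp_apply hα]
  have hl : α (sharp (fun u v => G u v) β) = (hα.mk' α) (sharp (fun u v => G u v) β) := rfl
  rw [hl, sharp, gtr]
  simp only [map_sum, map_smul, smul_eq_mul, IsLinearMap.mk'_apply]
  refine Finset.sum_congr rfl fun i _ => Finset.sum_congr rfl fun j _ => ?_
  ring

/-- The metric trace is the sum over an orthonormal basis. -/
theorem IsInner.gtr_eq_sum {G : LinearMap.BilinForm ℝ V} (hG : IsInner G) {ι : Type*} [Fintype ι]
    [DecidableEq ι] (e : Module.Basis ι ℝ V) (he : ∀ i j, G (e i) (e j) = if i = j then 1 else 0)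
    {Q : V → V → ℝ} (hQ : IsBilin Q) :
    gtr (fun u v => G u v) Q = ∑ i, Q (e i) (e i) := by
  rw [hG.gtr_eq_trace (hQ.endo G) fun a b => (hG.endo_apply hQ a b).symm,
    LinearMap.trace_eq_matrix_trace ℝ e]
  simp only [Matrix.trace, Matrix.diag_apply, LinearMap.toMatrix_apply]
  refine Finset.sum_congr rfl fun i _ => ?_
  rw [← hG.endo_apply hQ]
  have h : ∀ v, G v (e i) = e.repr v i := by
    intro v
    have : G v (e i) = G (∑ j, e.repr v j • e j) (e i) := by rw [e.sum_repr]
    rw [this, map_sum, LinearMap.sum_apply]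
    simp [he]
  rw [h]

theorem innerTwo_eq (g α β : V → V → ℝ) :
    innerTwo g α β = gtr g fun a b => gtr g fun c d => α a c * β b d := by
  simp only [innerTwo, gtr, Finset.mul_sum]
  refine Finset.sum_congr rfl fun i _ => ?_
  rw [Finset.sum_comm]
  refine Finset.sum_congr rfl fun j _ => ?_
  refine Finset.sum_congr rfl fun a _ => ?_
  refine Finset.sum_congr rfl fun b _ => ?_
  ring

end LinearAlgebra

/-! ### Rules of differentiation in a frame -/

section Calculus

variable {B V : Type*} [AddCommGroup V] [Module ℝ V]

/-- A vector field whose components belong to the algebra `A` of functions. -/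
def VecIn (A : Subalgebra ℝ (B → ℝ)) (Y : B → V) : Prop :=
  ∀ l : Module.Dual ℝ V, (fun y => l (Y y)) ∈ A

/-- The rules of differentiation for a frame calculus, over a set `S` of points and for an algebra
`A` of functions, thought of as those that are smooth on `S`. Only values on `S` matter. -/
structure SmoothCalculus (C : FrameCalculus B V) (S : Set B) (A : Subalgebra ℝ (B → ℝ)) :
    Prop where
  mem_congr : ∀ {f g : B → ℝ}, f ∈ A → (∀ x ∈ S, f x = g x) → g ∈ A
  inv_mem : ∀ {f : B → ℝ}, f ∈ A → (∀ x ∈ S, f x ≠ 0) → (fun y => (f y)⁻¹) ∈ A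
  der_mem : ∀ (u : V) {f : B → ℝ}, f ∈ A → C.derS u f ∈ A
  der_congr : ∀ (u : V) {f g : B → ℝ}, (∀ x ∈ S, f x = g x) →
    ∀ x ∈ S, C.derS u f x = C.derS u g x
  der_const : ∀ (u : V) (c : ℝ), ∀ x ∈ S, C.derS u (fun _ => c) x = 0
  der_add : ∀ (u : V) {f g : B → ℝ}, f ∈ A → g ∈ A → ∀ x ∈ S,
    C.derS u (fun y => f y + g y) x = C.derS u f x + C.derS u g x
  der_mul : ∀ (u : V) {f g : B → ℝ}, f ∈ A → g ∈ A → ∀ x ∈ S,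
    C.derS u (fun y => f y * g y) x = C.derS u f x * g x + f x * C.derS u g x
  der_add_left : ∀ (u v : V) {f : B → ℝ}, f ∈ A → ∀ x ∈ S,
    C.derS (u + v) f x = C.derS u f x + C.derS v f x
  der_smul_left : ∀ (c : ℝ) (u : V) {f : B → ℝ}, f ∈ A → ∀ x ∈ S,
    C.derS (c • u) f x = c * C.derS u f x
  der_comm : ∀ (u v : V) {f : B → ℝ}, f ∈ A → ∀ x ∈ S,
    C.derS u (C.derS v f) x - C.derS v (C.derS u f) x = C.derS (C.br u v) f x
  br_add_left : ∀ u v w, C.br (u + v) w = C.br u w + C.br v w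
  br_smul_left : ∀ (c : ℝ) (u v : V), C.br (c • u) v = c • C.br u v
  br_skew : ∀ u v, C.br v u = -C.br u v
  jacobi : ∀ u v w, C.br u (C.br v w) + C.br v (C.br w u) + C.br w (C.br u v) = 0
  derV_apply : ∀ (u : V) {Y : B → V}, VecIn A Y → ∀ x ∈ S, ∀ l : Module.Dual ℝ V,
    l (C.derV u Y x) = C.derS u (fun y => l (Y y)) x

variable {C : FrameCalculus B V} {S : Set B} {A : Subalgebra ℝ (B → ℝ)}

theorem const_mem (c : ℝ) : (fun _ : B => c) ∈ A := A.algebraMap_mem c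

theorem fun_add_mem {f g : B → ℝ} (hf : f ∈ A) (hg : g ∈ A) : (fun y => f y + g y) ∈ A :=
  A.add_mem hf hg

theorem fun_sub_mem {f g : B → ℝ} (hf : f ∈ A) (hg : g ∈ A) : (fun y => f y - g y) ∈ A :=
  A.sub_mem hf hg

theorem fun_neg_mem {f : B → ℝ} (hf : f ∈ A) : (fun y => -f y) ∈ A :=
  A.neg_mem hf

theorem fun_mul_mem {f g : B → ℝ} (hf : f ∈ A) (hg : g ∈ A) : (fun y => f y * g y) ∈ A :=
  A.mul_mem hf hg

theorem fun_sum_mem {ι : Type*} (s : Finset ι) {f : ι → B → ℝ} (h : ∀ i ∈ s, f i ∈ A) :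
    (fun y => ∑ i ∈ s, f i y) ∈ A := by
  have : (fun y => ∑ i ∈ s, f i y) = ∑ i ∈ s, f i := by funext y; simp
  rw [this]
  exact A.sum_mem h

theorem sum_repr_eq [FiniteDimensional ℝ V] {F : V → ℝ} (hF : IsLinearMap ℝ F) (v : V) :
    F v = ∑ i, (Module.finBasis ℝ V).coord i v * F (Module.finBasis ℝ V i) := by
  have : F v = hF.mk' F (∑ i, (Module.finBasis ℝ V).repr v i • Module.finBasis ℝ V i) := by
    rw [Module.Basis.sum_repr]; rfl
  rw [this]
  simp only [map_sum, map_smul, smul_eq_mul, IsLinearMap.mk'_apply, Module.Basis.coord_apply]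

theorem VecIn.const (v : V) : VecIn A fun _ : B => v := fun l => const_mem (l v)

theorem VecIn.add {Y Z : B → V} (hY : VecIn A Y) (hZ : VecIn A Z) : VecIn A fun y => Y y + Z y := by
  intro l
  simp only [map_add]
  exact A.add_mem (hY l) (hZ l)

theorem VecIn.smul {f : B → ℝ} {Y : B → V} (hf : f ∈ A) (hY : VecIn A Y) :
    VecIn A fun y => f y • Y y := by
  intro l
  simp only [map_smul, smul_eq_mul]
  exact A.mul_mem hf (hY l)

theorem VecIn.const_smul (c : ℝ) {Y : B → V} (hY : VecIn A Y) : VecIn A fun y => c • Y y :=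
  VecIn.smul (const_mem c) hY

theorem VecIn.neg {Y : B → V} (hY : VecIn A Y) : VecIn A fun y => -Y y := by
  intro l
  simp only [map_neg]
  exact A.neg_mem (hY l)

theorem VecIn.sub {Y Z : B → V} (hY : VecIn A Y) (hZ : VecIn A Z) : VecIn A fun y => Y y - Z y := by
  intro l
  simp only [map_sub]
  exact A.sub_mem (hY l) (hZ l)

theorem VecIn.sum {ι : Type*} (s : Finset ι) {Y : ι → B → V} (h : ∀ i ∈ s, VecIn A (Y i)) :
    VecIn A fun y => ∑ i ∈ s, Y i y := by
  intro l
  have : (fun y => l (∑ i ∈ s, Y i y)) = ∑ i ∈ s, fun y => l (Y i y) := by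
    funext y; simp
  rw [this]
  exact A.sum_mem fun i hi => h i hi l

namespace SmoothCalculus

variable (hC : SmoothCalculus C S A)
include hC

theorem vecIn_congr {Y Z : B → V} (hY : VecIn A Y) (h : ∀ x ∈ S, Y x = Z x) : VecIn A Z :=
  fun l => hC.mem_congr (hY l) fun x hx => by rw [h x hx]

theorem der_const_mul (u : V) (c : ℝ) {f : B → ℝ} (hf : f ∈ A) {x : B} (hx : x ∈ S) :
    C.derS u (fun y => c * f y) x = c * C.derS u f x := by
  rw [hC.der_mul u (const_mem c) hf x hx, hC.der_const u c x hx]; ring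

theorem der_neg (u : V) {f : B → ℝ} (hf : f ∈ A) {x : B} (hx : x ∈ S) :
    C.derS u (fun y => -f y) x = -C.derS u f x := by
  have := hC.der_const_mul u (-1) hf hx
  simpa using this

theorem der_sub (u : V) {f g : B → ℝ} (hf : f ∈ A) (hg : g ∈ A) {x : B} (hx : x ∈ S) :
    C.derS u (fun y => f y - g y) x = C.derS u f x - C.derS u g x := by
  have h := hC.der_add u hf (A.neg_mem hg) x hx
  have h2 := hC.der_neg u hg hx
  simp only [Pi.neg_apply, ← sub_eq_add_neg] at h
  rw [h, sub_eq_add_neg, ← h2]; rfl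

theorem der_sum (u : V) {ι : Type*} (s : Finset ι) {f : ι → B → ℝ} (hf : ∀ i ∈ s, f i ∈ A) {x : B}
    (hx : x ∈ S) : C.derS u (fun y => ∑ i ∈ s, f i y) x = ∑ i ∈ s, C.derS u (f i) x := by
  classical
  induction s using Finset.induction_on with
  | empty => simpa using hC.der_const u 0 x hx
  | insert a s ha ih =>
    simp only [Finset.sum_insert ha]
    have hs : (fun y => ∑ i ∈ s, f i y) ∈ A :=
      fun_sum_mem s fun i hi => hf i (Finset.mem_insert_of_mem hi)
    rw [hC.der_add u (hf a (Finset.mem_insert_self a s)) hs x hx,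
      ih fun i hi => hf i (Finset.mem_insert_of_mem hi)]

theorem der_zero_left {f : B → ℝ} (hf : f ∈ A) {x : B} (hx : x ∈ S) : C.derS 0 f x = 0 := by
  have := hC.der_smul_left 0 0 hf x hx
  simpa using this

theorem der_isLinear {f : B → ℝ} (hf : f ∈ A) {x : B} (hx : x ∈ S) :
    IsLinearMap ℝ fun u => C.derS u f x :=
  ⟨fun u v => hC.der_add_left u v hf x hx, fun c u => hC.der_smul_left c u hf x hx⟩

theorem br_bilin : IsBilin C.br :=
  ⟨fun w => ⟨fun u v => hC.br_add_left u v w, fun c u => hC.br_smul_left c u w⟩,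
    fun w => ⟨fun u v => by
      rw [hC.br_skew, hC.br_add_left, hC.br_skew w, hC.br_skew w, neg_add, neg_neg, neg_neg],
      fun c u => by rw [hC.br_skew, hC.br_smul_left, hC.br_skew w]; simp⟩⟩

theorem derV_ext (u : V) {Y : B → V} (hY : VecIn A Y) {x : B} (hx : x ∈ S) {v : V}
    (h : ∀ l : Module.Dual ℝ V, C.derS u (fun y => l (Y y)) x = l v) : C.derV u Y x = v := by
  rw [← sub_eq_zero, ← Module.forall_dual_apply_eq_zero_iff ℝ]
  intro l
  rw [map_sub, hC.derV_apply u hY x hx l, h l, sub_self]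

theorem derV_congr (u : V) {Y Z : B → V} (hY : VecIn A Y) (h : ∀ x ∈ S, Y x = Z x) {x : B}
    (hx : x ∈ S) : C.derV u Y x = C.derV u Z x :=
  hC.derV_ext u hY hx fun l => by
    rw [hC.derV_apply u (hC.vecIn_congr hY h) x hx l]
    exact hC.der_congr u (fun y hy => by rw [h y hy]) x hx

theorem vecIn_derV (u : V) {Y : B → V} (hY : VecIn A Y) : VecIn A (C.derV u Y) :=
  fun l => hC.mem_congr (hC.der_mem u (hY l)) fun x hx => (hC.derV_apply u hY x hx l).symm

theorem derV_const (u v : V) {x : B} (hx : x ∈ S) : C.derV u (fun _ => v) x = 0 :=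
  hC.derV_ext u (VecIn.const v) hx fun l => by rw [hC.der_const u _ x hx, map_zero]

theorem derV_add (u : V) {Y Z : B → V} (hY : VecIn A Y) (hZ : VecIn A Z) {x : B} (hx : x ∈ S) :
    C.derV u (fun y => Y y + Z y) x = C.derV u Y x + C.derV u Z x :=
  hC.derV_ext u (hY.add hZ) hx fun l => by
    simp only [map_add, hC.derV_apply u hY x hx, hC.derV_apply u hZ x hx]
    exact hC.der_add u (hY l) (hZ l) x hx

theorem derV_const_smul (u : V) (c : ℝ) {Y : B → V} (hY : VecIn A Y) {x : B} (hx : x ∈ S) :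
    C.derV u (fun y => c • Y y) x = c • C.derV u Y x :=
  hC.derV_ext u (hY.const_smul c) hx fun l => by
    simp only [map_smul, smul_eq_mul, hC.derV_apply u hY x hx]
    exact hC.der_const_mul u c (hY l) hx

theorem derV_neg (u : V) {Y : B → V} (hY : VecIn A Y) {x : B} (hx : x ∈ S) :
    C.derV u (fun y => -Y y) x = -C.derV u Y x := by
  simpa using hC.derV_const_smul u (-1) hY hx

theorem derV_sub (u : V) {Y Z : B → V} (hY : VecIn A Y) (hZ : VecIn A Z) {x : B} (hx : x ∈ S) :
    C.derV u (fun y => Y y - Z y) x = C.derV u Y x - C.derV u Z x := by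
  simp only [sub_eq_add_neg]
  rw [hC.derV_add u hY hZ.neg hx, hC.derV_neg u hZ hx]

theorem derV_isLinear {Y : B → V} (hY : VecIn A Y) {x : B} (hx : x ∈ S) :
    IsLinearMap ℝ fun u => C.derV u Y x := by
  constructor
  · intro u v
    exact hC.derV_ext _ hY hx fun l => by
      rw [hC.der_add_left u v (hY l) x hx, map_add, hC.derV_apply u hY x hx, hC.derV_apply v hY x hx]
  · intro c u
    exact hC.derV_ext _ hY hx fun l => by
      rw [hC.der_smul_left c u (hY l) x hx, map_smul, hC.derV_apply u hY x hx, smul_eq_mul]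

theorem derV_comm (u v : V) {Y : B → V} (hY : VecIn A Y) {x : B} (hx : x ∈ S) :
    C.derV u (C.derV v Y) x - C.derV v (C.derV u Y) x = C.derV (C.br u v) Y x := by
  symm
  refine hC.derV_ext _ hY hx fun l => ?_
  rw [← hC.der_comm u v (hY l) x hx, map_sub, hC.derV_apply u (hC.vecIn_derV v hY) x hx,
    hC.derV_apply v (hC.vecIn_derV u hY) x hx]
  congr 1
  · exact hC.der_congr u (fun y hy => (hC.derV_apply v hY y hy l).symm) x hx
  · exact hC.der_congr v (fun y hy => (hC.derV_apply u hY y hy l).symm) x hx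

variable [FiniteDimensional ℝ V]

/-- A `1`-form with components in `A`, applied to a vector field, is in `A`. -/
theorem apply_mem {F : B → V → ℝ} (hF : ∀ y ∈ S, IsLinearMap ℝ (F y))
    (hm : ∀ v, (fun y => F y v) ∈ A) {Y : B → V} (hY : VecIn A Y) : (fun y => F y (Y y)) ∈ A := by
  refine hC.mem_congr (fun_sum_mem Finset.univ fun i _ => fun_mul_mem
    (hY ((Module.finBasis ℝ V).coord i)) (hm (Module.finBasis ℝ V i))) fun x hx => ?_
  rw [sum_repr_eq (hF x hx) (Y x)]

/-- The Leibniz rule for a `1`-form applied to a vector field. Used one argument at a time, it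
differentiates every contraction of tensor fields. -/
theorem der_apply (u : V) {F : B → V → ℝ} (hF : ∀ y ∈ S, IsLinearMap ℝ (F y))
    (hm : ∀ v, (fun y => F y v) ∈ A) {Y : B → V} (hY : VecIn A Y) {x : B} (hx : x ∈ S) :
    C.derS u (fun y => F y (Y y)) x
      = C.derS u (fun y => F y (Y x)) x + F x (C.derV u Y x) := by
  set b := Module.finBasis ℝ V
  have e1 : C.derS u (fun y => F y (Y y)) x
      = ∑ i, C.derS u (fun y => b.coord i (Y y) * F y (b i)) x := by
    rw [← hC.der_sum u _ (fun i _ => fun_mul_mem (hY _) (hm _)) hx]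
    exact hC.der_congr u (fun y hy => sum_repr_eq (hF y hy) (Y y)) x hx
  have e2 : C.derS u (fun y => F y (Y x)) x
      = ∑ i, C.derS u (fun y => b.coord i (Y x) * F y (b i)) x := by
    rw [← hC.der_sum u _ (fun i _ => fun_mul_mem (const_mem _) (hm _)) hx]
    exact hC.der_congr u (fun y hy => sum_repr_eq (hF y hy) (Y x)) x hx
  rw [e1, e2, sum_repr_eq (hF x hx) (C.derV u Y x), ← Finset.sum_add_distrib]
  refine Finset.sum_congr rfl fun i _ => ?_
  rw [hC.der_mul u (hY _) (hm _) x hx, hC.der_const_mul u _ (hm _) hx, hC.derV_apply u hY x hx]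
  ring

theorem vecIn_apply {F : B → V → V} (hF : ∀ y ∈ S, IsLinearMap ℝ (F y))
    (hm : ∀ v, VecIn A fun y => F y v) {Y : B → V} (hY : VecIn A Y) :
    VecIn A fun y => F y (Y y) := fun l =>
  hC.apply_mem (F := fun y v => l (F y v))
    (fun y hy => ⟨fun a b => by rw [(hF y hy).map_add, map_add], fun c a => by
      rw [(hF y hy).map_smul, map_smul]⟩) (fun v => hm v l) hY

theorem derV_vecIn_apply (u : V) {F : B → V → V} (hF : ∀ y ∈ S, IsLinearMap ℝ (F y))
    (hm : ∀ v, VecIn A fun y => F y v) {Y : B → V} (hY : VecIn A Y) {x : B} (hx : x ∈ S) :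
    C.derV u (fun y => F y (Y y)) x
      = C.derV u (fun y => F y (Y x)) x + F x (C.derV u Y x) := by
  refine hC.derV_ext u (hC.vecIn_apply hF hm hY) hx fun l => ?_
  rw [map_add, hC.derV_apply u (hm _) x hx]
  exact hC.der_apply u (F := fun y v => l (F y v))
    (fun y hy => ⟨fun a b => by rw [(hF y hy).map_add, map_add], fun c a => by
      rw [(hF y hy).map_smul, map_smul]⟩) (fun v => hm v l) hY hx

end SmoothCalculus

end Calculus

/-! ### Connections and curvature -/

section Connections

variable {B V : Type*} [AddCommGroup V] [Module ℝ V] [FiniteDimensional ℝ V]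

/-- A Riemannian metric on `S` with components in `A`. -/
structure IsMetricField (S : Set B) (A : Subalgebra ℝ (B → ℝ)) (G : B → LinearMap.BilinForm ℝ V) :
    Prop where
  inner : ∀ x ∈ S, IsInner (G x)
  mem : ∀ u v, (fun y => G y u v) ∈ A

/-- The coefficients `Λ(u, v) = ∇_u v` of a connection, bilinear on `S` and with components
in `A`. -/
structure IsConnection (S : Set B) (A : Subalgebra ℝ (B → ℝ)) (L : B → V → V → V) : Prop where
  bilin : ∀ x ∈ S, IsBilin (L x)
  mem : ∀ u v, VecIn A fun y => L y u v

/-- The covariant derivative `∇_u Y` of a vector field. -/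
def covD (C : FrameCalculus B V) (L : B → V → V → V) (u : V) (Y : B → V) (x : B) : V :=
  C.derV u Y x + L x u (Y x)

/-- `∇ g = 0`. -/
def IsMetricConn (C : FrameCalculus B V) (S : Set B) (G : B → LinearMap.BilinForm ℝ V)
    (L : B → V → V → V) : Prop :=
  ∀ x ∈ S, ∀ u v w, C.derS u (fun y => G y v w) x = G x (L x u v) w + G x v (L x u w)

/-- `∇ J = 0`. -/
def IsParallelEnd (C : FrameCalculus B V) (S : Set B) (J : B → Module.End ℝ V)
    (L : B → V → V → V) : Prop :=
  ∀ x ∈ S, ∀ u v, C.derV u (fun y => J y v) x + L x u (J x v) = J x (L x u v)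

/-- `∇` is free of torsion. -/
def IsTorsionFree (C : FrameCalculus B V) (S : Set B) (L : B → V → V → V) : Prop :=
  ∀ x ∈ S, ∀ u v, L x u v - L x v u = C.br u v

variable {C : FrameCalculus B V} {S : Set B} {A : Subalgebra ℝ (B → ℝ)}

omit [Module ℝ V] [FiniteDimensional ℝ V] in
theorem curvature_const {L : B → V → V → V} (u v w : V) (x : B) :
    covD C L u (fun y => L y v w) x - covD C L v (fun y => L y u w) x - L x (C.br u v) w
      = curvature C L x u v w := rfl

theorem det_mem {n : Type*} [Fintype n] [DecidableEq n] {M : B → Matrix n n ℝ}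
    (h : ∀ i j, (fun y => M y i j) ∈ A) : (fun y => (M y).det) ∈ A := by
  simp only [Matrix.det_apply']
  refine fun_sum_mem _ fun s _ => fun_mul_mem (const_mem _) ?_
  have : (fun y => ∏ i, M y (s i) i) = ∏ i, fun y => M y (s i) i := by funext y; simp
  rw [this]
  exact A.prod_mem fun i _ => h _ _

namespace SmoothCalculus

variable (hC : SmoothCalculus C S A)
include hC

section Metric

variable {G : B → LinearMap.BilinForm ℝ V} (hG : IsMetricField S A G)
include hG

theorem ginv_mem (i j : Fin (Module.finrank ℝ V)) :
    (fun y => ginv (fun u v => G y u v) i j) ∈ A := by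
  have hM : ∀ i j, (fun y => gram (fun u v => G y u v) i j) ∈ A := fun i j => hG.mem _ _
  have hdet := hC.inv_mem (det_mem hM) fun x hx => (hG.inner x hx).gram_det_ne_zero
  have hadj : (fun y => (gram (fun u v => G y u v)).adjugate i j) ∈ A := by
    simp only [Matrix.adjugate_apply]
    refine det_mem fun a b => ?_
    by_cases h : a = j
    · subst h; simp only [Matrix.updateRow_self]; exact const_mem _
    · simp only [Matrix.updateRow_ne h]; exact hM a b
  have := fun_mul_mem hdet hadj
  refine hC.mem_congr this fun x _ => ?_
  rw [ginv_eq, Matrix.inv_def]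
  simp [Ring.inverse_eq_inv']

theorem vecIn_sharp {a : B → V → ℝ} (ha : ∀ v, (fun y => a y v) ∈ A) :
    VecIn A fun y => sharp (fun u v => G y u v) (a y) :=
  VecIn.sum _ fun i _ => VecIn.sum _ fun j _ =>
    VecIn.smul (fun_mul_mem (hC.ginv_mem hG i j) (ha _)) (VecIn.const _)

theorem gtr_mem {Q : B → V → V → ℝ} (hQ : ∀ a b, (fun y => Q y a b) ∈ A) :
    (fun y => gtr (fun u v => G y u v) (Q y)) ∈ A :=
  fun_sum_mem _ fun i _ => fun_sum_mem _ fun j _ =>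
    fun_mul_mem (hC.ginv_mem hG i j) (hQ _ _)

theorem metric_apply_mem {Y Z : B → V} (hY : VecIn A Y) (hZ : VecIn A Z) :
    (fun y => G y (Y y) (Z y)) ∈ A :=
  hC.apply_mem (F := fun y z => G y (Y y) z) (fun y _ => (G y (Y y)).isLinear)
    (fun z => hC.apply_mem (F := fun y v => G y v z)
      (fun y _ => ⟨by simp, by simp⟩) (fun v => hG.mem v z) hY) hZ

theorem der_metric_apply (u : V) {Y Z : B → V} (hY : VecIn A Y) (hZ : VecIn A Z) {x : B}
    (hx : x ∈ S) : C.derS u (fun y => G y (Y y) (Z y)) x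
      = C.derS u (fun y => G y (Y x) (Z x)) x + G x (C.derV u Y x) (Z x)
        + G x (Y x) (C.derV u Z x) := by
  rw [hC.der_apply u (F := fun y z => G y (Y y) z) (fun y _ => (G y (Y y)).isLinear)
    (fun z => hC.metric_apply_mem hG hY (VecIn.const z)) hZ hx,
    hC.der_apply u (F := fun y v => G y v (Z x)) (fun y _ => ⟨by simp, by simp⟩)
    (fun v => hG.mem v _) hY hx]

theorem der_metric_covD {L : B → V → V → V} (hm : IsMetricConn C S G L) (u : V) {Y Z : B → V}
    (hY : VecIn A Y) (hZ : VecIn A Z) {x : B} (hx : x ∈ S) :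
    C.derS u (fun y => G y (Y y) (Z y)) x
      = G x (covD C L u Y x) (Z x) + G x (Y x) (covD C L u Z x) := by
  rw [hC.der_metric_apply hG u hY hZ hx, hm x hx]
  simp only [covD, map_add, LinearMap.add_apply]
  ring

end Metric

/-- A field of endomorphisms applied to a vector field. -/
theorem vecIn_end_apply {J : B → Module.End ℝ V} (hJ : ∀ v, VecIn A fun y => J y v) {Y : B → V}
    (hY : VecIn A Y) : VecIn A fun y => J y (Y y) :=
  hC.vecIn_apply (F := fun y v => J y v) (fun y _ => (J y).isLinear) hJ hY

theorem covD_parallel {L : B → V → V → V} {J : B → Module.End ℝ V} (hJ : ∀ v, VecIn A fun y => J y v)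
    (hp : IsParallelEnd C S J L) (u : V) {Y : B → V} (hY : VecIn A Y) {x : B} (hx : x ∈ S) :
    covD C L u (fun y => J y (Y y)) x = J x (covD C L u Y x) := by
  rw [covD, hC.derV_vecIn_apply u (F := fun y v => J y v) (fun y _ => (J y).isLinear) hJ hY hx,
    add_right_comm, hp x hx, covD, map_add, add_comm]

theorem covD_congr {L : B → V → V → V} (u : V) {Y Z : B → V} (hY : VecIn A Y)
    (h : ∀ x ∈ S, Y x = Z x) {x : B} (hx : x ∈ S) : covD C L u Y x = covD C L u Z x := by
  rw [covD, covD, hC.derV_congr u hY h hx, h x hx]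

section Curvature

variable {L : B → V → V → V} (hL : IsConnection S A L)
include hL

theorem vecIn_conn_apply (u : V) {Y : B → V} (hY : VecIn A Y) : VecIn A fun y => L y u (Y y) :=
  hC.vecIn_apply (F := fun y => L y u) (fun y hy => (hL.bilin y hy).right u) (fun v => hL.mem u v) hY

theorem vecIn_covD (u : V) {Y : B → V} (hY : VecIn A Y) : VecIn A (covD C L u Y) :=
  (hC.vecIn_derV u hY).add (hC.vecIn_conn_apply hL u hY)

/-- The curvature applied to a vector field: `R(u, v) Y = ∇_u ∇_v Y - ∇_v ∇_u Y - ∇_{[u,v]} Y`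
depends only on the value of `Y` at the point. -/
theorem covD_covD (u v : V) {Y : B → V} (hY : VecIn A Y) {x : B} (hx : x ∈ S) :
    covD C L u (covD C L v Y) x - covD C L v (covD C L u Y) x - covD C L (C.br u v) Y x
      = curvature C L x u v (Y x) := by
  have h1 : ∀ u v, covD C L u (covD C L v Y) x = C.derV u (C.derV v Y) x
      + (C.derV u (fun y => L y v (Y x)) x + L x v (C.derV u Y x))
      + (L x u (C.derV v Y x) + L x u (L x v (Y x))) := by
    intro u v
    have : covD C L v Y = fun y => C.derV v Y y + L y v (Y y) := rfl
    rw [covD, this, hC.derV_add u (hC.vecIn_derV v hY) (hC.vecIn_conn_apply hL v hY) hx,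
      hC.derV_vecIn_apply u (F := fun y => L y v) (fun y hy => (hL.bilin y hy).right v)
        (fun w => hL.mem v w) hY hx, ((hL.bilin x hx).right u).map_add]
  rw [h1, h1, covD, ← hC.derV_comm u v hY hx, curvature]
  abel

theorem curvature_swap (u v w : V) {x : B} (hx : x ∈ S) :
    curvature C L x v u w = -curvature C L x u v w := by
  rw [curvature, curvature, hC.br_skew u v, ((hL.bilin x hx).left w).map_neg]
  abel

theorem curvature_linear_right (u v : V) {x : B} (hx : x ∈ S) :
    IsLinearMap ℝ fun w => curvature C L x u v w := by
  have hadd : ∀ u v w w', C.derV u (fun y => L y v (w + w')) x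
      = C.derV u (fun y => L y v w) x + C.derV u (fun y => L y v w') x := by
    intro u v w w'
    rw [← hC.derV_add u (hL.mem v w) (hL.mem v w') hx]
    exact hC.derV_congr u (hL.mem v _) (fun y hy => ((hL.bilin y hy).right v).map_add w w') hx
  have hsmul : ∀ u v (c : ℝ) w, C.derV u (fun y => L y v (c • w)) x
      = c • C.derV u (fun y => L y v w) x := by
    intro u v c w
    rw [← hC.derV_const_smul u c (hL.mem v w) hx]
    exact hC.derV_congr u (hL.mem v _) (fun y hy => ((hL.bilin y hy).right v).map_smul c w) hx
  have hb := hL.bilin x hx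
  constructor
  · intro w w'
    simp only [curvature, hadd, (hb.right _).map_add]
    abel
  · intro c w
    simp only [curvature, hsmul, (hb.right _).map_smul]
    module

theorem curvature_linear_left (v w : V) {x : B} (hx : x ∈ S) :
    IsLinearMap ℝ fun u => curvature C L x u v w := by
  have hadd : ∀ u v w w', C.derV u (fun y => L y (v + w') w) x
      = C.derV u (fun y => L y v w) x + C.derV u (fun y => L y w' w) x := by
    intro u v w w'
    rw [← hC.derV_add u (hL.mem v w) (hL.mem w' w) hx]
    exact hC.derV_congr u (hL.mem _ _) (fun y hy => ((hL.bilin y hy).left w).map_add v w') hx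
  have hsmul : ∀ u v (c : ℝ) w, C.derV u (fun y => L y (c • v) w) x
      = c • C.derV u (fun y => L y v w) x := by
    intro u v c w
    rw [← hC.derV_const_smul u c (hL.mem v w) hx]
    exact hC.derV_congr u (hL.mem _ _) (fun y hy => ((hL.bilin y hy).left w).map_smul c v) hx
  have hb := hL.bilin x hx
  have l1 : ∀ a b c, L x (a + b) c = L x a c + L x b c := fun a b c => (hb.left c).map_add a b
  have l2 : ∀ (r : ℝ) a c, L x (r • a) c = r • L x a c := fun r a c => (hb.left c).map_smul r a
  have hD := fun Y (hY : VecIn A Y) => hC.derV_isLinear hY hx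
  constructor
  · intro u u'
    simp only [curvature, hadd, l1, (hb.right _).map_add, hC.br_add_left,
      (hD _ (hL.mem v w)).map_add]
    abel
  · intro c u
    simp only [curvature, hsmul, l2, (hb.right _).map_smul, hC.br_smul_left,
      (hD _ (hL.mem v w)).map_smul]
    module

/-- The curvature of a metric connection is skew-symmetric. -/
theorem curvature_metric {G : B → LinearMap.BilinForm ℝ V} (hG : IsMetricField S A G)
    (hm : IsMetricConn C S G L) (u v w z : V) {x : B} (hx : x ∈ S) :
    G x (curvature C L x u v w) z = -G x w (curvature C L x u v z) := by
  have h1 : ∀ u v, C.derS u (C.derS v fun y => G y w z) x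
      = G x (covD C L u (fun y => L y v w) x) z + G x (L x v w) (L x u z)
        + (G x (L x u w) (L x v z) + G x w (covD C L u (fun y => L y v z) x)) := by
    intro u v
    have ha : ∀ w : V, VecIn A fun _ : B => w := VecIn.const
    have hb : ∀ w, covD C L u (fun _ => w) x = L x u w := by
      intro w; rw [covD, hC.derV_const u w hx, zero_add]
    rw [hC.der_congr u (fun y hy => hm y hy v w z) x hx,
      hC.der_add u (hC.metric_apply_mem hG (hL.mem v w) (ha z))
        (hC.metric_apply_mem hG (ha w) (hL.mem v z)) x hx,
      hC.der_metric_covD hG hm u (hL.mem v w) (ha z) hx,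
      hC.der_metric_covD hG hm u (ha w) (hL.mem v z) hx, hb, hb]
  have h2 := hC.der_comm u v (hG.mem w z) x hx
  rw [h1, h1, hm x hx] at h2
  rw [← curvature_const u v w x, ← curvature_const u v z x]
  simp only [map_sub, LinearMap.sub_apply]
  linarith

/-- The curvature commutes with a parallel endomorphism. -/
theorem curvature_parallel {J : B → Module.End ℝ V} (hJ : ∀ v, VecIn A fun y => J y v)
    (hp : IsParallelEnd C S J L) (u v w : V) {x : B} (hx : x ∈ S) :
    curvature C L x u v (J x w) = J x (curvature C L x u v w) := by
  have hw := VecIn.const (A := A) w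
  rw [← hC.covD_covD hL u v (hJ w) hx, ← hC.covD_covD hL u v (Y := fun _ => w) hw hx]
  have h1 : ∀ u v, covD C L u (covD C L v fun y => J y w) x
      = J x (covD C L u (covD C L v fun _ => w) x) := by
    intro u v
    have hS : ∀ y ∈ S, J y (covD C L v (fun _ => w) y) = covD C L v (fun y => J y w) y :=
      fun y hy => (hC.covD_parallel hJ hp v hw hy).symm
    have hv := hC.vecIn_end_apply hJ (hC.vecIn_covD hL v hw)
    rw [← hC.covD_parallel hJ hp u (hC.vecIn_covD hL v hw), hC.covD_congr u hv hS hx]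
    exact hx
  rw [h1, h1, hC.covD_parallel hJ hp _ hw hx]
  simp only [map_sub]

/-- The first Bianchi identity of a torsion-free connection. -/
theorem curvature_bianchi (ht : IsTorsionFree C S L) (u v w : V) {x : B} (hx : x ∈ S) :
    curvature C L x u v w + curvature C L x v w u + curvature C L x w u v = 0 := by
  have hb := hL.bilin x hx
  have h1 : ∀ u v w, C.derV u (fun y => L y v w) x = C.derV u (fun y => L y w v) x := by
    intro u v w
    rw [← sub_eq_zero, ← hC.derV_sub u (hL.mem v w) (hL.mem w v) hx,
      hC.derV_congr u ((hL.mem v w).sub (hL.mem w v)) (fun y hy => ht y hy v w) hx,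
      hC.derV_const u _ hx]
  have h2 : ∀ u v w, L x u (L x v w) - L x u (L x w v) = L x u (C.br v w) := by
    intro u v w
    rw [← (hb.right u).map_sub, ht x hx]
  have h3 : ∀ u v w, L x u (C.br v w) - L x (C.br v w) u = C.br u (C.br v w) :=
    fun u v w => ht x hx _ _
  have hj := hC.jacobi u v w
  rw [← h3, ← h3, ← h3, ← h2, ← h2, ← h2] at hj
  rw [curvature, curvature, curvature, h1 u w v, h1 v u w, h1 w v u, ← hj]
  abel

end Curvature

end SmoothCalculus
end Connections

/-! ### The Levi-Civita connection and metric connections with skew torsion -/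

section LeviCivita

variable {B V : Type*} [AddCommGroup V] [Module ℝ V] [FiniteDimensional ℝ V]
  {C : FrameCalculus B V} {S : Set B} {A : Subalgebra ℝ (B → ℝ)}
  {G : B → LinearMap.BilinForm ℝ V}

/-- The Levi-Civita connection of a metric given by bundled bilinear forms. -/
noncomputable abbrev lc (C : FrameCalculus B V) (G : B → LinearMap.BilinForm ℝ V) :
    B → V → V → V :=
  leviCivita C fun y u v => G y u v

namespace SmoothCalculus

variable (hC : SmoothCalculus C S A) (hG : IsMetricField S A G)
include hC hG

theorem koszul_mem (u v w : V) : (fun x => (1 / 2 : ℝ) *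
    (C.derS u (fun y => G y v w) x + C.derS v (fun y => G y u w) x - C.derS w (fun y => G y u v) x
      + G x (C.br u v) w - G x (C.br u w) v - G x (C.br v w) u)) ∈ A :=
  fun_mul_mem (const_mem _) (fun_sub_mem (fun_sub_mem (fun_add_mem (fun_sub_mem (fun_add_mem
    (hC.der_mem u (hG.mem v w)) (hC.der_mem v (hG.mem u w))) (hC.der_mem w (hG.mem u v)))
    (hG.mem _ _)) (hG.mem _ _)) (hG.mem _ _))

theorem der_metric_symm (u v w : V) {x : B} (hx : x ∈ S) :
    C.derS u (fun y => G y v w) x = C.derS u (fun y => G y w v) x :=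
  hC.der_congr u (fun y hy => (hG.inner y hy).symm v w) x hx

theorem lc_apply (u v w : V) {x : B} (hx : x ∈ S) : G x (lc C G x u v) w = (1 / 2 : ℝ) *
    (C.derS u (fun y => G y v w) x + C.derS v (fun y => G y u w) x - C.derS w (fun y => G y u v) x
      + G x (C.br u v) w - G x (C.br u w) v - G x (C.br v w) u) := by
  have hw := hC.der_isLinear (hG.mem u v) hx
  have hb := hC.br_bilin
  refine (hG.inner x hx).sharp_apply ⟨fun w w' => ?_, fun c w => ?_⟩ w
  · simp only [hw.map_add, (hb.right _).map_add, map_add, LinearMap.add_apply]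
    have e1 := hC.der_add u (hG.mem v w) (hG.mem v w') x hx
    have e2 := hC.der_add v (hG.mem u w) (hG.mem u w') x hx
    rw [e1, e2]; ring
  · simp only [hw.map_smul, (hb.right _).map_smul, map_smul, LinearMap.smul_apply, smul_eq_mul]
    have e1 := hC.der_const_mul u c (hG.mem v w) hx
    have e2 := hC.der_const_mul v c (hG.mem u w) hx
    rw [e1, e2]; ring

theorem lc_isConnection : IsConnection S A (lc C G) where
  bilin x hx := by
    have hw := fun u v => hC.der_isLinear (hG.mem u v) hx
    have hb := hC.br_bilin
    have hl : ∀ w a b, C.br (a + b) w = C.br a w + C.br b w := fun w => (hb.left w).map_add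
    have hl' : ∀ w (c : ℝ) b, C.br (c • b) w = c • C.br b w := fun w => (hb.left w).map_smul
    constructor
    · refine fun v => ⟨fun u u' => (hG.inner x hx).ext fun w => ?_,
        fun c u => (hG.inner x hx).ext fun w => ?_⟩
      · simp only [map_add, LinearMap.add_apply, hC.lc_apply hG _ _ _ hx]
        simp only [(hw _ _).map_add, hl, map_add, LinearMap.add_apply]
        have e1 := hC.der_add v (hG.mem u w) (hG.mem u' w) x hx
        have e2 := hC.der_add w (hG.mem u v) (hG.mem u' v) x hx
        rw [e1, e2]; ring
      · simp only [map_smul, LinearMap.smul_apply, hC.lc_apply hG _ _ _ hx, smul_eq_mul]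
        simp only [(hw _ _).map_smul, hl', map_smul, LinearMap.smul_apply, smul_eq_mul]
        have e1 := hC.der_const_mul v c (hG.mem u w) hx
        have e2 := hC.der_const_mul w c (hG.mem u v) hx
        rw [e1, e2]; ring
    · refine fun u => ⟨fun v v' => (hG.inner x hx).ext fun w => ?_,
        fun c v => (hG.inner x hx).ext fun w => ?_⟩
      · simp only [map_add, LinearMap.add_apply, hC.lc_apply hG _ _ _ hx]
        simp only [(hw _ _).map_add, hl, (hb.right _).map_add, map_add, LinearMap.add_apply]
        have e1 := hC.der_add u (hG.mem v w) (hG.mem v' w) x hx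
        have e2 := hC.der_add w (hG.mem u v) (hG.mem u v') x hx
        rw [e1, e2]; ring
      · simp only [map_smul, LinearMap.smul_apply, hC.lc_apply hG _ _ _ hx, smul_eq_mul]
        simp only [(hw _ _).map_smul, hl', (hb.right _).map_smul, map_smul, LinearMap.smul_apply,
          smul_eq_mul]
        have e1 := hC.der_const_mul u c (hG.mem v w) hx
        have e2 := hC.der_const_mul w c (hG.mem u v) hx
        rw [e1, e2]; ring
  mem u v := hC.vecIn_sharp hG fun w => hC.koszul_mem hG u v w

theorem lc_metric : IsMetricConn C S G (lc C G) := by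
  intro x hx u v w
  rw [(hG.inner x hx).symm v, hC.lc_apply hG u v w hx, hC.lc_apply hG u w v hx,
    hC.der_metric_symm hG u w v hx, hC.der_metric_symm hG v u w hx, hC.der_metric_symm hG w u v hx,
    hC.br_skew v w, hC.der_metric_symm hG w v u hx, hC.der_metric_symm hG v w u hx]
  simp only [map_neg, LinearMap.neg_apply]
  ring

theorem lc_torsionFree : IsTorsionFree C S (lc C G) := by
  intro x hx u v
  refine (hG.inner x hx).ext fun w => ?_
  rw [map_sub, LinearMap.sub_apply, hC.lc_apply hG _ _ _ hx, hC.lc_apply hG _ _ _ hx,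
    hC.der_metric_symm hG w u v hx, hC.br_skew u v]
  simp only [map_neg, LinearMap.neg_apply]
  ring

end SmoothCalculus

end LeviCivita

section Torsion

variable {B V : Type*} [AddCommGroup V] [Module ℝ V] [FiniteDimensional ℝ V]

/-- Alternating trilinear functions. -/
structure IsAlt3 (T : V → V → V → ℝ) : Prop where
  lin : ∀ v w, IsLinearMap ℝ fun u => T u v w
  swap12 : ∀ u v w, T v u w = -T u v w
  swap23 : ∀ u v w, T u w v = -T u v w

theorem IsAlt3.rot {T : V → V → V → ℝ} (h : IsAlt3 T) (u v w : V) : T v w u = T u v w := by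
  rw [h.swap23, h.swap12, neg_neg]

theorem IsAlt3.lin2 {T : V → V → V → ℝ} (h : IsAlt3 T) (u w : V) :
    IsLinearMap ℝ fun v => T u v w :=
  ⟨fun a b => by
    rw [h.swap12, (h.lin u w).map_add, h.swap12 u, h.swap12 u, neg_add, neg_neg, neg_neg],
  fun c a => by
    rw [h.swap12, (h.lin u w).map_smul, h.swap12 u, smul_neg, neg_neg]⟩

theorem IsAlt3.lin3 {T : V → V → V → ℝ} (h : IsAlt3 T) (u v : V) :
    IsLinearMap ℝ fun w => T u v w := by
  have : (fun w => T u v w) = fun w => T w u v := by funext w; exact h.rot w u v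
  rw [this]; exact h.lin u v

/-- A field of `3`-forms on `S`, with components in `A`. -/
structure IsThreeForm (S : Set B) (A : Subalgebra ℝ (B → ℝ)) (T : B → V → V → V → ℝ) : Prop where
  alt : ∀ x ∈ S, IsAlt3 (T x)
  mem : ∀ u v w, (fun y => T y u v w) ∈ A

/-- The tensor `K` with `g(K(u, v), w) = T(u, v, w)`. -/
noncomputable def tors (G : B → LinearMap.BilinForm ℝ V) (T : B → V → V → V → ℝ) (x : B) (u v : V) :
    V :=
  sharp (fun a b => G x a b) (T x u v)

/-- The metric connection with totally skew torsion `T`. -/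
noncomputable def torsConn (C : FrameCalculus B V) (G : B → LinearMap.BilinForm ℝ V)
    (T : B → V → V → V → ℝ) (x : B) (u v : V) : V :=
  lc C G x u v + (1 / 2 : ℝ) • tors G T x u v

/-- The components of `∇T`, for a `3`-tensor `T`. -/
noncomputable def nab3 (C : FrameCalculus B V) (L : B → V → V → V) (T : B → V → V → V → ℝ) (x : B)
    (u v w z : V) : ℝ :=
  C.derS u (fun y => T y v w z) x - T x (L x u v) w z - T x v (L x u w) z - T x v w (L x u z)

variable {C : FrameCalculus B V} {S : Set B} {A : Subalgebra ℝ (B → ℝ)}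
  {G : B → LinearMap.BilinForm ℝ V} {T : B → V → V → V → ℝ}

theorem tors_apply (hG : IsMetricField S A G) (hT : IsThreeForm S A T) {x : B} (hx : x ∈ S)
    (u v w : V) : G x (tors G T x u v) w = T x u v w :=
  (hG.inner x hx).sharp_apply ((hT.alt x hx).lin3 u v) w

theorem tors_swap (hG : IsMetricField S A G) (hT : IsThreeForm S A T) {x : B} (hx : x ∈ S)
    (u v : V) : tors G T x v u = -tors G T x u v :=
  (hG.inner x hx).ext fun w => by
    rw [tors_apply hG hT hx, map_neg, LinearMap.neg_apply, tors_apply hG hT hx,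
      (hT.alt x hx).swap12]

theorem tors_bilin (hG : IsMetricField S A G) (hT : IsThreeForm S A T) {x : B} (hx : x ∈ S) :
    IsBilin (tors G T x) := by
  have hl := fun v => (hT.alt x hx).lin v
  have h2 := fun v => (hT.alt x hx).lin2 v
  constructor
  · refine fun v => ⟨fun a b => (hG.inner x hx).ext fun w => ?_,
      fun c a => (hG.inner x hx).ext fun w => ?_⟩
    · simp only [map_add, LinearMap.add_apply, tors_apply hG hT hx, (hl _ _).map_add]
    · simp only [map_smul, LinearMap.smul_apply, tors_apply hG hT hx, (hl _ _).map_smul]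
  · refine fun v => ⟨fun a b => (hG.inner x hx).ext fun w => ?_,
      fun c a => (hG.inner x hx).ext fun w => ?_⟩
    · simp only [map_add, LinearMap.add_apply, tors_apply hG hT hx, (h2 _ _).map_add]
    · simp only [map_smul, LinearMap.smul_apply, tors_apply hG hT hx, (h2 _ _).map_smul]

namespace SmoothCalculus

variable (hC : SmoothCalculus C S A) (hG : IsMetricField S A G) (hT : IsThreeForm S A T)
include hC hG hT

theorem vecIn_tors (u v : V) : VecIn A fun y => tors G T y u v :=
  hC.vecIn_sharp hG fun w => hT.mem u v w

theorem torsConn_isConnection : IsConnection S A (torsConn C G T) where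
  bilin x hx := by
    have h1 := (hC.lc_isConnection hG).bilin x hx
    have h2 := tors_bilin hG hT hx
    exact ⟨fun v => ((h1.left v).mk' _ + (1 / 2 : ℝ) • (h2.left v).mk' _).isLinear,
      fun u => ((h1.right u).mk' _ + (1 / 2 : ℝ) • (h2.right u).mk' _).isLinear⟩
  mem u v := ((hC.lc_isConnection hG).mem u v).add ((hC.vecIn_tors hG hT u v).const_smul _)

theorem torsConn_metric : IsMetricConn C S G (torsConn C G T) := by
  intro x hx u v w
  rw [hC.lc_metric hG x hx, torsConn, torsConn]
  simp only [map_add, LinearMap.add_apply, map_smul, LinearMap.smul_apply, smul_eq_mul]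
  rw [(hG.inner x hx).symm v (tors G T x u w), tors_apply hG hT hx, tors_apply hG hT hx,
    (hT.alt x hx).swap23 u w v]
  ring

theorem nab3_swap12 (L : B → V → V → V) (u v w z : V) {x : B} (hx : x ∈ S) :
    nab3 C L T x u w v z = -nab3 C L T x u v w z := by
  have h := hT.alt x hx
  rw [nab3, nab3, hC.der_congr u (fun y hy => (hT.alt y hy).swap12 v w z) x hx,
    hC.der_neg u (hT.mem v w z) hx, h.swap12 v, h.swap12 (L x u v), h.swap12 v w]
  ring

theorem nab3_swap23 (L : B → V → V → V) (u v w z : V) {x : B} (hx : x ∈ S) :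
    nab3 C L T x u v z w = -nab3 C L T x u v w z := by
  have h := hT.alt x hx
  rw [nab3, nab3, hC.der_congr u (fun y hy => (hT.alt y hy).swap23 v w z) x hx,
    hC.der_neg u (hT.mem v w z) hx, h.swap23 _ w z, h.swap23 v w, h.swap23 v _ z]
  ring

/-- The curvature of the metric connection with torsion `T`, in terms of the Riemannian curvature,
`∇T` and a quadratic expression in `T`. -/
theorem curvature_torsConn (u v w z : V) {x : B} (hx : x ∈ S) :
    G x (curvature C (torsConn C G T) x u v w) z
      = G x (curvature C (lc C G) x u v w) z
        + (1 / 2) * (nab3 C (lc C G) T x u v w z - nab3 C (lc C G) T x v u w z)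
        + (1 / 4) * (G x (tors G T x u w) (tors G T x v z)
          - G x (tors G T x v w) (tors G T x u z)) := by
  have hL := hC.lc_isConnection hG
  have hb := hL.bilin x hx
  have hk := tors_bilin hG hT hx
  have hK := hC.vecIn_tors hG hT
  have ha := hT.alt x hx
  have hd : ∀ u v w, C.derV u (fun y => torsConn C G T y v w) x
      = C.derV u (fun y => lc C G y v w) x + (1 / 2 : ℝ) • C.derV u (fun y => tors G T y v w) x := by
    intro u v w
    rw [← hC.derV_const_smul u _ (hK v w) hx, ← hC.derV_add u (hL.mem v w) ((hK v w).const_smul _) hx]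
    rfl
  -- the metric turns `∇_u (K(v, w))` into a derivative of `T`
  have hm : ∀ u v w, G x (C.derV u (fun y => tors G T y v w) x) z + G x (lc C G x u (tors G T x v w)) z
      = C.derS u (fun y => T y v w z) x - T x v w (lc C G x u z) := by
    intro u v w
    have h1 := hC.der_metric_covD hG (hC.lc_metric hG) u (hK v w) (VecIn.const z) hx
    rw [hC.der_congr u (fun y hy => tors_apply hG hT hy v w z) x hx] at h1
    have h2 : covD C (lc C G) u (fun _ => z) x = lc C G x u z := by
      rw [covD, hC.derV_const u z hx, zero_add]
    rw [h2, tors_apply hG hT hx] at h1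
    rw [h1, covD, map_add, LinearMap.add_apply]
    ring
  have hq : ∀ u v w, G x (tors G T x u (tors G T x v w)) z
      = -G x (tors G T x v w) (tors G T x u z) := by
    intro u v w
    rw [tors_apply hG hT hx, ha.swap23, (hG.inner x hx).symm, tors_apply hG hT hx]
  have ht : T x (C.br u v) w z = T x (lc C G x u v) w z - T x (lc C G x v u) w z := by
    rw [← hC.lc_torsionFree hG x hx u v, (ha.lin w z).map_sub]
  have m1 := hm u v w
  have m2 := hm v u w
  rw [curvature, curvature, hd, hd]
  simp only [torsConn, (hb.right _).map_add, (hb.right _).map_smul, (hk.right _).map_add,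
    (hk.right _).map_smul, map_add, map_sub, map_smul, LinearMap.add_apply, LinearMap.sub_apply,
    LinearMap.smul_apply, smul_eq_mul, hq]
  simp only [tors_apply hG hT hx, ht, nab3]
  linear_combination (1 / 2) * m1 - (1 / 2) * m2

end SmoothCalculus

end Torsion

/-! ### The Ricci form of a metric connection with closed skew torsion -/

section TraceIdentity

variable {V : Type*} [AddCommGroup V] [Module ℝ V] [FiniteDimensional ℝ V]

/-- Pair symmetry of an algebraic curvature tensor. -/
theorem curvatureTensor_pair_symm {R : V → V → V → V → ℝ} (h12 : ∀ u v w z, R v u w z = -R u v w z)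
    (h34 : ∀ u v w z, R u v z w = -R u v w z)
    (hB : ∀ u v w z, R u v w z + R v w u z + R w u v z = 0) (u v w z : V) :
    R u v w z = R w z u v := by
  linarith [hB u v w z, hB v w z u, hB w z u v, hB z u v w, h12 u v w z, h34 u v w z,
    h34 w u v z, h12 w z u v, h34 w z u v, h34 v w u z, h12 v w z u, h12 w u z v, h34 z u v w,
    h12 u w v z, h34 u w v z, h34 z v w u, h12 v z u w, h34 v z u w, h12 z u v w, h34 v z w u,
    h34 u z v w, h12 u z w v]

/-- The trace identity behind the comparison of the Bismut-Ricci form and the Bismut-Ricci tensor.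
Here `P` is the curvature of a metric connection with closed skew torsion, expressed by the
Riemannian curvature `R`, the derivative `D` of the torsion and its square `q`; `D'` is the
derivative of the torsion for that connection. -/
theorem IsInner.trace_curvature_J {G : LinearMap.BilinForm ℝ V} (hG : IsInner G)
    {J : Module.End ℝ V} (hJ : ∀ u, J (J u) = -u) (hH : ∀ u v, G (J u) (J v) = G u v)
    {R D D' q P : V → V → V → V → ℝ}
    (hP : ∀ u v w z, P u v w z = R u v w z + (1 / 2) * (D u v w z - D v u w z)
      + (1 / 4) * (q u w v z - q v w u z))
    (hD' : ∀ u v w z, D' u v w z = D u v w z - (1 / 2) * (q w z u v + q z v u w + q v w u z))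
    (R12 : ∀ u v w z, R v u w z = -R u v w z) (R34 : ∀ u v w z, R u v z w = -R u v w z)
    (RB : ∀ u v w z, R u v w z + R v w u z + R w u v z = 0)
    (D12 : ∀ u v w z, D u w v z = -D u v w z) (D23 : ∀ u v w z, D u v z w = -D u v w z)
    (hd : ∀ u v w z, D u v w z - D v u w z + D w u v z - D z u v w = 0)
    (q12 : ∀ u v w z, q v u w z = -q u v w z) (qs : ∀ u v w z, q w z u v = q u v w z)
    (hPJ : ∀ u v w z, P u v (J w) z = -P u v w (J z))
    (hPb : ∀ v z, IsBilin fun a b => P b v a z) (X Y : V) :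
    gtr (fun u v => G u v) (fun a b => P X Y a (J b))
      = 2 * gtr (fun u v => G u v) (fun a b => P a X (J Y) b)
        + gtr (fun u v => G u v) (fun a b => D' X Y a (J b)) := by
  have q34 : ∀ u v w z, q u v z w = -q u v w z := fun u v w z => by
    rw [← qs, q12, qs]
  have hps := curvatureTensor_pair_symm R12 R34 RB
  -- the curvature of the connection with the opposite torsion
  obtain ⟨M, hM⟩ : ∃ M : V → V → V → V → ℝ, ∀ u v w z, M u v w z = P w z u v :=
    ⟨_, fun _ _ _ _ => rfl⟩
  have hM' : ∀ u v w z, M u v w z = R u v w z - (1 / 2) * (D u v w z - D v u w z)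
      + (1 / 4) * (q u w v z - q v w u z) := by
    intro u v w z
    rw [hM, hP, hps w z u v]
    linarith [hd u v w z, D12 w u z v, D23 w u v z, D12 z u w v, D23 z u v w,
      q12 u w z v, q34 u w v z, q12 u z w v, q34 u z w v, qs v w u z]
  have M12 : ∀ u v w z, M v u w z = -M u v w z := by
    intro u v w z; rw [hM', hM', R12 u v w z]; ring
  have M34 : ∀ u v w z, M u v z w = -M u v w z := by
    intro u v w z
    rw [hM', hM', R34 u v w z, D23 u v w z, D23 v u w z, qs v w u z, qs u w v z]
    ring
  have MB : ∀ u v w z, M u v w z + M v w u z + M w u v z = -D' z u v w := by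
    intro u v w z
    rw [hM', hM', hM', hD']
    linarith [RB u v w z, hd u v w z, D12 u v w z, D12 v u w z, D12 w u v z, q12 w u v z,
      q12 u v w z, q12 v w u z, q34 v w u z, q34 w u v z, q34 u v w z]
  set g : V → V → ℝ := fun u v => G u v
  have a1 : gtr g (fun a b => P a X (J Y) b) = -gtr g (fun a b => M Y (J b) a X) := by
    rw [← gtr_neg]; congr 1; funext a b; rw [hPJ, hM]
  have a2 : gtr g (fun a b => P X Y a (J b)) = gtr g (fun a b => M (J b) a Y X) := by
    congr 1; funext a b; rw [M12, M34, neg_neg, hM]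
  have a3 : gtr g (fun a b => M a Y (J b) X) = gtr g (fun a b => M Y (J b) a X) := by
    have hb : IsBilin fun a b => M a Y b X := by
      have : (fun a b => M a Y b X) = fun a b => P b X a Y := by funext a b; rw [hM]
      rw [this]; exact hPb X Y
    rw [hG.gtr_right_J hJ hH hb, ← gtr_neg]
    congr 1; funext a b; rw [M12, neg_neg]
  have a4 : gtr g (fun a b => D' X Y a (J b)) = gtr g (fun a b =>
      M Y (J b) a X + M (J b) a Y X + M a Y (J b) X) := by
    congr 1; funext a b
    rw [MB, hD', hD', D23 X Y a (J b)]
    linarith [q12 a (J b) X Y, q12 (J b) Y X a, q12 Y a X (J b), q12 a Y X (J b)]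
  rw [a4, gtr_add, gtr_add, a3, a2, a1]
  ring

end TraceIdentity

section BismutRicci

variable {B V : Type*} [AddCommGroup V] [Module ℝ V] [FiniteDimensional ℝ V]
  {C : FrameCalculus B V} {S : Set B} {A : Subalgebra ℝ (B → ℝ)}
  {G : B → LinearMap.BilinForm ℝ V} {T : B → V → V → V → ℝ} {J : B → Module.End ℝ V}

/-- An almost complex structure on `S`, orthogonal for the metric `G`, with components in `A`. -/
structure IsHermitianField (S : Set B) (A : Subalgebra ℝ (B → ℝ))
    (G : B → LinearMap.BilinForm ℝ V) (J : B → Module.End ℝ V) : Prop where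
  sq : ∀ x ∈ S, ∀ u, J x (J x u) = -u
  herm : ∀ x ∈ S, ∀ u v, G x (J x u) (J x v) = G x u v
  mem : ∀ v, VecIn A fun y => J y v

/-- `dT = 0`, for a `3`-form `T`, in terms of the Levi-Civita connection. -/
def IsClosedThree (C : FrameCalculus B V) (S : Set B) (G : B → LinearMap.BilinForm ℝ V)
    (T : B → V → V → V → ℝ) : Prop :=
  ∀ x ∈ S, ∀ u v w z, nab3 C (lc C G) T x u v w z - nab3 C (lc C G) T x v u w z
    + nab3 C (lc C G) T x w u v z - nab3 C (lc C G) T x z u v w = 0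

/-- The `1`-form `θ(Z) = - T(JZ, e_i, J e_i) / 2`, which is the Lee form when `T` is the torsion of
the Bismut connection. -/
noncomputable def leeTrace (G : B → LinearMap.BilinForm ℝ V) (J : B → Module.End ℝ V)
    (T : B → V → V → V → ℝ) (x : B) (z : V) : ℝ :=
  -(1 / 2) * gtr (fun u v => G x u v) fun a b => T x (J x z) a (J x b)

theorem IsHermitianField.skew (hJ : IsHermitianField S A G J) {x : B} (hx : x ∈ S) (u v : V) :
    G x u (J x v) = -G x (J x u) v := by
  have := hJ.herm x hx (J x u) v
  rw [hJ.sq x hx, map_neg, LinearMap.neg_apply] at this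
  linarith

namespace SmoothCalculus

variable (hC : SmoothCalculus C S A) (hG : IsMetricField S A G)
include hC hG

/-- The metric trace commutes with covariant differentiation by a metric connection. -/
theorem der_gtr {L : B → V → V → V} (hL : IsConnection S A L) (hm : IsMetricConn C S G L)
    {Q : B → V → V → ℝ} (hQ : ∀ x ∈ S, IsBilin (Q x)) (hQm : ∀ a b, (fun y => Q y a b) ∈ A) (u : V)
    {x : B} (hx : x ∈ S) :
    C.derS u (fun y => gtr (fun v w => G y v w) (Q y)) x
      = gtr (fun v w => G x v w) fun a b =>
          C.derS u (fun y => Q y a b) x - Q x (L x u a) b - Q x a (L x u b) := by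
  set E : B → V → V := fun y a => sharp (fun v w => G y v w) (Q y a)
  have hE : ∀ a, VecIn A fun y => E y a := fun a => hC.vecIn_sharp hG fun b => hQm a b
  have hEa : ∀ y ∈ S, ∀ a b, G y (E y a) b = Q y a b := fun y hy a b =>
    (hG.inner y hy).sharp_apply ((hQ y hy).right a) b
  set b := Module.finBasis ℝ V
  have e1 : C.derS u (fun y => gtr (fun v w => G y v w) (Q y)) x
      = tr fun a => C.derV u (fun y => E y a) x := by
    have : ∀ i, C.derS u (fun y => b.coord i (E y (b i))) x
        = b.coord i (C.derV u (fun y => E y (b i)) x) := fun i => by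
      rw [hC.derV_apply u (hE _) x hx]
    rw [tr, ← Finset.sum_congr rfl fun i _ => this i,
      ← hC.der_sum u (f := fun i y => b.coord i (E y (b i))) _ (fun i _ => hE _ _) hx]
    congr 1; funext y; exact gtr_eq_tr _ _
  set N : Module.End ℝ V := ((hL.bilin x hx).right u).mk' _
  have hN : ∀ a, N a = L x u a := fun _ => rfl
  set E' : Module.End ℝ V := (hQ x hx).endo (G x)
  have hE' : ∀ a, E' a = E x a := fun _ => rfl
  have e2 : gtr (fun v w => G x v w) (fun a b =>
      C.derS u (fun y => Q y a b) x - Q x (L x u a) b - Q x a (L x u b))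
      = tr fun a => C.derV u (fun y => E y a) x + (N * E' - E' * N) a := by
    rw [gtr_eq_tr]; congr 1; funext a
    refine (hG.inner x hx).sharp_eq fun w => ?_
    have h1 := hC.der_metric_covD hG hm u (hE a) (VecIn.const w) hx
    have h2 : covD C L u (fun _ => w) x = L x u w := by
      rw [covD, hC.derV_const u w hx, zero_add]
    rw [h2, hEa x hx] at h1
    rw [← hC.der_congr u (fun y hy => hEa y hy a w) x hx, h1, covD]
    simp only [map_add, LinearMap.add_apply, LinearMap.sub_apply, Module.End.mul_apply, hN, hE',
      map_sub, hEa x hx]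
    ring
  have e3 : tr (fun a => C.derV u (fun y => E y a) x + (N * E' - E' * N) a)
      = tr (fun a => C.derV u (fun y => E y a) x) + tr fun a => (N * E' - E' * N) a := by
    simp only [tr, map_add, Finset.sum_add_distrib]
  rw [e1, e2, e3, tr_eq_trace, map_sub, LinearMap.trace_mul_comm, sub_self, add_zero]

theorem curvature_lc_pair_symm (u v w z : V) {x : B} (hx : x ∈ S) :
    G x (curvature C (lc C G) x u v w) z = G x (curvature C (lc C G) x w z u) v := by
  have hL := hC.lc_isConnection hG
  refine curvatureTensor_pair_symm (R := fun u v w z => G x (curvature C (lc C G) x u v w) z)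
    (fun u v w z => ?_) (fun u v w z => ?_) (fun u v w z => ?_) u v w z
  · rw [hC.curvature_swap hL u v w hx]; simp
  · rw [hC.curvature_metric hL hG (hC.lc_metric hG) u v w z hx, (hG.inner x hx).symm w]; simp
  · have := congrArg (fun t => G x t z) (hC.curvature_bianchi hL (hC.lc_torsionFree hG) u v w hx)
    simpa using this

theorem ricci_eq_gtr (v w : V) (x : B) (hx : x ∈ S) :
    ricci C (fun y a b => G y a b) x v w
      = gtr (fun a b => G x a b) fun a b => G x (curvature C (lc C G) x a v w) b := by
  rw [gtr_eq_tr, ricci]; congr 1; funext a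
  exact ((hG.inner x hx).sharp_eq fun _ => rfl).symm

theorem ricci_symm (v w : V) {x : B} (hx : x ∈ S) :
    ricci C (fun y a b => G y a b) x v w = ricci C (fun y a b => G y a b) x w v := by
  rw [hC.ricci_eq_gtr hG v w x hx, hC.ricci_eq_gtr hG w v x hx,
    ← (hG.inner x hx).gtr_swap (fun a b => G x (curvature C (lc C G) x a v w) b)]
  congr 1; funext a b
  have hL := hC.lc_isConnection hG
  rw [hC.curvature_lc_pair_symm hG b v w a hx, hC.curvature_swap hL a w b hx, map_neg,
    LinearMap.neg_apply, hC.curvature_metric hL hG (hC.lc_metric hG) a w b v hx, neg_neg,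
    (hG.inner x hx).symm]

variable (hT : IsThreeForm S A T)
include hT

theorem nab3_torsConn (u v w z : V) {x : B} (hx : x ∈ S) :
    nab3 C (torsConn C G T) T x u v w z = nab3 C (lc C G) T x u v w z
      - (1 / 2) * (G x (tors G T x w z) (tors G T x u v) + G x (tors G T x z v) (tors G T x u w)
        + G x (tors G T x v w) (tors G T x u z)) := by
  have ha := hT.alt x hx
  simp only [nab3, torsConn, (ha.lin _ _).map_add, (ha.lin _ _).map_smul, (ha.lin2 _ _).map_add,
    (ha.lin2 _ _).map_smul, (ha.lin3 _ _).map_add, (ha.lin3 _ _).map_smul, tors_apply hG hT hx,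
    smul_eq_mul]
  rw [← ha.rot (tors G T x u v), ha.rot z v (tors G T x u w)]
  ring

/-- The trace of the square of `T` over two slots. -/
theorem hSq_eq_gtr (H : B → (Fin 3 → V) → ℝ) {x : B} (hx : x ∈ S)
    (hH : ∀ u v w, H x ![u, v, w] = -T x u v w) (u v : V) :
    hSq (fun y a b => G y a b) H x u v
      = gtr (fun a b => G x a b) fun a b => G x (tors G T x u a) (tors G T x v b) := by
  rw [hSq, innerTwo_eq]
  congr 1; funext a b
  have h := (hG.inner x hx).gtr_mul ((hT.alt x hx).lin3 u a) (T x v b)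
  rw [tors, tors, ← h]
  congr 1; funext c d
  rw [hH, hH]; ring

/-- The Ricci tensor of the metric connection with torsion `T = -H`. -/
theorem ricci_torsConn (H : B → (Fin 3 → V) → ℝ)
    (hH : ∀ y ∈ S, ∀ u v w, H y ![u, v, w] = -T y u v w) (u v : V) {x : B} (hx : x ∈ S) :
    gtr (fun a b => G x a b) (fun a b => G x (curvature C (torsConn C G T) x a u v) b)
      = ricB C (fun y a b => G y a b) H x u v
        + (1 / 2) * codiff C (fun y a b => G y a b) H x ![u, v] := by
  set g : V → V → ℝ := fun a b => G x a b
  have hi := hG.inner x hx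
  have e : (fun a b => G x (curvature C (torsConn C G T) x a u v) b) = fun a b =>
      G x (curvature C (lc C G) x a u v) b
        + (1 / 2) * (nab3 C (lc C G) T x a u v b - nab3 C (lc C G) T x u a v b)
        + (1 / 4) * (-G x (tors G T x v a) (tors G T x u b)
          - G x (tors G T x u v) (tors G T x a b)) := by
    funext a b
    rw [hC.curvature_torsConn hG hT _ _ _ _ hx, tors_swap hG hT hx v a]
    simp
  have z1 : gtr g (fun a b => nab3 C (lc C G) T x u a v b) = 0 := hi.gtr_eq_zero fun a b => by
    rw [hC.nab3_swap12 hG hT _ _ _ _ _ hx, hC.nab3_swap23 hG hT _ _ _ _ _ hx,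
      hC.nab3_swap12 hG hT _ _ _ _ _ hx, neg_neg]
  have z2 : gtr g (fun a b => G x (tors G T x u v) (tors G T x a b)) = 0 :=
    hi.gtr_eq_zero fun a b => by rw [tors_swap hG hT hx a b, map_neg]
  have z3 : gtr g (fun a b => G x (tors G T x v a) (tors G T x u b))
      = hSq (fun y a b => G y a b) H x u v := by
    rw [hC.hSq_eq_gtr hG hT H hx (hH x hx), ← hi.gtr_swap]
    congr 1; funext a b; rw [hi.symm]
  have z4 : gtr g (fun a b => nab3 C (lc C G) T x a u v b)
      = codiff C (fun y a b => G y a b) H x ![u, v] := by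
    rw [codiff]
    change _ = -gtr g fun a b => nabla C (fun y a b => G y a b) a H x (Fin.cons b ![u, v])
    rw [← gtr_neg]; congr 1; funext a b
    have hd : C.derS a (fun y => H y ![b, u, v]) x = -C.derS a (fun y => T y u v b) x := by
      rw [← hC.der_neg a (hT.mem u v b) hx]
      exact hC.der_congr a (fun y hy => by rw [hH y hy, (hT.alt y hy).rot b u v]) x hx
    have hcons : (Fin.cons b ![u, v] : Fin 3 → V) = ![b, u, v] := rfl
    rw [nabla, hcons, hd, Fin.sum_univ_three]
    have u0 : ∀ w, Function.update ![b, u, v] 0 w = ![w, u, v] := fun w => by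
      ext i; fin_cases i <;> simp
    have u1 : ∀ w, Function.update ![b, u, v] 1 w = ![b, w, v] := fun w => by
      funext i; fin_cases i <;> simp
    have u2 : ∀ w, Function.update ![b, u, v] 2 w = ![b, u, w] := fun w => by
      funext i; fin_cases i <;> simp
    simp only [u0, u1, u2, hH x hx]
    rw [← (hT.alt x hx).rot _ u v, ← (hT.alt x hx).rot b _ v, ← (hT.alt x hx).rot b u, nab3]
    simp
    ring
  rw [e, gtr_add, gtr_add, gtr_smul, gtr_smul, gtr_sub, gtr_sub, gtr_neg, z1, z2, z3, z4,
    ← hC.ricci_eq_gtr hG u v x hx, ricB]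
  ring

variable (hJ : IsHermitianField S A G J)
include hJ

/-- The Bismut-Ricci form, as a trace, in terms of the Ricci tensor of the Bismut connection and the
derivative of its torsion. -/
theorem trace_J_curvature_torsConn (hd : IsClosedThree C S G T)
    (hp : IsParallelEnd C S J (torsConn C G T)) (X Y : V) {x : B} (hx : x ∈ S) :
    gtr (fun u v => G x u v) (fun a b => G x (curvature C (torsConn C G T) x X Y a) (J x b))
      = 2 * gtr (fun u v => G x u v)
          (fun a b => G x (curvature C (torsConn C G T) x a X (J x Y)) b)
        + gtr (fun u v => G x u v) (fun a b => nab3 C (torsConn C G T) T x X Y a (J x b)) := by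
  have hL := hC.lc_isConnection hG
  have hL' := hC.torsConn_isConnection hG hT
  have hi := hG.inner x hx
  refine hi.trace_curvature_J (hJ.sq x hx) (hJ.herm x hx)
    (R := fun u v w z => G x (curvature C (lc C G) x u v w) z)
    (D := nab3 C (lc C G) T x) (D' := nab3 C (torsConn C G T) T x)
    (q := fun u v w z => G x (tors G T x u v) (tors G T x w z))
    (P := fun u v w z => G x (curvature C (torsConn C G T) x u v w) z)
    (fun u v w z => hC.curvature_torsConn hG hT u v w z hx)
    (fun u v w z => hC.nab3_torsConn hG hT u v w z hx)
    (fun u v w z => ?_) (fun u v w z => ?_) (fun u v w z => ?_)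
    (fun u v w z => hC.nab3_swap12 hG hT _ u v w z hx)
    (fun u v w z => hC.nab3_swap23 hG hT _ u v w z hx)
    (fun u v w z => hd x hx u v w z) (fun u v w z => ?_) (fun u v w z => hi.symm _ _)
    (fun u v w z => ?_) (fun v z => ⟨fun b => ?_, fun a => ?_⟩) X Y
  · rw [hC.curvature_swap hL u v w hx]; simp
  · rw [hC.curvature_metric hL hG (hC.lc_metric hG) u v w z hx, hi.symm w]; simp
  · have := congrArg (fun t => G x t z) (hC.curvature_bianchi hL (hC.lc_torsionFree hG) u v w hx)
    simpa using this
  · rw [tors_swap hG hT hx u v]; simp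
  · rw [hC.curvature_parallel hL' hJ.mem hp u v w hx, hJ.skew hx, neg_neg]
  · exact (((G x).flip z) ∘ₗ (hC.curvature_linear_right hL' b v hx).mk' _).isLinear
  · exact (((G x).flip z) ∘ₗ (hC.curvature_linear_left hL' v a hx).mk' _).isLinear

/-- The derivative of the Lee form in terms of the derivative of the torsion. -/
theorem der_leeTrace (hp : IsParallelEnd C S J (torsConn C G T)) (X Z : V) {x : B} (hx : x ∈ S) :
    C.derS X (fun y => leeTrace G J T y Z) x
      = leeTrace G J T x (torsConn C G T x X Z)
        - (1 / 2) * gtr (fun u v => G x u v)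
          (fun a b => nab3 C (torsConn C G T) T x X (J x Z) a (J x b)) := by
  have hL := hC.torsConn_isConnection hG hT
  have hm1 : ∀ v a b, (fun y => T y v a (J y b)) ∈ A := fun v a b =>
    hC.apply_mem (F := fun y w => T y v a w) (fun y hy => (hT.alt y hy).lin3 v a)
      (fun w => hT.mem v a w) (hJ.mem b)
  have hm2 : ∀ a b, (fun y => T y (J y Z) a (J y b)) ∈ A := fun a b =>
    hC.apply_mem (F := fun y w => T y w a (J y b)) (fun y hy => (hT.alt y hy).lin a _)
      (fun w => hm1 w a b) (hJ.mem Z)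
  have hQ : ∀ y ∈ S, IsBilin fun a b => T y (J y Z) a (J y b) := fun y hy =>
    ⟨fun b => (hT.alt y hy).lin2 _ _,
      fun a => (((hT.alt y hy).lin3 (J y Z) a).mk' _ ∘ₗ J y).isLinear⟩
  have hQm : (fun y => gtr (fun u v => G y u v) fun a b => T y (J y Z) a (J y b)) ∈ A :=
    hC.gtr_mem hG hm2
  have ha := hT.alt x hx
  have key : ∀ a b, C.derS X (fun y => T y (J y Z) a (J y b)) x
      - T x (J x Z) (torsConn C G T x X a) (J x b) - T x (J x Z) a (J x (torsConn C G T x X b))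
      = nab3 C (torsConn C G T) T x X (J x Z) a (J x b)
        + T x (J x (torsConn C G T x X Z)) a (J x b) := by
    intro a b
    have e1 : C.derV X (fun y => J y Z) x
        = J x (torsConn C G T x X Z) - torsConn C G T x X (J x Z) := by
      rw [← hp x hx]; abel
    have e2 : C.derV X (fun y => J y b) x
        = J x (torsConn C G T x X b) - torsConn C G T x X (J x b) := by
      rw [← hp x hx]; abel
    rw [hC.der_apply X (F := fun y w => T y w a (J y b)) (fun y hy => (hT.alt y hy).lin a _)
        (fun w => hm1 w a b) (hJ.mem Z) hx,
      hC.der_apply X (F := fun y w => T y (J x Z) a w) (fun y hy => (hT.alt y hy).lin3 _ a)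
        (fun w => hT.mem _ a w) (hJ.mem b) hx, e1, e2, (ha.lin _ _).map_sub, (ha.lin3 _ _).map_sub,
      nab3]
    ring
  have h := hC.der_gtr hG hL (hC.torsConn_metric hG hT) hQ hm2 X hx
  simp only [key] at h
  rw [gtr_add] at h
  simp only [leeTrace]
  rw [hC.der_const_mul X _ hQm hx, h]
  ring

/-- The comparison of the Bismut-Ricci form with the Bismut-Ricci tensor: `ρ(X, JZ)` is
`Ric^B(X, Z) + d^*H(X, Z)/2 + (∇^B_X θ)(Z)`. -/
theorem rho_torsConn (hd : IsClosedThree C S G T)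
    (hp : IsParallelEnd C S J (torsConn C G T)) (H : B → (Fin 3 → V) → ℝ)
    (hH : ∀ y ∈ S, ∀ u v w, H y ![u, v, w] = -T y u v w) (X Z : V) {x : B} (hx : x ∈ S) :
    (1 / 2) * tr (fun w => J x (curvature C (torsConn C G T) x X (J x Z) w))
      = ricB C (fun y a b => G y a b) H x X Z
        + (1 / 2) * codiff C (fun y a b => G y a b) H x ![X, Z]
        + C.derS X (fun y => leeTrace G J T y Z) x
        - leeTrace G J T x (torsConn C G T x X Z) := by
  have hi := hG.inner x hx
  have e1 : tr (fun w => J x (curvature C (torsConn C G T) x X (J x Z) w))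
      = -gtr (fun u v => G x u v)
        (fun a b => G x (curvature C (torsConn C G T) x X (J x Z) a) (J x b)) := by
    rw [← gtr_neg, gtr_eq_tr]; congr 1; funext a
    exact (hi.sharp_eq fun w => by rw [hJ.skew hx, neg_neg]).symm
  have e2 : gtr (fun u v => G x u v)
        (fun a b => G x (curvature C (torsConn C G T) x a X (J x (J x Z))) b)
      = -gtr (fun u v => G x u v)
        (fun a b => G x (curvature C (torsConn C G T) x a X Z) b) := by
    rw [← gtr_neg]; congr 1; funext a b
    rw [hJ.sq x hx, (hC.curvature_linear_right (hC.torsConn_isConnection hG hT) a X hx).map_neg]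
    simp
  rw [e1, hC.trace_J_curvature_torsConn hG hT hJ hd hp _ _ hx, e2,
    hC.der_leeTrace hG hT hJ hp X Z hx, hC.ricci_torsConn hG hT H hH X Z hx]
  ring

end SmoothCalculus

end BismutRicci

/-! ### Exterior derivatives and the Bismut connection -/

section ExteriorDerivative

variable {B V : Type*} [AddCommGroup V] [Module ℝ V] [FiniteDimensional ℝ V]
  {C : FrameCalculus B V} {S : Set B} {A : Subalgebra ℝ (B → ℝ)}
  {G : B → LinearMap.BilinForm ℝ V} {J : B → Module.End ℝ V}

/-- Replacing the `j`-th argument and removing the `i`-th is, up to sign, replacing the `i`-th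
argument and removing the `j`-th. -/
theorem AlternatingMap.neg_one_pow_mul_removeNth_update {k : ℕ} (a : V [⋀^Fin k]→ₗ[ℝ] ℝ)
    (v : Fin (k + 1) → V) (z : V) {i j : Fin (k + 1)} (hij : i ≠ j) :
    (-1) ^ (i : ℕ) * a (i.removeNth (Function.update v j z))
      = -((-1) ^ (j : ℕ) * a (j.removeNth (Function.update v i z))) := by
  have h := a.neg_one_pow_smul_map_removeNth_add_eq_zero_of_eq
    (v := Function.update (Function.update v j z) i z) (i := i) (j := j) (by simp [hij.symm]) hij
  have h1 : i.removeNth (Function.update (Function.update v j z) i z)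
      = i.removeNth (Function.update v j z) := by
    simp [Fin.removeNth_update]
  have h2 : j.removeNth (Function.update (Function.update v j z) i z)
      = j.removeNth (Function.update v i z) := by
    rw [Function.update_comm hij.symm, Fin.removeNth_update]
  simp only [h1, h2, zsmul_eq_mul, Int.cast_pow, Int.cast_neg, Int.cast_one] at h
  linarith

/-- The exterior derivative as the antisymmetrized covariant derivative. -/
theorem SmoothCalculus.extD_eq_nabla (hC : SmoothCalculus C S A) (hG : IsMetricField S A G) {k : ℕ}
    (α : B → (Fin k → V) → ℝ) {x : B} (hx : x ∈ S) (a : V [⋀^Fin k]→ₗ[ℝ] ℝ)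
    (ha : ∀ v, α x v = a v) (v : Fin (k + 1) → V) :
    extD C α x v = ∑ j : Fin (k + 1), (-1) ^ (j : ℕ) *
      nabla C (fun y u w => G y u w) (v j) α x (j.removeNth v) := by
  set Γ := lc C G x
  set F : Fin (k + 1) → Fin (k + 1) → ℝ := fun j i =>
    (-1) ^ (j : ℕ) * a (j.removeNth (Function.update v i (Γ (v j) (v i))))
  have e1 : ∀ j : Fin (k + 1), ∑ i : Fin k, (-1) ^ (j : ℕ) *
      a (Function.update (j.removeNth v) i (Γ (v j) (j.removeNth v i)))
      = ∑ i, (if i < j then F j i else 0) + ∑ i, if j < i then F j i else 0 := by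
    intro j
    rw [← Finset.sum_add_distrib, Fin.sum_univ_succAbove _ j]
    simp only [lt_irrefl, if_false, add_zero, zero_add]
    refine Finset.sum_congr rfl fun i _ => ?_
    have h1 : Function.update (j.removeNth v) i (Γ (v j) (j.removeNth v i))
        = j.removeNth (Function.update v (j.succAbove i) (Γ (v j) (v (j.succAbove i)))) := by
      funext l
      by_cases hl : l = i
      · subst hl; simp [Fin.removeNth]
      · have : j.succAbove l ≠ j.succAbove i := fun h => hl (Fin.succAbove_right_injective h)
        simp [Fin.removeNth, hl]
    rw [h1]
    rcases lt_or_gt_of_ne (Fin.succAbove_ne j i) with h | h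
    · simp [h, h.not_gt, F]
    · simp [h, h.not_gt, F]
  have e2 : ∑ j, ∑ i, (if j < i then F j i else 0) = ∑ j, ∑ i, if i < j then F i j else 0 :=
    Finset.sum_comm
  have e3 : ∀ i j : Fin (k + 1), i < j →
      (-1) ^ (j : ℕ) * a (j.removeNth (Function.update v i (C.br (v i) (v j)))) = -(F j i + F i j) := by
    intro i j hij
    simp only [F]
    rw [AlternatingMap.neg_one_pow_mul_removeNth_update a v _ hij.ne,
      ← hC.lc_torsionFree hG x hx (v i) (v j)]
    obtain ⟨l, rfl⟩ := Fin.exists_succAbove_eq hij.ne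
    have h1 : ∀ z, j.removeNth (Function.update v (j.succAbove l) z)
        = Function.update (j.removeNth v) l z := by
      intro z; funext m
      by_cases hm : m = l
      · subst hm; simp [Fin.removeNth]
      · have : j.succAbove m ≠ j.succAbove l := fun h => hm (Fin.succAbove_right_injective h)
        simp [Fin.removeNth, hm]
    rw [h1, h1, h1, a.map_update_sub]
    ring
  have e4 : ∀ j : Fin (k + 1), (-1) ^ (j : ℕ) * ∑ i ∈ Finset.univ.filter (fun i => i < j),
      α x (j.removeNth (Function.update v i (C.br (v i) (v j))))
      = -∑ i, ((if i < j then F j i else 0) + if i < j then F i j else 0) := by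
    intro j
    rw [Finset.mul_sum, Finset.sum_filter, ← Finset.sum_neg_distrib]
    refine Finset.sum_congr rfl fun i _ => ?_
    by_cases h : i < j
    · simp only [h, if_true]; rw [ha, e3 i j h]
    · simp [h]
  simp only [extD, nabla, mul_add, mul_sub, e4]
  simp only [Finset.sum_add_distrib, Finset.sum_sub_distrib, Finset.sum_neg_distrib, ha,
    Finset.mul_sum]
  have e5 := Finset.sum_congr rfl fun j (_ : j ∈ Finset.univ) => e1 j
  rw [Finset.sum_add_distrib, e2] at e5
  rw [e5]; ring

/-- An alternating bilinear function as an alternating map. -/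
def altTwo (b : V → V → ℝ) (hb : IsBilin b) (hs : ∀ u, b u u = 0) : V [⋀^Fin 2]→ₗ[ℝ] ℝ where
  toFun v := b (v 0) (v 1)
  map_update_add' v i x y := by
    fin_cases i
    · simpa using (hb.left (v 1)).map_add x y
    · simpa using (hb.right (v 0)).map_add x y
  map_update_smul' v i c x := by
    fin_cases i
    · simpa using (hb.left (v 1)).map_smul c x
    · simpa using (hb.right (v 0)).map_smul c x
  map_eq_zero_of_eq' v i j h hij := by
    fin_cases i <;> fin_cases j <;> simp_all

theorem removeNth_vec3 (u v w : V) : (0 : Fin 3).removeNth ![u, v, w] = ![v, w] ∧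
    (1 : Fin 3).removeNth ![u, v, w] = ![u, w] ∧ (2 : Fin 3).removeNth ![u, v, w] = ![u, v] := by
  refine ⟨?_, ?_, ?_⟩ <;> funext i <;> fin_cases i <;> rfl

theorem removeNth_vec4 (u v w z : V) : (0 : Fin 4).removeNth ![u, v, w, z] = ![v, w, z] ∧
    (1 : Fin 4).removeNth ![u, v, w, z] = ![u, w, z] ∧
    (2 : Fin 4).removeNth ![u, v, w, z] = ![u, v, z] ∧
    (3 : Fin 4).removeNth ![u, v, w, z] = ![u, v, w] := by
  refine ⟨?_, ?_, ?_, ?_⟩ <;> funext i <;> fin_cases i <;> rfl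

theorem update_vec2 (u v w : V) : Function.update ![u, v] 0 w = ![w, v] ∧
    Function.update ![u, v] 1 w = ![u, w] := by
  refine ⟨?_, ?_⟩ <;> funext i <;> fin_cases i <;> simp

theorem update_vec3 (u v w z : V) : Function.update ![u, v, w] 0 z = ![z, v, w] ∧
    Function.update ![u, v, w] 1 z = ![u, z, w] ∧ Function.update ![u, v, w] 2 z = ![u, v, z] := by
  refine ⟨?_, ?_, ?_⟩ <;> funext i <;> fin_cases i <;> simp

theorem nabla_two (g : B → V → V → ℝ) (α : B → (Fin 2 → V) → ℝ) (x : B) (u v w : V) :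
    nabla C g u α x ![v, w] = C.derS u (fun y => α y ![v, w]) x - α x ![leviCivita C g x u v, w]
      - α x ![v, leviCivita C g x u w] := by
  rw [nabla, Fin.sum_univ_two, (update_vec2 _ _ _).1, (update_vec2 _ _ _).2]
  simp
  ring

theorem nabla_three (g : B → V → V → ℝ) (α : B → (Fin 3 → V) → ℝ) (x : B) (u v w z : V) :
    nabla C g u α x ![v, w, z] = C.derS u (fun y => α y ![v, w, z]) x
      - α x ![leviCivita C g x u v, w, z] - α x ![v, leviCivita C g x u w, z]
      - α x ![v, w, leviCivita C g x u z] := by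
  rw [nabla, Fin.sum_univ_three, (update_vec3 _ _ _ _).1, (update_vec3 _ _ _ _).2.1,
    (update_vec3 _ _ _ _).2.2]
  simp
  ring

namespace SmoothCalculus

variable (hC : SmoothCalculus C S A) (hG : IsMetricField S A G)
include hC hG

theorem extD_two (α : B → (Fin 2 → V) → ℝ) {x : B} (hx : x ∈ S) (a : V [⋀^Fin 2]→ₗ[ℝ] ℝ)
    (ha : ∀ v, α x v = a v) (u v w : V) :
    extD C α x ![u, v, w] = nabla C (fun y a b => G y a b) u α x ![v, w]
      - nabla C (fun y a b => G y a b) v α x ![u, w]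
      + nabla C (fun y a b => G y a b) w α x ![u, v] := by
  rw [hC.extD_eq_nabla hG α hx a ha, Fin.sum_univ_three, (removeNth_vec3 u v w).1,
    (removeNth_vec3 u v w).2.1, (removeNth_vec3 u v w).2.2]
  simp
  ring

theorem extD_three (α : B → (Fin 3 → V) → ℝ) {x : B} (hx : x ∈ S) (a : V [⋀^Fin 3]→ₗ[ℝ] ℝ)
    (ha : ∀ v, α x v = a v) (u v w z : V) :
    extD C α x ![u, v, w, z] = nabla C (fun y a b => G y a b) u α x ![v, w, z]
      - nabla C (fun y a b => G y a b) v α x ![u, w, z]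
      + nabla C (fun y a b => G y a b) w α x ![u, v, z]
      - nabla C (fun y a b => G y a b) z α x ![u, v, w] := by
  rw [hC.extD_eq_nabla hG α hx a ha, Fin.sum_univ_four, (removeNth_vec4 u v w z).1,
    (removeNth_vec4 u v w z).2.1, (removeNth_vec4 u v w z).2.2.1, (removeNth_vec4 u v w z).2.2.2]
  simp [pow_succ]
  ring

end SmoothCalculus

end ExteriorDerivative

section Bismut

variable {B V : Type*} [AddCommGroup V] [Module ℝ V] [FiniteDimensional ℝ V]
  {C : FrameCalculus B V} {S : Set B} {A : Subalgebra ℝ (B → ℝ)}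
  {G : B → LinearMap.BilinForm ℝ V} {J : B → Module.End ℝ V}

/-- The covariant derivative `(∇_u J) v` for the Levi-Civita connection. -/
noncomputable def nablaJ (C : FrameCalculus B V) (G : B → LinearMap.BilinForm ℝ V)
    (J : B → Module.End ℝ V) (x : B) (u v : V) : V :=
  C.derV u (fun y => J y v) x + lc C G x u (J x v) - J x (lc C G x u v)

/-- The torsion `dω(J·, J·, J·)` of the Bismut connection. -/
noncomputable def bismutTors (C : FrameCalculus B V) (G : B → LinearMap.BilinForm ℝ V)
    (J : B → Module.End ℝ V) (x : B) (u v w : V) : ℝ :=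
  extD C (omega (fun y a b => G y a b) fun y a => J y a) x ![J x u, J x v, J x w]

theorem omega_vec (g : B → V → V → ℝ) (J : B → V → V) (x : B) (u v : V) :
    omega g J x ![u, v] = g x (J x u) v := rfl

namespace SmoothCalculus

variable (hC : SmoothCalculus C S A) (hG : IsMetricField S A G) (hJ : IsHermitianField S A G J)
include hC hG hJ

theorem omega_bilin (x : B) : IsBilin fun u v => G x (J x u) v :=
  ⟨fun v => ⟨by simp, by simp⟩, fun u => ⟨by simp, by simp⟩⟩

theorem omega_self {x : B} (hx : x ∈ S) (u : V) : G x (J x u) u = 0 := by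
  have := hJ.skew hx u u
  rw [(hG.inner x hx).symm] at this
  linarith

theorem nabla_omega (u v w : V) {x : B} (hx : x ∈ S) :
    nabla C (fun y a b => G y a b) u (omega (fun y a b => G y a b) fun y a => J y a) x ![v, w]
      = G x (nablaJ C G J x u v) w := by
  rw [nabla_two]
  simp only [omega_vec]
  have h := hC.der_metric_covD hG (hC.lc_metric hG) u (hJ.mem v) (VecIn.const w) hx
  have h2 : covD C (lc C G) u (fun _ => w) x = lc C G x u w := by
    rw [covD, hC.derV_const u w hx, zero_add]
  rw [h2] at h
  rw [h, nablaJ, covD]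
  simp only [map_sub, LinearMap.sub_apply]
  ring

theorem nablaJ_bilin {x : B} (hx : x ∈ S) : IsBilin (nablaJ C G J x) := by
  have hb := (hC.lc_isConnection hG).bilin x hx
  have hd := fun v => hC.derV_isLinear (hJ.mem v) hx
  have l1 : ∀ a b c, lc C G x (a + b) c = lc C G x a c + lc C G x b c :=
    fun a b c => (hb.left c).map_add a b
  have l2 : ∀ (r : ℝ) a c, lc C G x (r • a) c = r • lc C G x a c :=
    fun r a c => (hb.left c).map_smul r a
  constructor
  · refine fun v => ⟨fun a b => ?_, fun c a => ?_⟩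
    · simp only [nablaJ, (hd v).map_add, l1, map_add]; abel
    · simp only [nablaJ, (hd v).map_smul, l2, map_smul]; module
  · refine fun u => ⟨fun a b => ?_, fun c a => ?_⟩
    · simp only [nablaJ, map_add, (hb.right _).map_add, hC.derV_add u (hJ.mem a) (hJ.mem b) hx]
      abel
    · simp only [nablaJ, map_smul, (hb.right _).map_smul, hC.derV_const_smul u c (hJ.mem a) hx]
      module

/-- `∇_u J` anticommutes with `J`. -/
theorem nablaJ_J (u v : V) {x : B} (hx : x ∈ S) :
    nablaJ C G J x u (J x v) = -J x (nablaJ C G J x u v) := by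
  have h1 := hC.derV_vecIn_apply u (F := fun y v => J y v) (fun y _ => (J y).isLinear) hJ.mem
    (hJ.mem v) hx
  have h2 : C.derV u (fun y => J y (J y v)) x = 0 := by
    rw [hC.derV_congr u (hC.vecIn_end_apply hJ.mem (hJ.mem v)) (fun y hy => hJ.sq y hy v) hx,
      hC.derV_const u _ hx]
  rw [h2] at h1
  have h3 : C.derV u (fun y => J y (J x v)) x = -J x (C.derV u (fun y => J y v) x) :=
    eq_neg_of_add_eq_zero_left h1.symm
  simp only [nablaJ, h3, hJ.sq x hx, map_add, map_sub,
    (((hC.lc_isConnection hG).bilin x hx).right u).map_neg]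
  abel

theorem nablaJ_skew (u v w : V) {x : B} (hx : x ∈ S) :
    G x (nablaJ C G J x u w) v = -G x (nablaJ C G J x u v) w := by
  rw [← hC.nabla_omega hG hJ u v w hx, ← hC.nabla_omega hG hJ u w v hx, nabla_two, nabla_two]
  simp only [omega_vec]
  have hs : ∀ y ∈ S, ∀ a b, G y (J y a) b = -G y (J y b) a := fun y hy a b => by
    rw [(hG.inner y hy).symm, hJ.skew hy]
  rw [hC.der_congr u (fun y hy => hs y hy w v) x hx,
    hC.der_neg u (hC.metric_apply_mem hG (hJ.mem v) (VecIn.const w)) hx, hs x hx w, hs x hx _ v]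
  ring

/-- The Nijenhuis tensor in terms of `∇J`. -/
theorem nijenhuis_eq (u v : V) {x : B} (hx : x ∈ S) :
    nijenhuis C (fun y a => J y a) x u v
      = J x (nablaJ C G J x u v) - J x (nablaJ C G J x v u) - nablaJ C G J x (J x u) v
        + nablaJ C G J x (J x v) u := by
  have ht := hC.lc_torsionFree hG x hx
  rw [nijenhuis, ← ht, ← ht, ← ht, ← ht]
  simp only [nablaJ, map_add, map_sub, map_neg, hJ.sq x hx]
  abel

variable (hN : ∀ x ∈ S, ∀ u v, nijenhuis C (fun y a => J y a) x u v = 0)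
include hN

/-- On a complex manifold `(∇_{Ju} J) v = J (∇_u J) v`. -/
theorem nablaJ_J_left (u v : V) {x : B} (hx : x ∈ S) :
    nablaJ C G J x (J x u) v = J x (nablaJ C G J x u v) := by
  have hi := hG.inner x hx
  -- the difference of the two sides is symmetric in two of its arguments and skew in two others
  set c : V → V → V → ℝ := fun u v w =>
    G x (nablaJ C G J x (J x u) v) w - G x (J x (nablaJ C G J x u v)) w
  have h12 : ∀ u v w, c u v w = c v u w := by
    intro u v w
    have h := congrArg (fun t => G x t w) (hN x hx u v)
    rw [hC.nijenhuis_eq hG hJ u v hx] at h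
    simp only [map_add, map_sub, LinearMap.add_apply, LinearMap.sub_apply, map_zero,
      LinearMap.zero_apply] at h
    simp only [c]; linarith
  have h23 : ∀ u v w, c u w v = -c u v w := by
    intro u v w
    simp only [c]
    rw [hC.nablaJ_skew hG hJ (J x u) v w hx, ← neg_neg (J x (nablaJ C G J x u w)),
      ← hC.nablaJ_J hG hJ u w hx, map_neg, LinearMap.neg_apply,
      hC.nablaJ_skew hG hJ u v (J x w) hx, hJ.skew hx]
    ring
  refine hi.ext fun w => ?_
  have : c u v w = 0 := by
    linarith [h12 u v w, h23 v u w, h12 v w u, h23 w v u, h12 w u v, h23 u w v]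
  simpa [c, sub_eq_zero] using this

theorem bismutTors_eq (u v w : V) {x : B} (hx : x ∈ S) :
    bismutTors C G J x u v w = -(G x (nablaJ C G J x (J x u) v) w
      + G x (nablaJ C G J x (J x v) w) u + G x (nablaJ C G J x (J x w) u) v) := by
  rw [bismutTors, hC.extD_two hG _ hx (altTwo _ (hC.omega_bilin hG hJ x) (hC.omega_self hG hJ hx))
    (fun v => rfl)]
  simp only [hC.nabla_omega hG hJ _ _ _ hx, hC.nablaJ_J hG hJ _ _ hx]
  have h := hJ.herm x hx
  simp only [map_neg, LinearMap.neg_apply, h]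
  rw [hC.nablaJ_skew hG hJ (J x v) w u hx]
  ring

/-- The Bismut connection of a Hermitian metric on a complex manifold preserves `J`. -/
theorem bismut_parallel (hT : IsThreeForm S A (bismutTors C G J)) :
    IsParallelEnd C S J (torsConn C G (bismutTors C G J)) := by
  intro x hx u v
  have hi := hG.inner x hx
  refine hi.ext fun w => ?_
  have h1 := hC.bismutTors_eq hG hJ hN u (J x v) w hx
  have h2 := hC.bismutTors_eq hG hJ hN u v (J x w) hx
  have hl := hC.nablaJ_J_left hG hJ hN
  have h3 : C.derV u (fun y => J y v) x + torsConn C G (bismutTors C G J) x u (J x v)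
      = nablaJ C G J x u v + J x (lc C G x u v)
        + (1 / 2 : ℝ) • tors G (bismutTors C G J) x u (J x v) := by
    rw [nablaJ, torsConn]; abel
  have h4 : G x (J x (tors G (bismutTors C G J) x u v)) w
      = -bismutTors C G J x u v (J x w) := by
    rw [← tors_apply hG hT hx, hJ.skew hx, neg_neg]
  rw [h3, torsConn]
  simp only [map_add, map_smul, LinearMap.add_apply, LinearMap.smul_apply, smul_eq_mul, h4,
    tors_apply hG hT hx]
  rw [h1, h2]
  simp only [hl _ _ hx, hC.nablaJ_J hG hJ _ _ hx, hJ.sq x hx, map_neg, LinearMap.neg_apply,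
    hJ.herm x hx]
  have hn : ∀ a b, nablaJ C G J x (-a) b = -nablaJ C G J x a b :=
    fun a b => ((hC.nablaJ_bilin hG hJ hx).left b).map_neg a
  simp only [hn, map_neg, LinearMap.neg_apply]
  ring

end SmoothCalculus

end Bismut

/-! ### Powers of a two-form -/

section Wedge

variable {V : Type*} [AddCommGroup V] [Module ℝ V]

theorem wedgeTwo_smul {k : ℕ} (β : (Fin 2 → V) → ℝ) (c : ℝ) (α : (Fin k → V) → ℝ)
    (v : Fin (k + 2) → V) : wedgeTwo β (fun w => c * α w) v = c * wedgeTwo β α v := by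
  simp only [wedgeTwo, Finset.mul_sum]
  refine Finset.sum_congr rfl fun j _ => Finset.sum_congr rfl fun i _ => ?_
  ring

theorem wedgeTwo_add {k : ℕ} (β : (Fin 2 → V) → ℝ) (α α' : (Fin k → V) → ℝ)
    (v : Fin (k + 2) → V) :
    wedgeTwo β (fun w => α w + α' w) v = wedgeTwo β α v + wedgeTwo β α' v := by
  simp only [wedgeTwo, mul_add, Finset.sum_add_distrib]

theorem removeNth_succ_cons {k : ℕ} (j : Fin (k + 1)) (z : V) (v : Fin (k + 1) → V) :
    j.succ.removeNth (Fin.cons z v : Fin (k + 2) → V) = Fin.cons z (j.removeNth v) := by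
  funext i
  refine Fin.cases ?_ (fun i => ?_) i
  · simp [Fin.removeNth]
  · simp [Fin.removeNth]

theorem removeNth_zero_cons {k : ℕ} (z : V) (v : Fin k → V) :
    (0 : Fin (k + 1)).removeNth (Fin.cons z v : Fin (k + 1) → V) = v := by
  funext i; simp [Fin.removeNth]

/-- The interior product is an antiderivation, for the wedge product with a `2`-form. -/
theorem wedgeTwo_cons {k : ℕ} {β : (Fin 2 → V) → ℝ} (hβ : ∀ a b, β ![b, a] = -β ![a, b])
    (α : (Fin (k + 1) → V) → ℝ) (z : V) (v : Fin (k + 2) → V) :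
    wedgeTwo β α (Fin.cons z v) = ∑ i : Fin (k + 2), (-1) ^ (i : ℕ) * β ![z, v i]
      * α (i.removeNth v) + wedgeTwo β (fun w => α (Fin.cons z w)) v := by
  have h1 : ∀ j : Fin (k + 2), ∑ i : Fin (k + 2), (-1 : ℝ) ^ ((i : ℕ) + ((j.succ : Fin (k + 3)) : ℕ))
      * β ![(Fin.cons z v : Fin (k + 3) → V) j.succ,
          j.succ.removeNth (Fin.cons z v : Fin (k + 3) → V) i]
      * α (i.removeNth (j.succ.removeNth (Fin.cons z v : Fin (k + 3) → V)))
      = (-1) ^ (j : ℕ) * β ![z, v j] * α (j.removeNth v)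
        + ∑ i : Fin (k + 1), (-1 : ℝ) ^ ((i : ℕ) + (j : ℕ)) * β ![v j, j.removeNth v i]
          * α (Fin.cons z (i.removeNth (j.removeNth v))) := by
    intro j
    rw [Fin.sum_univ_succ]
    simp only [removeNth_succ_cons, Fin.cons_zero, Fin.cons_succ, removeNth_zero_cons]
    congr 1
    · rw [hβ z (v j)]; simp [pow_succ]
    · refine Finset.sum_congr rfl fun i _ => ?_
      simp only [Fin.val_succ]; ring
  rw [wedgeTwo, Fin.sum_univ_succ, Finset.sum_congr rfl fun j _ => h1 j, Finset.sum_add_distrib,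
    wedgeTwo]
  simp only [removeNth_zero_cons, Fin.cons_zero, Fin.val_zero, add_zero]
  ring

theorem sum_removeNth_cons {k : ℕ} (f : V → (Fin (k + 1) → V) → ℝ) (b : V) (w : Fin (k + 1) → V) :
    ∑ i : Fin (k + 2), (-1 : ℝ) ^ (i : ℕ) * f ((Fin.cons b w : Fin (k + 2) → V) i)
        (i.removeNth (Fin.cons b w : Fin (k + 2) → V))
      = f b w - ∑ i : Fin (k + 1), (-1 : ℝ) ^ (i : ℕ) * f (w i) (Fin.cons b (i.removeNth w)) := by
  rw [Fin.sum_univ_succ]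
  simp only [removeNth_succ_cons, removeNth_zero_cons, Fin.cons_zero, Fin.cons_succ, Fin.val_zero,
    pow_zero, one_mul, Fin.val_succ, pow_succ]
  rw [sub_eq_add_neg, ← Finset.sum_neg_distrib]
  congr 1
  refine Finset.sum_congr rfl fun i _ => ?_
  ring

theorem wedgeTwo_zero {β : (Fin 2 → V) → ℝ} (hβ : ∀ a b, β ![b, a] = -β ![a, b])
    (α : (Fin 0 → V) → ℝ) (z b : V) (w : Fin 0 → V) :
    wedgeTwo β α (Fin.cons z (Fin.cons b w)) = β ![z, b] * α w := by
  rw [wedgeTwo, Fin.sum_univ_two, Fin.sum_univ_one, Fin.sum_univ_one]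
  have e1 : (Fin.cons z (Fin.cons b w : Fin 1 → V) : Fin 2 → V) 1 = b := rfl
  have e2 : (1 : Fin 2).removeNth (Fin.cons z (Fin.cons b w : Fin 1 → V) : Fin 2 → V) 0 = z := rfl
  have e3 : ∀ v : Fin 0 → V, α v = α w := fun v => congrArg α (Subsingleton.elim _ _)
  simp only [removeNth_zero_cons, Fin.cons_zero, e1, e2, e3]
  rw [hβ z b]
  simp
  ring

/-- The wedge product of a bilinear form and an alternating map, as an alternating map. -/
noncomputable def wedgeAlt {k : ℕ} (b : LinearMap.BilinForm ℝ V) (a : V [⋀^Fin k]→ₗ[ℝ] ℝ) :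
    V [⋀^Fin (k + 2)]→ₗ[ℝ] ℝ :=
  (1 / 2 : ℝ) • AlternatingMap.alternatizeUncurryFin
    { toFun := fun u => AlternatingMap.alternatizeUncurryFin ((b u).smulRight a)
      map_add' := fun u v => by
        rw [← AlternatingMap.alternatizeUncurryFin_add]; congr 1; ext; simp [add_mul]
      map_smul' := fun c u => by
        rw [RingHom.id_apply, ← AlternatingMap.alternatizeUncurryFin_smul]
        congr 1; ext; simp [mul_assoc] }

theorem wedgeAlt_apply {k : ℕ} (b : LinearMap.BilinForm ℝ V) (a : V [⋀^Fin k]→ₗ[ℝ] ℝ)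
    (v : Fin (k + 2) → V) : wedgeAlt b a v = wedgeTwo (fun w => b (w 0) (w 1)) a v := by
  simp only [wedgeAlt, wedgeTwo, AlternatingMap.smul_apply,
    AlternatingMap.alternatizeUncurryFin_apply, LinearMap.coe_mk, AddHom.coe_mk, smul_eq_mul,
    zsmul_eq_mul, Int.cast_pow, Int.cast_neg, Int.cast_one, LinearMap.smulRight_apply,
    Finset.mul_sum]
  refine Finset.sum_congr rfl fun j _ => Finset.sum_congr rfl fun i _ => ?_
  simp only [Matrix.cons_val_zero, Matrix.cons_val_one]
  ring

/-- The powers of a `2`-form, as alternating maps. -/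
noncomputable def powAlt (b : LinearMap.BilinForm ℝ V) : (m : ℕ) → V [⋀^Fin (2 * m)]→ₗ[ℝ] ℝ
  | 0 => (AlternatingMap.constOfIsEmpty ℝ V (Fin 0) 1 : V [⋀^Fin 0]→ₗ[ℝ] ℝ)
  | m + 1 => wedgeAlt b (powAlt b m)

/-- The derivative of the powers of a `2`-form `b` in the direction `b'`. -/
noncomputable def dpowAlt (b b' : LinearMap.BilinForm ℝ V) : (m : ℕ) → V [⋀^Fin (2 * m)]→ₗ[ℝ] ℝ
  | 0 => 0
  | m + 1 => wedgeAlt b' (powAlt b m) + wedgeAlt b (dpowAlt b b' m)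

theorem powAlt_apply (b : LinearMap.BilinForm ℝ V) (m : ℕ) (v : Fin (2 * m) → V) :
    powAlt b m v = wedgePow (fun w => b (w 0) (w 1)) m v := by
  induction m with
  | zero => rfl
  | succ m ih =>
    rw [powAlt, wedgeAlt_apply, wedgePow]
    congr 1
    funext w; exact ih w

variable {b b' : LinearMap.BilinForm ℝ V}

theorem wedgeAlt_cons (hb : ∀ u v, b v u = -b u v) {k : ℕ} (a : V [⋀^Fin (k + 1)]→ₗ[ℝ] ℝ) (z : V)
    (v : Fin (k + 2) → V) : wedgeAlt b a (Fin.cons z v)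
      = ∑ i : Fin (k + 2), (-1) ^ (i : ℕ) * (b z (v i) * a (i.removeNth v))
        + wedgeAlt b (a.curryLeft z) v := by
  rw [wedgeAlt_apply, wedgeTwo_cons (fun u v => hb _ _), wedgeAlt_apply]
  simp only [mul_assoc]
  rfl

theorem powAlt_cons_eq_zero (hb : ∀ u v, b v u = -b u v) (m : ℕ) (z : V) (w : Fin (2 * m + 1) → V)
    (h : ∀ i, b z (w i) = 0) :
    powAlt b (m + 1) (Fin.cons z w : Fin (2 * m + 2) → V) = 0 := by
  induction m with
  | zero =>
    obtain ⟨w0, w1, rfl⟩ : ∃ (w0 : V) (w1 : Fin 0 → V), w = Fin.cons w0 w1 :=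
      ⟨w 0, Fin.tail w, (Fin.cons_self_tail w).symm⟩
    have h0 : b z w0 = 0 := by simpa using h 0
    rw [powAlt, wedgeAlt_apply]
    exact (wedgeTwo_zero (fun u v => hb _ _) _ z w0 w1).trans (by simp [h0])
  | succ m ih =>
    rw [powAlt]
    refine (wedgeAlt_cons hb (k := 2 * m + 1) (powAlt b (m + 1)) z w).trans ?_
    have e1 : ∀ v : Fin (2 * m + 1) → V, (∀ i, b z (v i) = 0) →
        (powAlt b (m + 1)).curryLeft z v = 0 := fun v hv => ih v hv
    rw [wedgeAlt_apply, wedgeTwo]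
    have e2 : ∀ (j : Fin (2 * m + 3)) (i : Fin (2 * m + 2)),
        (powAlt b (m + 1)).curryLeft z (i.removeNth (j.removeNth w)) = 0 :=
      fun j i => e1 _ fun l => h _
    simp only [h, zero_mul, mul_zero, Finset.sum_const_zero, zero_add]
    exact mul_eq_zero_of_right _ (Finset.sum_eq_zero fun j _ => Finset.sum_eq_zero fun i _ =>
      mul_eq_zero_of_right _ (e2 j i))

theorem wedgeAlt_cons_cons (hb : ∀ u v, b v u = -b u v) {k : ℕ} (a : V [⋀^Fin (k + 2)]→ₗ[ℝ] ℝ)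
    (z y : V) (w : Fin (k + 2) → V) :
    wedgeAlt b a (Fin.cons z (Fin.cons y w : Fin (k + 3) → V))
      = b z y * a w
        - ∑ i : Fin (k + 2), (-1) ^ (i : ℕ) * (b z (w i) * a (Fin.cons y (i.removeNth w)))
        + ∑ i : Fin (k + 2), (-1) ^ (i : ℕ) * (b y (w i) * a (Fin.cons z (i.removeNth w)))
        + wedgeAlt b ((a.curryLeft z).curryLeft y) w := by
  rw [wedgeAlt_cons hb (k := k + 1), wedgeAlt_cons hb (k := k),
    sum_removeNth_cons (fun u v => b z u * a v)]
  simp only [add_assoc]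
  rfl

theorem wedgeAlt_congr {k : ℕ} (a a' : V [⋀^Fin k]→ₗ[ℝ] ℝ) (v : Fin (k + 2) → V)
    (h : ∀ (j : Fin (k + 2)) (i : Fin (k + 1)),
      a (i.removeNth (j.removeNth v)) = a' (i.removeNth (j.removeNth v))) :
    wedgeAlt b a v = wedgeAlt b a' v := by
  rw [wedgeAlt_apply, wedgeAlt_apply, wedgeTwo, wedgeTwo]
  congr 1
  refine Finset.sum_congr rfl fun j _ => Finset.sum_congr rfl fun i _ => ?_
  rw [h]

theorem wedgeAlt_smul {k : ℕ} (c : ℝ) (a : V [⋀^Fin k]→ₗ[ℝ] ℝ) (v : Fin (k + 2) → V) :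
    wedgeAlt b (c • a) v = c * wedgeAlt b a v := by
  rw [wedgeAlt_apply, wedgeAlt_apply, ← wedgeTwo_smul]
  rfl

theorem wedgeAlt_add {k : ℕ} (a a' : V [⋀^Fin k]→ₗ[ℝ] ℝ) (v : Fin (k + 2) → V) :
    wedgeAlt b (a + a') v = wedgeAlt b a v + wedgeAlt b a' v := by
  rw [wedgeAlt_apply, wedgeAlt_apply, wedgeAlt_apply, ← wedgeTwo_add]
  rfl

theorem wedgeAlt_zero_cons_cons (hb : ∀ u v, b v u = -b u v) (a : V [⋀^Fin 0]→ₗ[ℝ] ℝ)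
    (z y : V) (w : Fin 0 → V) : wedgeAlt b a (Fin.cons z (Fin.cons y w : Fin 1 → V)) = b z y * a w := by
  rw [wedgeAlt_apply]
  exact wedgeTwo_zero (fun u v => hb _ _) _ z y w

/-- A vector `y` orthogonal to all of `w` can only be paired with `z`. -/
theorem powAlt_cons_cons (hb : ∀ u v, b v u = -b u v) (m : ℕ) (z y : V) (w : Fin (2 * m) → V)
    (h : ∀ i, b y (w i) = 0) :
    powAlt b (m + 1) (Fin.cons z (Fin.cons y w : Fin (2 * m + 1) → V) : Fin (2 * m + 2) → V)
      = (m + 1) * b z y * powAlt b m w := by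
  induction m with
  | zero =>
    exact (wedgeAlt_zero_cons_cons hb (powAlt b 0) z y w).trans (by simp)
  | succ m ih =>
    refine (wedgeAlt_cons_cons hb (k := 2 * m) (powAlt b (m + 1)) z y w).trans ?_
    have e1 : ∀ i : Fin (2 * m + 2), powAlt b (m + 1)
        (Fin.cons y (i.removeNth w : Fin (2 * m + 1) → V) : Fin (2 * m + 2) → V) = 0 :=
      fun i => powAlt_cons_eq_zero hb m y (i.removeNth w) fun l => h _
    have e2 : wedgeAlt b (((powAlt b (m + 1)).curryLeft z).curryLeft y : V [⋀^Fin (2 * m)]→ₗ[ℝ] ℝ) w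
        = ((m + 1) * b z y) * powAlt b (m + 1) w := by
      rw [powAlt, ← wedgeAlt_smul]
      refine wedgeAlt_congr _ _ _ fun j i => ?_
      exact ih (i.removeNth (j.removeNth w)) fun l => h _
    rw [e2]
    have e3 : ∑ i : Fin (2 * m + 2), (-1 : ℝ) ^ (i : ℕ) * (b z (w i) * powAlt b (m + 1)
        (Fin.cons y (i.removeNth w : Fin (2 * m + 1) → V) : Fin (2 * m + 2) → V)) = 0 :=
      Finset.sum_eq_zero fun i _ => by rw [e1 i]; ring
    have e4 : ∑ i : Fin (2 * m + 2), (-1 : ℝ) ^ (i : ℕ) * (b y (w i) * powAlt b (m + 1)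
        (Fin.cons z (i.removeNth w : Fin (2 * m + 1) → V) : Fin (2 * m + 2) → V)) = 0 :=
      Finset.sum_eq_zero fun i _ => by rw [h i]; ring
    refine (congrArg₂ (fun s t => b z y * powAlt b (m + 1) w - s + t
      + (m + 1) * b z y * powAlt b (m + 1) w) e3 e4).trans ?_
    push_cast; ring

theorem dpowAlt_cons_cons (hb : ∀ u v, b v u = -b u v) (hb' : ∀ u v, b' v u = -b' u v) (m : ℕ)
    (z y : V) (w : Fin (2 * m) → V) (hz : ∀ i, b z (w i) = 0) (hy : ∀ i, b y (w i) = 0) :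
    dpowAlt b b' (m + 1) (Fin.cons z (Fin.cons y w : Fin (2 * m + 1) → V) : Fin (2 * m + 2) → V)
      = (m + 1) * (b' z y * powAlt b m w + b z y * dpowAlt b b' m w) := by
  induction m with
  | zero =>
    refine (congrArg₂ (· + ·) (wedgeAlt_zero_cons_cons hb' (powAlt b 0) z y w)
      (wedgeAlt_zero_cons_cons hb (dpowAlt b b' 0) z y w)).trans ?_
    simp
  | succ m ih =>
    have e0 : ∀ x, (∀ i, b x (w i) = 0) → ∀ i : Fin (2 * m + 2), powAlt b (m + 1)
        (Fin.cons x (i.removeNth w : Fin (2 * m + 1) → V) : Fin (2 * m + 2) → V) = 0 :=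
      fun x hx i => powAlt_cons_eq_zero hb m x (i.removeNth w) fun l => hx _
    have s0 : ∀ (c : V → V → ℝ) (t x : V), (∀ i, b x (w i) = 0) →
        ∑ i : Fin (2 * m + 2), (-1 : ℝ) ^ (i : ℕ) * (c t (w i) * powAlt b (m + 1)
        (Fin.cons x (i.removeNth w : Fin (2 * m + 1) → V) : Fin (2 * m + 2) → V)) = 0 :=
      fun c t x hx => Finset.sum_eq_zero fun i _ => by rw [e0 x hx i]; ring
    have s1 : ∀ (t x : V), (∀ i, b t (w i) = 0) →
        ∑ i : Fin (2 * m + 2), (-1 : ℝ) ^ (i : ℕ) * (b t (w i) * dpowAlt b b' (m + 1)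
        (Fin.cons x (i.removeNth w : Fin (2 * m + 1) → V) : Fin (2 * m + 2) → V)) = 0 :=
      fun t x hx => Finset.sum_eq_zero fun i _ => by rw [hx i]; ring
    have e2 : wedgeAlt b' (((powAlt b (m + 1)).curryLeft z).curryLeft y : V [⋀^Fin (2 * m)]→ₗ[ℝ] ℝ) w
        = ((m + 1) * b z y) * wedgeAlt b' (powAlt b m) w := by
      rw [← wedgeAlt_smul]
      refine wedgeAlt_congr _ _ _ fun j i => ?_
      exact powAlt_cons_cons hb m z y (i.removeNth (j.removeNth w)) fun l => hy _
    have e3 : wedgeAlt b (((dpowAlt b b' (m + 1)).curryLeft z).curryLeft y :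
        V [⋀^Fin (2 * m)]→ₗ[ℝ] ℝ) w
        = ((m + 1) * b' z y) * wedgeAlt b (powAlt b m) w
          + ((m + 1) * b z y) * wedgeAlt b (dpowAlt b b' m) w := by
      rw [← wedgeAlt_smul, ← wedgeAlt_smul, ← wedgeAlt_add]
      refine wedgeAlt_congr _ _ _ fun j i => ?_
      refine (ih (i.removeNth (j.removeNth w)) (fun l => hz _) fun l => hy _).trans ?_
      simp only [AlternatingMap.add_apply, AlternatingMap.smul_apply, smul_eq_mul]
      ring
    have t1 := wedgeAlt_cons_cons hb' (k := 2 * m) (powAlt b (m + 1)) z y w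
    have t2 := wedgeAlt_cons_cons hb (k := 2 * m) (dpowAlt b b' (m + 1)) z y w
    have t1' := t1.trans (congrArg₂ (fun s t => b' z y * powAlt b (m + 1) w - s + t + _)
      (s0 (fun t x => b' t x) z y hy) (s0 (fun t x => b' t x) y z hz))
    have t2' := t2.trans (congrArg₂ (fun s t => b z y * dpowAlt b b' (m + 1) w - s + t + _)
      (s1 z y hz) (s1 y z hy))
    refine (congrArg₂ (· + ·) (t1'.trans (congrArg _ e2)) (t2'.trans (congrArg _ e3))).trans ?_
    have d1 : powAlt b (m + 1) w = wedgeAlt b (powAlt b m) w := rfl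
    have d2 : dpowAlt b b' (m + 1) w
      = wedgeAlt b' (powAlt b m) w + wedgeAlt b (dpowAlt b b' m) w := rfl
    have d3 : (fun t x => b' t x) z y = b' z y := rfl
    rw [d1, d2]
    push_cast; ring

/-- The `(2m+1)`-form obtained by antisymmetrizing the derivatives of the `m`-th power of `b`, when
`D u` is the derivative of `b` along `u`. -/
noncomputable def altDpow (b : LinearMap.BilinForm ℝ V) (D : V → LinearMap.BilinForm ℝ V) (m : ℕ)
    (v : Fin (2 * m + 1) → V) : ℝ :=
  ∑ j : Fin (2 * m + 1), (-1) ^ (j : ℕ) * dpowAlt b (D (v j)) m (j.removeNth v)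

theorem alt_rot {k : ℕ} (a : V [⋀^Fin (k + 3)]→ₗ[ℝ] ℝ) (u y z : V) (w : Fin k → V) :
    a (Fin.cons u (Fin.cons y (Fin.cons z w : Fin (k + 1) → V) : Fin (k + 2) → V))
      = a (Fin.cons y (Fin.cons z (Fin.cons u w : Fin (k + 1) → V) : Fin (k + 2) → V)) := by
  have h := a.map_insertNth (Fin.succ (Fin.succ 0)) u
    (Fin.cons y (Fin.cons z w : Fin (k + 1) → V) : Fin (k + 2) → V)
  have e : (Fin.succ (Fin.succ 0) : Fin (k + 3)).insertNth (α := fun _ => V) u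
      (Fin.cons y (Fin.cons z w : Fin (k + 1) → V) : Fin (k + 2) → V)
      = Fin.cons y (Fin.cons z (Fin.cons u w : Fin (k + 1) → V) : Fin (k + 2) → V) := by
    rw [Fin.insertNth_eq_iff]
    refine ⟨rfl, ?_⟩
    rw [removeNth_succ_cons, removeNth_succ_cons, removeNth_zero_cons]
  have e2 : ((Fin.succ (Fin.succ 0) : Fin (k + 3)) : ℕ) = 2 := rfl
  rw [e, e2] at h
  rw [h]
  simp [Matrix.vecCons]

/-- The recursion for the derivative of the powers of `b`, evaluated on a plane spanned by `y`, `z`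
and on vectors `w`, `u` orthogonal to this plane and to `u`. -/
theorem altDpow_cons {D : V → LinearMap.BilinForm ℝ V} (hb : ∀ u v, b v u = -b u v)
    (hD : ∀ s u v, D s v u = -D s u v) (m : ℕ) (u y z : V) (w : Fin (2 * m) → V)
    (huy : b u y = 0) (huz : b u z = 0) (hu : ∀ i, b u (w i) = 0) (hy : ∀ i, b y (w i) = 0)
    (hz : ∀ i, b z (w i) = 0) :
    altDpow b D (m + 1) (Fin.cons u (Fin.cons y (Fin.cons z w : Fin (2 * m + 1) → V) :
        Fin (2 * m + 2) → V) : Fin (2 * m + 3) → V)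
      = (m + 1) * ((D u y z - D y u z + D z u y) * powAlt b m w
        + b y z * altDpow b D m (Fin.cons u w)) := by
  have g1 : dpowAlt b (D u) (m + 1) (Fin.cons y (Fin.cons z w : Fin (2 * m + 1) → V) :
      Fin (2 * m + 2) → V) = _ := dpowAlt_cons_cons hb (hD u) m y z w hy hz
  have g2 : dpowAlt b (D y) (m + 1) (Fin.cons u (Fin.cons z w : Fin (2 * m + 1) → V) :
      Fin (2 * m + 2) → V) = _ := dpowAlt_cons_cons hb (hD y) m u z w hu hz
  have g3 : dpowAlt b (D z) (m + 1) (Fin.cons u (Fin.cons y w : Fin (2 * m + 1) → V) :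
      Fin (2 * m + 2) → V) = _ := dpowAlt_cons_cons hb (hD z) m u y w hu hy
  cases m with
  | zero =>
    have s1 := (sum_removeNth_cons (fun s v => dpowAlt b (D s) 1 v) u
      (Fin.cons y (Fin.cons z w : Fin 1 → V) : Fin 2 → V)).trans (congrArg _
      (sum_removeNth_cons (fun s v => dpowAlt b (D s) 1 (Fin.cons u v : Fin 2 → V)) y
        (Fin.cons z w : Fin 1 → V)))
    rw [Fin.sum_univ_one] at s1
    refine s1.trans ?_
    rw [removeNth_zero_cons]
    refine (congrArg₂ (fun s t => s - t) g1 (congrArg₂ (fun s t => s - (-1) ^ ((0 : Fin 1) : ℕ) * t)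
      g2 g3)).trans ?_
    simp [huy, huz, altDpow, dpowAlt]
    ring
  | succ m =>
    have g4 : ∀ i : Fin (2 * m + 2), dpowAlt b (D (w i)) (m + 2) (Fin.cons u (Fin.cons y
        (Fin.cons z (i.removeNth w) : Fin (2 * m + 2) → V) : Fin (2 * m + 3) → V) :
        Fin (2 * m + 4) → V)
        = (m + 2) * (b y z * dpowAlt b (D (w i)) (m + 1) (Fin.cons u (i.removeNth w))) := by
      intro i
      refine (alt_rot (k := 2 * m + 1) (dpowAlt b (D (w i)) (m + 2)) u y z (i.removeNth w)).trans ?_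
      have h0 : powAlt b (m + 1) (Fin.cons u (i.removeNth w : Fin (2 * m + 1) → V) :
          Fin (2 * m + 2) → V) = 0 := powAlt_cons_eq_zero hb m u _ fun l => hu _
      refine (dpowAlt_cons_cons hb (hD (w i)) (m + 1) y z (Fin.cons u (i.removeNth w)) ?_ ?_).trans ?_
      · refine fun l => Fin.cases ?_ (fun l => ?_) l
        · simp [hb u y, huy]
        · exact hy _
      · refine fun l => Fin.cases ?_ (fun l => ?_) l
        · simp [hb u z, huz]
        · exact hz _
      · rw [h0]; push_cast; ring
    have s1 := (sum_removeNth_cons (fun s v => dpowAlt b (D s) (m + 2) v) u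
      (Fin.cons y (Fin.cons z w : Fin (2 * m + 3) → V) : Fin (2 * m + 4) → V)).trans (congrArg _
      ((sum_removeNth_cons (fun s v => dpowAlt b (D s) (m + 2) (Fin.cons u v : Fin (2 * m + 4) → V)) y
        (Fin.cons z w : Fin (2 * m + 3) → V)).trans (congrArg _
      (sum_removeNth_cons (fun s v => dpowAlt b (D s) (m + 2) (Fin.cons u (Fin.cons y v :
        Fin (2 * m + 3) → V) : Fin (2 * m + 4) → V)) z w))))
    have s2 := sum_removeNth_cons (fun s v => dpowAlt b (D s) (m + 1) v) u w
    have s3 : ∑ i : Fin (2 * m + 2), (-1 : ℝ) ^ (i : ℕ) * dpowAlt b (D (w i)) (m + 2) (Fin.cons u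
        (Fin.cons y (Fin.cons z (i.removeNth w) : Fin (2 * m + 2) → V) : Fin (2 * m + 3) → V) :
        Fin (2 * m + 4) → V) = (m + 2) * b y z * ∑ i : Fin (2 * m + 2), (-1 : ℝ) ^ (i : ℕ)
          * dpowAlt b (D (w i)) (m + 1) (Fin.cons u (i.removeNth w)) := by
      rw [Finset.mul_sum]
      refine Finset.sum_congr rfl fun i _ => ?_
      rw [g4]; ring
    have s4 : altDpow b D (m + 1) (Fin.cons u w) = _ := s2
    have s5 : ∀ {s t r : ℝ}, s = t - r → r = t - s := fun h => by linarith
    refine s1.trans ?_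
    refine (congrArg₂ (fun s t => s - t) g1 (congrArg₂ (fun s t => s - t) g2
      (congrArg₂ (fun s t => s - t) g3 (s3.trans (congrArg _ (s5 s4)))))).trans ?_
    rw [huy, huz]
    push_cast; ring

end Wedge

/-! ### The derivative of the powers of the fundamental form, and unitary frames -/

section NablaWedge

variable {B V : Type*} [AddCommGroup V] [Module ℝ V] [FiniteDimensional ℝ V]
  {C : FrameCalculus B V} {S : Set B} {A : Subalgebra ℝ (B → ℝ)}
  {G : B → LinearMap.BilinForm ℝ V} {J : B → Module.End ℝ V}

theorem removeNth_update_succAbove {k : ℕ} (j : Fin (k + 1)) (l : Fin k) (v : Fin (k + 1) → V)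
    (z : V) : j.removeNth (Function.update v (j.succAbove l) z)
      = Function.update (j.removeNth v) l z := by
  funext m
  by_cases hm : m = l
  · subst hm; simp [Fin.removeNth]
  · have : j.succAbove m ≠ j.succAbove l := fun h => hm (Fin.succAbove_right_injective h)
    simp [Fin.removeNth, hm]

theorem removeNth_update_self {k : ℕ} (j : Fin (k + 1)) (v : Fin (k + 1) → V) (z : V) :
    j.removeNth (Function.update v j z) = j.removeNth v := by
  simp [Fin.removeNth_update]

theorem wedgeTwo_mem {k : ℕ} {β : B → (Fin 2 → V) → ℝ} {α : B → (Fin k → V) → ℝ}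
    (hβ : ∀ v, (fun y => β y v) ∈ A) (hα : ∀ v, (fun y => α y v) ∈ A) (v : Fin (k + 2) → V) :
    (fun y => wedgeTwo (β y) (α y) v) ∈ A :=
  fun_mul_mem (const_mem _) (fun_sum_mem _ fun _ _ => fun_sum_mem _ fun _ _ =>
    fun_mul_mem (fun_mul_mem (const_mem _) (hβ _)) (hα _))

theorem wedgePow_mem {β : B → (Fin 2 → V) → ℝ} (hβ : ∀ v, (fun y => β y v) ∈ A) (m : ℕ)
    (v : Fin (2 * m) → V) : (fun y => wedgePow (β y) m v) ∈ A := by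
  induction m with
  | zero => exact const_mem _
  | succ m ih => exact wedgeTwo_mem hβ ih v

/-- The bilinear form `ω`. -/
noncomputable def omegaBil (G : B → LinearMap.BilinForm ℝ V)
    (J : B → Module.End ℝ V) (x : B) : LinearMap.BilinForm ℝ V := G x ∘ₗ J x

namespace SmoothCalculus

variable (hC : SmoothCalculus C S A)
include hC

/-- The Leibniz rule for the covariant derivative of a wedge product. -/
theorem nabla_wedgeTwo (g : B → V → V → ℝ) {k : ℕ} {β : B → (Fin 2 → V) → ℝ}
    {α : B → (Fin k → V) → ℝ} (hβ : ∀ v, (fun y => β y v) ∈ A) (hα : ∀ v, (fun y => α y v) ∈ A)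
    (u : V) (w : Fin (k + 2) → V) {x : B} (hx : x ∈ S) :
    nabla C g u (fun y => wedgeTwo (β y) (α y)) x w
      = wedgeTwo (fun v => nabla C g u β x v) (α x) w
        + wedgeTwo (β x) (fun v => nabla C g u α x v) w := by
  set Γ := leviCivita C g x u
  have hm : ∀ (j : Fin (k + 2)) (i : Fin (k + 1)), (fun y => (-1 : ℝ) ^ ((i : ℕ) + (j : ℕ))
      * β y ![w j, j.removeNth w i] * α y (i.removeNth (j.removeNth w))) ∈ A := fun j i =>
    fun_mul_mem (fun_mul_mem (const_mem _) (hβ _)) (hα _)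
  have h1 : C.derS u (fun y => wedgeTwo (β y) (α y) w) x
      = (1 / 2) * ∑ j : Fin (k + 2), ∑ i : Fin (k + 1), ((-1) ^ ((i : ℕ) + (j : ℕ))
        * (C.derS u (fun y => β y ![w j, j.removeNth w i]) x * α x (i.removeNth (j.removeNth w))
          + β x ![w j, j.removeNth w i]
            * C.derS u (fun y => α y (i.removeNth (j.removeNth w))) x)) := by
    have := hC.der_const_mul u (1 / 2) (fun_sum_mem Finset.univ fun j _ =>
      fun_sum_mem Finset.univ fun i _ => hm j i) hx
    refine this.trans ?_
    rw [hC.der_sum u _ (fun j _ => fun_sum_mem Finset.univ fun i _ => hm j i) hx]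
    congr 1
    refine Finset.sum_congr rfl fun j _ => ?_
    rw [hC.der_sum u _ (fun i _ => hm j i) hx]
    refine Finset.sum_congr rfl fun i _ => ?_
    rw [hC.der_mul u (fun_mul_mem (const_mem _) (hβ _)) (hα _) x hx,
      hC.der_const_mul u _ (hβ _) hx]
    ring
  have h2 : ∑ l, wedgeTwo (β x) (α x) (Function.update w l (Γ (w l)))
      = (1 / 2) * ∑ j : Fin (k + 2), ∑ i : Fin (k + 1), ((-1) ^ ((i : ℕ) + (j : ℕ))
        * ((β x ![Γ (w j), j.removeNth w i] + β x ![w j, Γ (j.removeNth w i)])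
            * α x (i.removeNth (j.removeNth w))
          + β x ![w j, j.removeNth w i] * ∑ l, α x (Function.update (i.removeNth (j.removeNth w)) l
            (Γ (i.removeNth (j.removeNth w) l))))) := by
    simp only [wedgeTwo]
    rw [← Finset.mul_sum, Finset.sum_comm]
    congr 1
    refine Finset.sum_congr rfl fun j _ => ?_
    rw [Finset.sum_comm]
    refine Finset.sum_congr rfl fun i _ => ?_
    rw [Fin.sum_univ_succAbove _ j, Fin.sum_univ_succAbove _ i]
    simp only [removeNth_update_self, removeNth_update_succAbove, Function.update_self]
    have n1 : ∀ l z, Function.update w (j.succAbove l) z j = w j := fun l z => by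
      rw [Function.update_of_ne (Fin.succAbove_ne j l).symm]
    have n2 : ∀ l z, Function.update (j.removeNth w) (i.succAbove l) z i = j.removeNth w i :=
      fun l z => by rw [Function.update_of_ne (Fin.succAbove_ne i l).symm]
    simp only [n1, n2, ← Finset.mul_sum]
    have n3 : ∀ l, i.removeNth (j.removeNth w) l = w (j.succAbove (i.succAbove l)) := fun _ => rfl
    have n4 : j.removeNth w i = w (j.succAbove i) := rfl
    simp only [n3, n4]
    ring
  rw [nabla, h1, h2, wedgeTwo, wedgeTwo, ← mul_sub, ← mul_add, ← Finset.sum_sub_distrib,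
    ← Finset.sum_add_distrib]
  congr 1
  refine Finset.sum_congr rfl fun j _ => ?_
  rw [← Finset.sum_sub_distrib, ← Finset.sum_add_distrib]
  refine Finset.sum_congr rfl fun i _ => ?_
  rw [nabla_two, nabla]
  ring

variable (hG : IsMetricField S A G) (hJ : IsHermitianField S A G J)
include hG hJ

theorem omega_mem (v : Fin 2 → V) :
    (fun y => omega (fun y a b => G y a b) (fun y a => J y a) y v) ∈ A :=
  hC.metric_apply_mem hG (hJ.mem _) (VecIn.const _)

/-- The bilinear form `∇_u ω`. -/
noncomputable def nablaOmegaBil {x : B} (hx : x ∈ S) (u : V) : LinearMap.BilinForm ℝ V :=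
  let N : Module.End ℝ V := ((hC.nablaJ_bilin hG hJ hx).right u).mk' _
  G x ∘ₗ N

theorem nabla_wedgePow (u : V) (m : ℕ) (w : Fin (2 * m) → V) {x : B} (hx : x ∈ S) :
    nabla C (fun y a b => G y a b) u
        (fun y => wedgePow (omega (fun y a b => G y a b) (fun y a => J y a) y) m) x w
      = dpowAlt (omegaBil G J x) (hC.nablaOmegaBil hG hJ hx u) m w := by
  induction m with
  | zero =>
    have h : ∀ l : Fin (2 * 0), False := fun l => Fin.elim0 l
    rw [nabla]
    simp only [wedgePow, hC.der_const u _ x hx]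
    rw [Finset.sum_eq_zero fun l _ => (h l).elim]
    simp [dpowAlt]
  | succ m ih =>
    have := hC.nabla_wedgeTwo (fun y a b => G y a b) (hC.omega_mem hG hJ)
      (wedgePow_mem (hC.omega_mem hG hJ) m) u w hx
    refine this.trans ?_
    rw [dpowAlt, AlternatingMap.add_apply, wedgeAlt_apply, wedgeAlt_apply]
    have e1 : (fun v => nabla C (fun y a b => G y a b) u
        (omega (fun y a b => G y a b) fun y a => J y a) x v)
        = fun v : Fin 2 → V => hC.nablaOmegaBil hG hJ hx u (v 0) (v 1) := by
      funext v
      have hv : v = ![v 0, v 1] := by funext i; fin_cases i <;> rfl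
      rw [hv, hC.nabla_omega hG hJ _ _ _ hx]
      rfl
    rw [e1]
    congr 1
    · congr 1; funext v; exact (powAlt_apply (omegaBil G J x) m v).symm
    · congr 1; funext v; exact ih v

theorem omegaBil_skew {x : B} (hx : x ∈ S) (u v : V) :
    omegaBil G J x v u = -omegaBil G J x u v := by
  change G x (J x v) u = -G x (J x u) v
  rw [(hG.inner x hx).symm, hJ.skew hx]

theorem nablaOmegaBil_skew {x : B} (hx : x ∈ S) (s u v : V) :
    hC.nablaOmegaBil hG hJ hx s v u = -hC.nablaOmegaBil hG hJ hx s u v :=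
  hC.nablaJ_skew hG hJ s u v hx

/-- The derivative of `ω^m` as the antisymmetrized derivative of a power. -/
theorem extD_wedgePow (m : ℕ) (v : Fin (2 * m + 1) → V) {x : B} (hx : x ∈ S) :
    extD C (fun y => wedgePow (omega (fun y a b => G y a b) (fun y a => J y a) y) m) x v
      = altDpow (omegaBil G J x) (fun u => hC.nablaOmegaBil hG hJ hx u) m v := by
  rw [hC.extD_eq_nabla hG _ hx (powAlt (omegaBil G J x) m) fun w =>
    (powAlt_apply (omegaBil G J x) m w).symm]
  simp only [hC.nabla_wedgePow hG hJ _ _ _ hx]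
  rfl

/-- `dω` at vectors, in terms of `∇J`. -/
theorem extD_omega (u v w : V) {x : B} (hx : x ∈ S) :
    extD C (omega (fun y a b => G y a b) fun y a => J y a) x ![u, v, w]
      = G x (nablaJ C G J x u v) w - G x (nablaJ C G J x v u) w + G x (nablaJ C G J x w u) v := by
  rw [hC.extD_two hG _ hx (altTwo _ (hC.omega_bilin hG hJ x) (hC.omega_self hG hJ hx))
    (fun v => rfl)]
  simp only [hC.nabla_omega hG hJ _ _ _ hx]

theorem extD_omega_alt {x : B} (hx : x ∈ S) : IsAlt3 fun u v w =>
    extD C (omega (fun y a b => G y a b) fun y a => J y a) x ![u, v, w] := by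
  have hb := hC.nablaJ_bilin hG hJ hx
  simp only [hC.extD_omega hG hJ _ _ _ hx]
  refine ⟨fun v w => ⟨fun a b => ?_, fun c a => ?_⟩, fun u v w => ?_, fun u v w => ?_⟩
  · have h1 : nablaJ C G J x (a + b) v = nablaJ C G J x a v + nablaJ C G J x b v :=
      (hb.left v).map_add a b
    have h2 := (hb.right v).map_add a b
    have h3 := (hb.right w).map_add a b
    rw [h1, h2, h3]
    simp only [map_add, LinearMap.add_apply]; ring
  · have h1 : nablaJ C G J x (c • a) v = c • nablaJ C G J x a v := (hb.left v).map_smul c a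
    have h2 := (hb.right v).map_smul c a
    have h3 := (hb.right w).map_smul c a
    rw [h1, h2, h3]
    simp only [map_smul, LinearMap.smul_apply, smul_eq_mul]; ring
  · rw [hC.nablaJ_skew hG hJ w u v hx]; ring
  · rw [hC.nablaJ_skew hG hJ u v w hx]; ring

end SmoothCalculus

end NablaWedge

section UnitaryFrame

variable {V : Type*} [AddCommGroup V] [Module ℝ V] [FiniteDimensional ℝ V]

/-- A family of vectors such that the `e i` and the `J (e i)` together are orthonormal. -/
structure IsUnitary (G : LinearMap.BilinForm ℝ V) (J : Module.End ℝ V) {k : ℕ} (e : Fin k → V) :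
    Prop where
  orth : ∀ i j, G (e i) (e j) = if i = j then 1 else 0
  orthJ : ∀ i j, G (e i) (J (e j)) = 0

/-- A unit vector is part of a unitary frame. -/
theorem IsInner.exists_unitary {G : LinearMap.BilinForm ℝ V} (hG : IsInner G) {J : Module.End ℝ V}
    (hJ : ∀ u, J (J u) = -u) (hH : ∀ u v, G (J u) (J v) = G u v) {u : V} (hu : G u u = 1) (m : ℕ)
    (hm : 2 * m < Module.finrank ℝ V) : ∃ e : Fin (m + 1) → V, e 0 = u ∧ IsUnitary G J e := by
  have hsk : ∀ u v, G u (J v) = -G (J u) v := by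
    intro u v
    have := hH (J u) v
    rw [hJ, map_neg, LinearMap.neg_apply] at this
    linarith
  have hself : ∀ u, G u (J u) = 0 := fun u => by
    have := hsk u u
    rw [hG.symm (J u)] at this; linarith
  induction m with
  | zero =>
    exact ⟨fun _ => u, rfl, fun i j => by
      have h : i = j := Fin.ext (by omega)
      simp [hu, h], fun _ _ => hself u⟩
  | succ m ih =>
    obtain ⟨e, he0, he⟩ := ih (by omega)
    -- for reasons of dimension some `v ≠ 0` is orthogonal to all `e i` and `J (e i)`
    let f : V →ₗ[ℝ] (Fin (m + 1) → ℝ) × (Fin (m + 1) → ℝ) :=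
      (LinearMap.pi fun i => G (e i)).prod (LinearMap.pi fun i => G (J (e i)))
    have hker : LinearMap.ker f ≠ ⊥ := LinearMap.ker_ne_bot_of_finrank_lt (by simp; omega)
    obtain ⟨v, hv, hv0⟩ := Submodule.exists_mem_ne_zero_of_ne_bot hker
    have hv' : f v = 0 := hv
    have h1 : ∀ i, G (e i) v = 0 := fun i => congrFun (congrArg Prod.fst hv') i
    have h2 : ∀ i, G (J (e i)) v = 0 := fun i => congrFun (congrArg Prod.snd hv') i
    have hp := hG.pos v hv0
    set c : ℝ := (Real.sqrt (G v v))⁻¹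
    have hc : c * c * G v v = 1 := by
      rw [← mul_inv, Real.mul_self_sqrt hp.le]; exact inv_mul_cancel₀ hp.ne'
    refine ⟨Fin.snoc (α := fun _ => V) e (c • v), ?_, ?_, ?_⟩
    · have : (0 : Fin (m + 2)) = Fin.castSucc 0 := rfl
      rw [this, Fin.snoc_castSucc, he0]
    · intro i j
      refine Fin.lastCases ?_ (fun i => ?_) i <;> refine Fin.lastCases ?_ (fun j => ?_) j
      · simp; linarith
      · simp [hG.symm v, h1, (Fin.castSucc_lt_last j).ne']
      · simp [h1, (Fin.castSucc_lt_last i).ne]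
      · simp [he.orth]
    · intro i j
      refine Fin.lastCases ?_ (fun i => ?_) i <;> refine Fin.lastCases ?_ (fun j => ?_) j
      · simp [hself]
      · simp [hG.symm v, h2]
      · simp [hsk, h2]
      · simp [he.orthJ]

/-- A unitary frame of maximal length computes the metric trace. -/
theorem IsInner.gtr_eq_unitary_sum {G : LinearMap.BilinForm ℝ V} (hG : IsInner G)
    {J : Module.End ℝ V} (hH : ∀ u v, G (J u) (J v) = G u v) {m : ℕ} {e : Fin m → V}
    (he : IsUnitary G J e) (hm : Module.finrank ℝ V = 2 * m) {Q : V → V → ℝ} (hQ : IsBilin Q) :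
    gtr (fun u v => G u v) Q = ∑ i, (Q (e i) (e i) + Q (J (e i)) (J (e i))) := by
  set f : Fin m ⊕ Fin m → V := Sum.elim e fun i => J (e i)
  have hf : ∀ i j, G (f i) (f j) = if i = j then 1 else 0 := by
    rintro (i | i) (j | j)
    · simp [f, he.orth]
    · simp [f, he.orthJ]
    · simp [f, hG.symm (J (e i)), he.orthJ]
    · simp [f, hH, he.orth]
  have hli : LinearIndependent ℝ f := by
    rw [Fintype.linearIndependent_iff]
    intro c hc i
    have := congrArg (fun t => G t (f i)) hc
    simpa only [map_sum, map_smul, LinearMap.sum_apply, LinearMap.smul_apply, hf, smul_eq_mul,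
      mul_ite, mul_one, mul_zero, Finset.sum_ite_eq', Finset.sum_ite_eq, Finset.mem_univ, if_true,
      map_zero, LinearMap.zero_apply] using this
  have hcard : Fintype.card (Fin m ⊕ Fin m) = Module.finrank ℝ V := by simp; omega
  have key : ∀ b : Module.Basis (Fin m ⊕ Fin m) ℝ V, (∀ i, b i = f i) →
      gtr (fun u v => G u v) Q = ∑ i, (Q (e i) (e i) + Q (J (e i)) (J (e i))) := by
    intro b hb
    rw [hG.gtr_eq_sum b (fun i j => by rw [hb, hb, hf]) hQ, Fintype.sum_sum_type,
      ← Finset.sum_add_distrib]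
    simp [hb, f]
  rcases isEmpty_or_nonempty (Fin m ⊕ Fin m) with hE | hE
  · have : Subsingleton V := by
      rw [← Module.finrank_zero_iff (R := ℝ), ← hcard]; exact Fintype.card_eq_zero
    exact key (Module.Basis.empty V) fun i => isEmptyElim i
  · exact key (basisOfLinearIndependentOfCardEqFinrank hli hcard) fun i => by simp

end UnitaryFrame

/-! ### The Lee form as a trace of the torsion -/

section LeeForm

variable {V : Type*} [AddCommGroup V] [Module ℝ V]

/-- The tuple `(e_1, J e_1, …, e_m, J e_m)`. -/
def pairTuple (J : Module.End ℝ V) : (m : ℕ) → (Fin m → V) → Fin (2 * m) → V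
  | 0, _ => fun i : Fin 0 => i.elim0
  | m + 1, e => (Fin.cons (e 0) (Fin.cons (J (e 0)) (pairTuple J m (Fin.tail e)) :
      Fin (2 * m + 1) → V) : Fin (2 * m + 2) → V)

theorem pairTuple_induction (J : Module.End ℝ V) {P : V → Prop} (m : ℕ) (e : Fin m → V)
    (h : ∀ i, P (e i)) (h' : ∀ i, P (J (e i))) (l : Fin (2 * m)) : P (pairTuple J m e l) := by
  induction m with
  | zero => exact Fin.elim0 l
  | succ m ih =>
    have key : ∀ l : Fin (2 * m + 2), P ((Fin.cons (e 0) (Fin.cons (J (e 0))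
        (pairTuple J m (Fin.tail e)) : Fin (2 * m + 1) → V) : Fin (2 * m + 2) → V) l) := by
      intro l
      refine Fin.cases (h 0) (fun l => ?_) l
      refine Fin.cases (h' 0) (fun l => ?_) l
      exact ih (Fin.tail e) (fun i => h _) (fun i => h' _) l
    exact key l

theorem IsUnitary.tail {G : LinearMap.BilinForm ℝ V} {J : Module.End ℝ V} {m : ℕ}
    {e : Fin (m + 1) → V} (he : IsUnitary G J e) : IsUnitary G J (Fin.tail e) :=
  ⟨fun i j => by simp [Fin.tail, he.orth], fun i j => he.orthJ _ _⟩

theorem powAlt_pairTuple {G : LinearMap.BilinForm ℝ V} {J : Module.End ℝ V}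
    (hsq : ∀ u, J (J u) = -u) (hH : ∀ u v, G (J u) (J v) = G u v)
    (hb : ∀ u v, (G ∘ₗ J) v u = -(G ∘ₗ J) u v) (m : ℕ) {e : Fin m → V} (he : IsUnitary G J e) :
    powAlt (G ∘ₗ J) m (pairTuple J m e) = (m.factorial : ℝ) := by
  induction m with
  | zero => simp [powAlt]
  | succ m ih =>
    have h : ∀ i, (G ∘ₗ J) (J (e 0)) (pairTuple J m (Fin.tail e) i) = 0 := by
      refine pairTuple_induction J (P := fun v => (G ∘ₗ J) (J (e 0)) v = 0) m _ (fun i => ?_)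
        fun i => ?_
      · simp [hsq, Fin.tail, he.orth, (Fin.succ_ne_zero i).symm]
      · simpa [hsq, Fin.tail] using he.orthJ 0 i.succ
    refine (powAlt_cons_cons hb m (e 0) (J (e 0)) _ h).trans ?_
    rw [ih he.tail]
    simp [hH, he.orth, Nat.factorial_succ]

theorem altDpow_pairTuple {G : LinearMap.BilinForm ℝ V} {J : Module.End ℝ V}
    (hsq : ∀ u, J (J u) = -u) (hH : ∀ u v, G (J u) (J v) = G u v)
    (hb : ∀ u v, (G ∘ₗ J) v u = -(G ∘ₗ J) u v) {D : V → LinearMap.BilinForm ℝ V}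
    (hD : ∀ s u v, D s v u = -D s u v) (m : ℕ) (u : V) {e : Fin m → V} (he : IsUnitary G J e)
    (hu : ∀ i, (G ∘ₗ J) u (e i) = 0) (hu' : ∀ i, (G ∘ₗ J) u (J (e i)) = 0) :
    altDpow (G ∘ₗ J) D m (Fin.cons u (pairTuple J m e)) = (m.factorial : ℝ)
      * ∑ i, (D u (e i) (J (e i)) - D (e i) u (J (e i)) + D (J (e i)) u (e i)) := by
  induction m with
  | zero => simp [altDpow, dpowAlt]
  | succ m ih =>
    have h : ∀ i, (G ∘ₗ J) (J (e 0)) (pairTuple J m (Fin.tail e) i) = 0 := by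
      refine pairTuple_induction J (P := fun v => (G ∘ₗ J) (J (e 0)) v = 0) m _ (fun i => ?_)
        fun i => ?_
      · simp [hsq, Fin.tail, he.orth, (Fin.succ_ne_zero i).symm]
      · simpa [hsq, Fin.tail] using he.orthJ 0 i.succ
    have h' : ∀ i, (G ∘ₗ J) (e 0) (pairTuple J m (Fin.tail e) i) = 0 := by
      refine pairTuple_induction J (P := fun v => (G ∘ₗ J) (e 0) v = 0) m _ (fun i => ?_)
        fun i => ?_
      · rw [hb, neg_eq_zero]
        have h4 := hH (e i.succ) (J (e 0))
        simp only [hsq, map_neg, he.orthJ, neg_eq_zero] at h4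
        exact h4
      · simp [hH, Fin.tail, he.orth, (Fin.succ_ne_zero i).symm]
    have hw : ∀ i, (G ∘ₗ J) u (pairTuple J m (Fin.tail e) i) = 0 :=
      pairTuple_induction J (P := fun v => (G ∘ₗ J) u v = 0) m _ (fun i => hu _) fun i => hu' _
    refine (altDpow_cons hb hD m u (e 0) (J (e 0)) _ (hu 0) (hu' 0) hw h' h).trans ?_
    rw [ih he.tail (fun i => hu _) (fun i => hu' _), powAlt_pairTuple hsq hH hb m he.tail,
      Fin.sum_univ_succ]
    simp only [LinearMap.comp_apply, hH, he.orth, if_true, Nat.factorial_succ, Fin.tail]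
    push_cast
    ring

theorem wedgeOne_powAlt {b : LinearMap.BilinForm ℝ V} (hb : ∀ u v, b v u = -b u v) (θ : V → ℝ)
    (m : ℕ) (u : V) (w : Fin (2 * m) → V) (h : ∀ i, b u (w i) = 0) :
    wedgeOne θ (powAlt b m) (Fin.cons u w) = θ u * powAlt b m w := by
  rw [wedgeOne, Fin.sum_univ_succ]
  have h0 : (0 : Fin (2 * m + 1)).removeNth (Fin.cons u w : Fin (2 * m + 1) → V) = w :=
    removeNth_zero_cons u w
  rw [h0]
  cases m with
  | zero => simp
  | succ m =>
    rw [Finset.sum_eq_zero fun i _ => ?_]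
    · simp
    · have h1 : i.succ.removeNth (Fin.cons u w : Fin (2 * (m + 1) + 1) → V)
          = (Fin.cons u ((i : Fin (2 * m + 2)).removeNth w : Fin (2 * m + 1) → V) :
            Fin (2 * m + 2) → V) := removeNth_succ_cons i u w
      rw [h1, powAlt_cons_eq_zero hb m u (i.removeNth w : Fin (2 * m + 1) → V) fun l => h _,
        mul_zero]

end LeeForm

section LeeIdentification

variable {B V : Type*} [AddCommGroup V] [Module ℝ V] [FiniteDimensional ℝ V]
  {C : FrameCalculus B V} {S : Set B} {A : Subalgebra ℝ (B → ℝ)}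
  {G : B → LinearMap.BilinForm ℝ V} {J : B → Module.End ℝ V}

namespace SmoothCalculus

variable (hC : SmoothCalculus C S A) (hG : IsMetricField S A G) (hJ : IsHermitianField S A G J)
include hC hG hJ

theorem leeTrace_isLinear {x : B} (hx : x ∈ S) :
    IsLinearMap ℝ (leeTrace G J (bismutTors C G J) x) := by
  have hT := hC.extD_omega_alt hG hJ hx
  refine ⟨fun a b => ?_, fun c a => ?_⟩
  · simp only [leeTrace, bismutTors, map_add, (hT.lin _ _).map_add, gtr_add]; ring
  · simp only [leeTrace, bismutTors, map_smul, (hT.lin _ _).map_smul, gtr_smul, smul_eq_mul]; ring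

/-- The identity `dω^{n-1} = θ ∧ ω^{n-1}`, evaluated on `(u, e_2, J e_2, …, e_n, J e_n)` for a
unitary frame `u, e_2, …, e_n`, gives `θ(u) = ∑ dω(u, e_i, J e_i)`. -/
theorem lee_eq_leeTrace {n : ℕ} (hn : Module.finrank ℝ V = 2 * n) {θ : B → V → ℝ} {x : B}
    (hx : x ∈ S) (hθ : IsLinearMap ℝ (θ x))
    (hL : LeeAt C (fun y a b => G y a b) (fun y a => J y a) n θ x) (u : V) :
    θ x u = leeTrace G J (bismutTors C G J) x u := by
  have hl := hC.leeTrace_isLinear hG hJ hx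
  have hi := hG.inner x hx
  have hT := hC.extD_omega_alt hG hJ hx
  have hsq := hJ.sq x hx
  have hH := hJ.herm x hx
  by_cases hu0 : u = 0
  · rw [hu0, hθ.map_zero, hl.map_zero]
  obtain ⟨m, rfl⟩ : ∃ m, n = m + 1 := by
    refine Nat.exists_eq_succ_of_ne_zero fun h => hu0 ?_
    have : Subsingleton V := Module.finrank_zero_iff (R := ℝ) |>.1 (by omega)
    exact Subsingleton.elim _ _
  -- it is enough to consider unit vectors
  wlog hu : G x u u = 1 generalizing u
  · have hp := hi.pos u hu0
    have hs : Real.sqrt (G x u u) ≠ 0 := (Real.sqrt_pos.2 hp).ne'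
    have h1 := this ((Real.sqrt (G x u u))⁻¹ • u) (smul_ne_zero (inv_ne_zero hs) hu0) (by
      simp only [map_smul, LinearMap.smul_apply, smul_eq_mul]
      rw [← mul_assoc, ← mul_inv, Real.mul_self_sqrt hp.le, inv_mul_cancel₀ hp.ne'])
    rw [hθ.map_smul, hl.map_smul] at h1
    exact smul_right_injective _ (inv_ne_zero hs) h1
  obtain ⟨e, rfl, he⟩ := hi.exists_unitary hsq hH hu m (by omega)
  have hb := hC.omegaBil_skew hG hJ hx
  have hu1 : ∀ i, (G x ∘ₗ J x) (e 0) (Fin.tail e i) = 0 := fun i => by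
    have h4 := he.orthJ (i.succ) 0
    rw [hi.symm] at h4
    exact h4
  have hu2 : ∀ i, (G x ∘ₗ J x) (e 0) (J x (Fin.tail e i)) = 0 := fun i => by
    simp [hH, Fin.tail, he.orth, (Fin.succ_ne_zero i).symm]
  have hpow : (wedgePow (omega (fun y a b => G y a b) (fun y a => J y a) x) m : (Fin (2 * m) → V) → ℝ)
      = powAlt (G x ∘ₗ J x) m := funext fun w => (powAlt_apply (G x ∘ₗ J x) m w).symm
  have h1 := hL (Fin.cons (e 0) (pairTuple (J x) m (Fin.tail e)))
  have h2 := hC.extD_wedgePow hG hJ m (Fin.cons (e 0) (pairTuple (J x) m (Fin.tail e))) hx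
  have h3 := altDpow_pairTuple hsq hH hb (fun s a b => hC.nablaOmegaBil_skew hG hJ hx s a b) m
    (e 0) he.tail hu1 hu2
  have h4 := wedgeOne_powAlt hb (θ x) m (e 0) (pairTuple (J x) m (Fin.tail e))
    (pairTuple_induction (J x) (P := fun v => (G x ∘ₗ J x) (e 0) v = 0) m _ hu1 hu2)
  have h4' := powAlt_pairTuple hsq hH hb m he.tail
  have h5 : θ x (e 0) * (m.factorial : ℝ) = (m.factorial : ℝ) * ∑ i : Fin m,
      extD C (omega (fun y a b => G y a b) fun y a => J y a) x
        ![e 0, Fin.tail e i, J x (Fin.tail e i)] := by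
    simp only [hC.extD_omega hG hJ _ _ _ hx]
    refine (congrArg _ h4'.symm).trans (h4.symm.trans (Eq.trans ?_ h3))
    refine (congrArg (fun α => wedgeOne (θ x) α _) hpow.symm).trans ?_
    exact h1.symm.trans h2
  have hf : (m.factorial : ℝ) ≠ 0 := by exact_mod_cast m.factorial_ne_zero
  have h6 : θ x (e 0) = ∑ i : Fin m, extD C (omega (fun y a b => G y a b) fun y a => J y a) x
        ![e 0, Fin.tail e i, J x (Fin.tail e i)] :=
    mul_left_cancel₀ hf (by rw [← h5]; ring)
  have hQ : IsBilin fun a b => bismutTors C G J x (J x (e 0)) a (J x b) := by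
    refine ⟨fun b => ⟨fun a a' => ?_, fun c a => ?_⟩, fun a => ⟨fun b b' => ?_, fun c b => ?_⟩⟩
    · simp only [bismutTors, map_add, (hT.lin2 _ _).map_add]
    · simp only [bismutTors, map_smul, (hT.lin2 _ _).map_smul]
    · simp only [bismutTors, map_add, (hT.lin3 _ _).map_add]
    · simp only [bismutTors, map_smul, (hT.lin3 _ _).map_smul]
  rw [h6, leeTrace, hi.gtr_eq_unitary_sum hH he hn hQ, Fin.sum_univ_succ]
  have key : ∀ a, bismutTors C G J x (J x (e 0)) a (J x a)
      + bismutTors C G J x (J x (e 0)) (J x a) (J x (J x a))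
      = -2 * extD C (omega (fun y a b => G y a b) fun y a => J y a) x ![e 0, a, J x a] := fun a => by
    simp only [bismutTors, hsq, map_neg]
    rw [(hT.lin _ _).map_neg, (hT.lin _ _).map_neg, (hT.lin2 _ _).map_neg, (hT.lin3 _ _).map_neg,
      (hT.lin3 _ _).map_neg, hT.swap23]
    ring
  have h0 : extD C (omega (fun y a b => G y a b) fun y a => J y a) x ![e 0, e 0, J x (e 0)] = 0 := by
    have := hT.swap12 (e 0) (e 0) (J x (e 0))
    linarith
  simp only [key, h0, Fin.tail]
  rw [← Finset.mul_sum]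
  ring

end SmoothCalculus
end LeeIdentification

/-! ### The Bismut-Ricci form of a pluriclosed metric -/

section Pluriclosed

variable {B V : Type*} [AddCommGroup V] [Module ℝ V] [FiniteDimensional ℝ V]

/-- The covariant derivative `(∇_u θ)(v)` of a `1`-form for the Levi-Civita connection. -/
noncomputable def nablaOne (C : FrameCalculus B V) (G : B → LinearMap.BilinForm ℝ V)
    (θ : B → V → ℝ) (x : B) (u v : V) : ℝ :=
  C.derS u (fun y => θ y v) x - θ x (lc C G x u v)

/-- A pluriclosed Hermitian metric on the set `S`, together with the `3`-form `H = d^c ω`. -/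
structure IsPluriclosed (C : FrameCalculus B V) (S : Set B) (A : Subalgebra ℝ (B → ℝ))
    (G : B → LinearMap.BilinForm ℝ V) (J : B → Module.End ℝ V) (H : B → V [⋀^Fin 3]→ₗ[ℝ] ℝ) :
    Prop where
  smooth : SmoothCalculus C S A
  metric : IsMetricField S A G
  herm : IsHermitianField S A G J
  integrable : ∀ x ∈ S, ∀ u v, nijenhuis C (fun y a => J y a) x u v = 0
  form_mem : ∀ v, (fun y => H y v) ∈ A
  form_eq : ∀ x ∈ S, ∀ v, H x v = dcOmega C (fun y a b => G y a b) (fun y a => J y a) x v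
  closed : ∀ x ∈ S, ∀ v, extD C (fun y => H y) x v = 0

/-- The vector field dual to the Lee form. -/
noncomputable def leeVec (C : FrameCalculus B V) (G : B → LinearMap.BilinForm ℝ V)
    (J : B → Module.End ℝ V) (x : B) : V :=
  sharp (fun a b => G x a b) (leeTrace G J (bismutTors C G J) x)

variable {C : FrameCalculus B V} {S : Set B} {A : Subalgebra ℝ (B → ℝ)}
  {G : B → LinearMap.BilinForm ℝ V} {J : B → Module.End ℝ V}

theorem SmoothCalculus.nablaOne_sharp (hC : SmoothCalculus C S A) (hG : IsMetricField S A G)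
    {Y : B → V} (hY : VecIn A Y) (u v : V) {x : B} (hx : x ∈ S) :
    nablaOne C G (fun y w => G y (Y y) w) x u v = G x (covD C (lc C G) u Y x) v := by
  rw [nablaOne, hC.der_metric_covD hG (hC.lc_metric hG) u hY (VecIn.const v) hx]
  simp only [covD, hC.derV_const u v hx, zero_add]
  ring

/-- The Lie derivative of the metric is the symmetrized covariant derivative. -/
theorem SmoothCalculus.covD_symm (hC : SmoothCalculus C S A) (hG : IsMetricField S A G)
    (Y : B → V) (u v : V) {x : B} (hx : x ∈ S) :
    G x (covD C (lc C G) u Y x) v + G x u (covD C (lc C G) v Y x)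
      = C.derS (Y x) (fun y => G y u v) x + G x (C.derV u Y x + C.br u (Y x)) v
        + G x u (C.derV v Y x + C.br v (Y x)) := by
  rw [hC.lc_metric hG x hx, ← hC.lc_torsionFree hG x hx u, ← hC.lc_torsionFree hG x hx v, covD, covD]
  simp only [map_add, map_sub, LinearMap.add_apply, LinearMap.sub_apply]
  ring

namespace IsPluriclosed

variable {H : B → V [⋀^Fin 3]→ₗ[ℝ] ℝ} (h : IsPluriclosed C S A G J H)
include h

theorem form_vec {x : B} (hx : x ∈ S) (u v w : V) :
    H x ![u, v, w] = -bismutTors C G J x u v w := by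
  rw [h.form_eq x hx, dcOmega, bismutTors]
  congr 2
  funext i; fin_cases i <;> rfl

theorem threeForm : IsThreeForm S A (bismutTors C G J) where
  alt x hx := by
    have ha := h.smooth.extD_omega_alt h.metric h.herm hx
    refine ⟨fun v w => ⟨fun a b => ?_, fun c a => ?_⟩, fun u v w => ha.swap12 _ _ _,
      fun u v w => ha.swap23 _ _ _⟩
    · simp only [bismutTors, map_add, (ha.lin _ _).map_add]
    · simp only [bismutTors, map_smul, (ha.lin _ _).map_smul]
  mem u v w := h.smooth.mem_congr (fun_neg_mem (h.form_mem ![u, v, w])) fun x hx => by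
    rw [h.form_vec hx, neg_neg]

theorem nabla_form (u v w z : V) {x : B} (hx : x ∈ S) :
    nabla C (fun y a b => G y a b) u (fun y => H y) x ![v, w, z]
      = -nab3 C (lc C G) (bismutTors C G J) x u v w z := by
  rw [nabla_three, nab3, h.form_vec hx, h.form_vec hx, h.form_vec hx,
    h.smooth.der_congr u (fun y hy => h.form_vec hy v w z) x hx,
    h.smooth.der_neg u (h.threeForm.mem v w z) hx]
  ring

theorem closedThree : IsClosedThree C S G (bismutTors C G J) := by
  intro x hx u v w z
  have h1 := h.closed x hx ![u, v, w, z]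
  rw [h.smooth.extD_three h.metric _ hx (H x) (fun v => rfl)] at h1
  simp only [h.nabla_form _ _ _ _ hx] at h1
  linarith

theorem parallel : IsParallelEnd C S J (torsConn C G (bismutTors C G J)) :=
  h.smooth.bismut_parallel h.metric h.herm h.integrable h.threeForm

theorem leeTrace_isLinear {x : B} (hx : x ∈ S) :
    IsLinearMap ℝ (leeTrace G J (bismutTors C G J) x) :=
  h.smooth.leeTrace_isLinear h.metric h.herm hx

theorem leeTrace_mem (v : V) : (fun y => leeTrace G J (bismutTors C G J) y v) ∈ A := by
  have hT := h.threeForm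
  have h1 : ∀ a b, (fun y => bismutTors C G J y (J y v) a (J y b)) ∈ A := fun a b =>
    h.smooth.apply_mem (F := fun y w => bismutTors C G J y w a (J y b))
      (fun y hy => (hT.alt y hy).lin _ _)
      (fun w => h.smooth.apply_mem (F := fun y z => bismutTors C G J y w a z)
        (fun y hy => (hT.alt y hy).lin3 _ _) (fun z => hT.mem w a z) (h.herm.mem b)) (h.herm.mem v)
  exact fun_mul_mem (const_mem _) (h.smooth.gtr_mem h.metric h1)

theorem leeVec_apply {x : B} (hx : x ∈ S) (v : V) :
    G x (leeVec C G J x) v = leeTrace G J (bismutTors C G J) x v :=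
  (h.metric.inner x hx).sharp_apply (h.leeTrace_isLinear hx) v

theorem vecIn_leeVec : VecIn A (leeVec C G J) :=
  h.smooth.vecIn_sharp h.metric h.leeTrace_mem

theorem nablaOne_lee (u v : V) {x : B} (hx : x ∈ S) :
    nablaOne C G (leeTrace G J (bismutTors C G J)) x u v
      = G x (covD C (lc C G) u (leeVec C G J) x) v := by
  rw [← h.smooth.nablaOne_sharp h.metric h.vecIn_leeVec u v hx, nablaOne, nablaOne,
    h.leeVec_apply hx, h.smooth.der_congr u (fun y hy => (h.leeVec_apply hy v).symm) x hx]

theorem codiff_skew (u v : V) {x : B} (hx : x ∈ S) :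
    codiff C (fun y a b => G y a b) (fun y => H y) x ![v, u]
      = -codiff C (fun y a b => G y a b) (fun y => H y) x ![u, v] := by
  simp only [codiff, ← Finset.sum_neg_distrib]
  refine Finset.sum_congr rfl fun i _ => Finset.sum_congr rfl fun j _ => ?_
  have hc : ∀ b u v : V, (Fin.cons b ![u, v] : Fin 3 → V) = ![b, u, v] := fun _ _ _ => rfl
  rw [hc, hc, h.nabla_form _ _ _ _ hx, h.nabla_form _ _ _ _ hx,
    h.smooth.nab3_swap23 h.metric h.threeForm _ _ _ _ _ hx]
  ring

theorem hSq_symm (u v : V) {x : B} (hx : x ∈ S) :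
    hSq (fun y a b => G y a b) (fun y => H y) x u v
      = hSq (fun y a b => G y a b) (fun y => H y) x v u := by
  have hi := h.metric.inner x hx
  rw [h.smooth.hSq_eq_gtr h.metric h.threeForm (fun y => H y) hx (h.form_vec hx),
    h.smooth.hSq_eq_gtr h.metric h.threeForm (fun y => H y) hx (h.form_vec hx), ← hi.gtr_swap]
  congr 1; funext a b; exact hi.symm _ _

theorem ricB_symm (u v : V) {x : B} (hx : x ∈ S) :
    ricB C (fun y a b => G y a b) (fun y => H y) x u v
      = ricB C (fun y a b => G y a b) (fun y => H y) x v u := by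
  rw [ricB, ricB, h.hSq_symm u v hx, h.smooth.ricci_symm h.metric u v hx]

/-- The Bismut-Ricci form of a pluriclosed metric:
`ρ(X, JZ) = Ric^B(X, Z) + d^*H(X, Z) / 2 + (∇_X θ)(Z) + H(X, Z, θ^♯) / 2`. -/
theorem rho_J (X Z : V) {x : B} (hx : x ∈ S) :
    rhoB C (fun y a b => G y a b) (fun y a => J y a) x X (J x Z)
      = ricB C (fun y a b => G y a b) (fun y => H y) x X Z
        + (1 / 2) * codiff C (fun y a b => G y a b) (fun y => H y) x ![X, Z]
        + nablaOne C G (leeTrace G J (bismutTors C G J)) x X Z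
        + (1 / 2) * H x ![X, Z, leeVec C G J x] := by
  have h1 := h.smooth.rho_torsConn h.metric h.threeForm h.herm h.closedThree h.parallel
    (fun y => H y) (fun y hy => h.form_vec hy) X Z hx
  have hl := h.leeTrace_isLinear hx
  have h2 : leeTrace G J (bismutTors C G J) x (tors G (bismutTors C G J) x X Z)
      = -H x ![X, Z, leeVec C G J x] := by
    rw [h.form_vec hx, neg_neg, ← tors_apply h.metric h.threeForm hx, ← h.leeVec_apply hx,
      (h.metric.inner x hx).symm]
  rw [torsConn, hl.map_add, hl.map_smul, h2] at h1
  refine Eq.trans h1 ?_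
  rw [nablaOne, smul_eq_mul]
  ring

theorem rho_skew (X Z : V) {x : B} (hx : x ∈ S) :
    rhoB C (fun y a b => G y a b) (fun y a => J y a) x Z X
      = -rhoB C (fun y a b => G y a b) (fun y a => J y a) x X Z := by
  have e : ∀ w, curvature C (bismut C (fun y a b => G y a b) (fun y a => J y a)) x Z X w
      = -curvature C (bismut C (fun y a b => G y a b) (fun y a => J y a)) x X Z w := fun w =>
    h.smooth.curvature_swap (h.smooth.torsConn_isConnection h.metric h.threeForm) X Z w hx
  simp only [rhoB, e, map_neg]
  simp only [tr, map_neg, Finset.sum_neg_distrib]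
  ring

/-- The `(1,1)`-part of the Bismut-Ricci form corresponds to the symmetric part of `ρ(·, J·)`. -/
theorem rho11_J (X Z : V) {x : B} (hx : x ∈ S) :
    rhoB11 C (fun y a b => G y a b) (fun y a => J y a) x X (J x Z)
      = ricB C (fun y a b => G y a b) (fun y => H y) x X Z
        + (1 / 2) * (nablaOne C G (leeTrace G J (bismutTors C G J)) x X Z
          + nablaOne C G (leeTrace G J (bismutTors C G J)) x Z X) := by
  have hH : H x ![Z, X, leeVec C G J x] = -H x ![X, Z, leeVec C G J x] := by
    rw [h.form_vec hx, h.form_vec hx, (h.threeForm.alt x hx).swap12]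
  have h1 := h.rho_J X Z hx
  have h2 := h.rho_J Z X hx
  rw [h.codiff_skew X Z hx, h.ricB_symm Z X hx, hH] at h2
  have hlin : ∀ u v : V, rhoB C (fun y a b => G y a b) (fun y a => J y a) x u (-v)
      = -rhoB C (fun y a b => G y a b) (fun y a => J y a) x u v := by
    intro u v
    have e : ∀ w, curvature C (bismut C (fun y a b => G y a b) (fun y a => J y a)) x u (-v) w
        = -curvature C (bismut C (fun y a b => G y a b) (fun y a => J y a)) x u v w := fun w => by
      have hL := h.smooth.torsConn_isConnection h.metric h.threeForm
      have e1 := h.smooth.curvature_swap hL (-v) u w hx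
      have e2 := h.smooth.curvature_swap hL v u w hx
      rw [(h.smooth.curvature_linear_left hL u w hx).map_neg] at e1
      exact e1.trans (by rw [neg_neg]; exact (neg_eq_iff_eq_neg.2 e2).symm)
    simp only [rhoB, e, map_neg]
    simp only [tr, map_neg, Finset.sum_neg_distrib]
    ring
  rw [rhoB11, h.herm.sq x hx, hlin, h.rho_skew Z (J x X) hx, h1, h2]
  ring

theorem rho_anti (X Z : V) {x : B} (hx : x ∈ S) :
    rhoB C (fun y a b => G y a b) (fun y a => J y a) x X (J x Z)
        - rhoB C (fun y a b => G y a b) (fun y a => J y a) x Z (J x X)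
      = codiff C (fun y a b => G y a b) (fun y => H y) x ![X, Z]
        + (nablaOne C G (leeTrace G J (bismutTors C G J)) x X Z
          - nablaOne C G (leeTrace G J (bismutTors C G J)) x Z X)
        + H x ![X, Z, leeVec C G J x] := by
  have hH : H x ![Z, X, leeVec C G J x] = -H x ![X, Z, leeVec C G J x] := by
    rw [h.form_vec hx, h.form_vec hx, (h.threeForm.alt x hx).swap12]
  have h2 := h.rho_J Z X hx
  rw [h.codiff_skew X Z hx, h.ricB_symm Z X hx, hH] at h2
  rw [h.rho_J X Z hx, h2]
  ring

end IsPluriclosed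

end Pluriclosed

/-! ### Exterior and Lie derivatives in a commuting frame -/

section CommutingFrame

variable {B V : Type*} [AddCommGroup V] [Module ℝ V] [FiniteDimensional ℝ V]

/-- A field of `2`-forms on `S`, with components in `A`. -/
structure IsTwoForm (S : Set B) (A : Subalgebra ℝ (B → ℝ)) (Q : B → V → V → ℝ) : Prop where
  lin : ∀ x ∈ S, ∀ v, IsLinearMap ℝ fun u => Q x u v
  skew : ∀ x ∈ S, ∀ u v, Q x v u = -Q x u v
  mem : ∀ u v, (fun y => Q y u v) ∈ A

/-- The exterior derivative of a `2`-form in a frame of commuting vector fields. -/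
def dTwo (C : FrameCalculus B V) (Q : B → V → V → ℝ) (x : B) (u v w : V) : ℝ :=
  C.derS u (fun y => Q y v w) x + C.derS v (fun y => Q y w u) x + C.derS w (fun y => Q y u v) x

/-- The Lie derivative of a `2`-tensor in a frame of commuting vector fields. -/
def lieTwo (C : FrameCalculus B V) (Y : B → V) (Q : B → V → V → ℝ) (x : B) (u v : V) : ℝ :=
  C.derS (Y x) (fun y => Q y u v) x + Q x (C.derV u Y x) v + Q x u (C.derV v Y x)

/-- The Lie derivative of a `3`-tensor in a frame of commuting vector fields. -/
def lieThree (C : FrameCalculus B V) (Y : B → V) (T : B → V → V → V → ℝ) (x : B) (u v w : V) : ℝ :=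
  C.derS (Y x) (fun y => T y u v w) x + T x (C.derV u Y x) v w + T x u (C.derV v Y x) w
    + T x u v (C.derV w Y x)

variable {C : FrameCalculus B V} {S : Set B} {A : Subalgebra ℝ (B → ℝ)}

theorem IsTwoForm.lin2 {Q : B → V → V → ℝ} (hQ : IsTwoForm S A Q) {x : B} (hx : x ∈ S) (u : V) :
    IsLinearMap ℝ fun v => Q x u v :=
  ⟨fun a b => by
    rw [hQ.skew x hx, (hQ.lin x hx u).map_add, hQ.skew x hx u a, hQ.skew x hx u b, neg_add, neg_neg,
      neg_neg],
  fun c a => by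
    rw [hQ.skew x hx, (hQ.lin x hx u).map_smul, hQ.skew x hx u a, smul_neg, neg_neg]⟩

theorem IsTwoForm.add {Q Q' : B → V → V → ℝ} (hQ : IsTwoForm S A Q) (hQ' : IsTwoForm S A Q') :
    IsTwoForm S A fun y u v => Q y u v + Q' y u v where
  lin x hx v := ((hQ.lin x hx v).mk' _ + (hQ'.lin x hx v).mk' _).isLinear
  skew x hx u v := by rw [hQ.skew x hx, hQ'.skew x hx]; ring
  mem u v := fun_add_mem (hQ.mem u v) (hQ'.mem u v)

theorem IsTwoForm.smul {Q : B → V → V → ℝ} (hQ : IsTwoForm S A Q) (c : ℝ) :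
    IsTwoForm S A fun y u v => c * Q y u v where
  lin x hx v := (c • (hQ.lin x hx v).mk' _).isLinear
  skew x hx u v := by rw [hQ.skew x hx]; ring
  mem u v := fun_mul_mem (const_mem c) (hQ.mem u v)

namespace SmoothCalculus

variable (hC : SmoothCalculus C S A)
include hC

theorem threeForm_congr {T T' : B → V → V → V → ℝ} (hT : IsThreeForm S A T)
    (h : ∀ x ∈ S, ∀ u v w, T x u v w = T' x u v w) : IsThreeForm S A T' where
  alt x hx := by
    have : T' x = T x := by funext u v w; rw [h x hx]
    rw [this]; exact hT.alt x hx
  mem u v w := hC.mem_congr (hT.mem u v w) fun x hx => h x hx u v w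

theorem dTwo_add {Q Q' : B → V → V → ℝ} (hQ : IsTwoForm S A Q) (hQ' : IsTwoForm S A Q') {x : B}
    (hx : x ∈ S) (u v w : V) : dTwo C (fun y a b => Q y a b + Q' y a b) x u v w
      = dTwo C Q x u v w + dTwo C Q' x u v w := by
  simp only [dTwo]
  rw [hC.der_add u (hQ.mem v w) (hQ'.mem v w) x hx, hC.der_add v (hQ.mem w u) (hQ'.mem w u) x hx,
    hC.der_add w (hQ.mem u v) (hQ'.mem u v) x hx]
  ring

theorem dTwo_smul {Q : B → V → V → ℝ} (hQ : IsTwoForm S A Q) (c : ℝ) {x : B} (hx : x ∈ S)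
    (u v w : V) : dTwo C (fun y a b => c * Q y a b) x u v w = c * dTwo C Q x u v w := by
  simp only [dTwo]
  rw [hC.der_const_mul u c (hQ.mem v w) hx, hC.der_const_mul v c (hQ.mem w u) hx,
    hC.der_const_mul w c (hQ.mem u v) hx]
  ring

theorem dTwo_threeForm {Q : B → V → V → ℝ} (hQ : IsTwoForm S A Q) : IsThreeForm S A (dTwo C Q) where
  alt x hx := by
    refine ⟨fun v w => ⟨fun a b => ?_, fun c a => ?_⟩, fun u v w => ?_, fun u v w => ?_⟩
    · simp only [dTwo]
      rw [(hC.der_isLinear (hQ.mem v w) hx).map_add,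
        hC.der_congr v (fun y hy => (hQ.lin2 hy w).map_add a b) x hx,
        hC.der_congr w (fun y hy => (hQ.lin y hy v).map_add a b) x hx,
        hC.der_add v (hQ.mem _ _) (hQ.mem _ _) x hx, hC.der_add w (hQ.mem _ _) (hQ.mem _ _) x hx]
      ring
    · simp only [dTwo]
      rw [(hC.der_isLinear (hQ.mem v w) hx).map_smul,
        hC.der_congr v (fun y hy => (hQ.lin2 hy w).map_smul c a) x hx,
        hC.der_congr w (fun y hy => (hQ.lin y hy v).map_smul c a) x hx]
      simp only [smul_eq_mul]
      rw [hC.der_const_mul v c (hQ.mem _ _) hx, hC.der_const_mul w c (hQ.mem _ _) hx]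
      ring
    all_goals
      have hs : ∀ a b c, C.derS a (fun y => Q y b c) x = -C.derS a (fun y => Q y c b) x :=
        fun a b c => by
          rw [hC.der_congr a (fun y hy => hQ.skew y hy c b) x hx, hC.der_neg a (hQ.mem c b) hx]
      simp only [dTwo]
      linarith [hs u v w, hs v w u, hs w u v]
  mem u v w := fun_add_mem (fun_add_mem (hC.der_mem u (hQ.mem _ _)) (hC.der_mem v (hQ.mem _ _)))
    (hC.der_mem w (hQ.mem _ _))

theorem der_field_mem {f : B → ℝ} (hf : f ∈ A) {Y : B → V} (hY : VecIn A Y) :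
    (fun y => C.derS (Y y) f y) ∈ A :=
  hC.apply_mem (F := fun y v => C.derS v f y) (fun _ hy => hC.der_isLinear hf hy)
    (fun v => hC.der_mem v hf) hY

theorem der_der_field (w : V) {f : B → ℝ} (hf : f ∈ A) {Y : B → V} (hY : VecIn A Y) {x : B}
    (hx : x ∈ S) : C.derS w (fun y => C.derS (Y y) f y) x
      = C.derS w (C.derS (Y x) f) x + C.derS (C.derV w Y x) f x :=
  hC.der_apply w (F := fun y v => C.derS v f y) (fun _ hy => hC.der_isLinear hf hy)
    (fun v => hC.der_mem v hf) hY hx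

theorem lieTwo_twoForm {Q : B → V → V → ℝ} (hQ : IsTwoForm S A Q) {Y : B → V} (hY : VecIn A Y) :
    IsTwoForm S A (lieTwo C Y Q) where
  lin x hx v := by
    refine ⟨fun a b => ?_, fun c a => ?_⟩
    · simp only [lieTwo]
      rw [hC.der_congr _ (fun y hy => (hQ.lin y hy v).map_add a b) x hx,
        hC.der_add _ (hQ.mem _ _) (hQ.mem _ _) x hx, (hC.derV_isLinear hY hx).map_add,
        (hQ.lin x hx v).map_add, (hQ.lin x hx _).map_add]
      ring
    · simp only [lieTwo]
      rw [hC.der_congr _ (fun y hy => (hQ.lin y hy v).map_smul c a) x hx,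
        (hC.derV_isLinear hY hx).map_smul, (hQ.lin x hx v).map_smul, (hQ.lin x hx _).map_smul]
      simp only [smul_eq_mul]
      rw [hC.der_const_mul _ c (hQ.mem _ _) hx]
      ring
  skew x hx u v := by
    simp only [lieTwo]
    rw [hC.der_congr _ (fun y hy => hQ.skew y hy u v) x hx, hC.der_neg _ (hQ.mem u v) hx,
      hQ.skew x hx u, hQ.skew x hx _ v]
    ring
  mem u v := fun_add_mem (fun_add_mem (hC.der_field_mem (hQ.mem u v) hY)
    (hC.apply_mem (fun y hy => hQ.lin y hy v) (fun u => hQ.mem u v) (hC.vecIn_derV u hY)))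
    (hC.apply_mem (F := fun y v => Q y u v) (fun y hy => hQ.lin2 hy u) (fun v => hQ.mem u v)
      (hC.vecIn_derV v hY))

theorem interior_twoForm {T : B → V → V → V → ℝ} (hT : IsThreeForm S A T) {Y : B → V}
    (hY : VecIn A Y) : IsTwoForm S A fun y u v => T y u v (Y y) where
  lin x hx v := (hT.alt x hx).lin v _
  skew x hx u v := (hT.alt x hx).swap12 u v _
  mem u v := hC.apply_mem (F := fun y w => T y u v w) (fun y hy => (hT.alt y hy).lin3 u v)
    (fun w => hT.mem u v w) hY

/-- Cartan's formula for a closed `3`-form. -/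
theorem dTwo_interior {T : B → V → V → V → ℝ} (hT : IsThreeForm S A T) {Y : B → V} (hY : VecIn A Y)
    {x : B} (hx : x ∈ S) (hd : ∀ u v w z, C.derS u (fun y => T y v w z) x
      - C.derS v (fun y => T y u w z) x + C.derS w (fun y => T y u v z) x
      - C.derS z (fun y => T y u v w) x = 0) (u v w : V) :
    dTwo C (fun y a b => T y a b (Y y)) x u v w = lieThree C Y T x u v w := by
  have key : ∀ u v w, C.derS u (fun y => T y v w (Y y)) x
      = C.derS u (fun y => T y v w (Y x)) x + T x v w (C.derV u Y x) := fun u v w =>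
    hC.der_apply u (F := fun y z => T y v w z) (fun y hy => (hT.alt y hy).lin3 v w)
      (fun z => hT.mem v w z) hY hx
  rw [dTwo, lieThree, key, key, key]
  have hs : C.derS v (fun y => T y w u (Y x)) x = -C.derS v (fun y => T y u w (Y x)) x := by
    rw [hC.der_congr v (fun y hy => (hT.alt y hy).swap12 u w _) x hx, hC.der_neg v (hT.mem _ _ _) hx]
  have h1 := hd u v w (Y x)
  have ha := hT.alt x hx
  rw [hs]
  linarith [ha.rot (C.derV u Y x) v w, ha.rot (C.derV v Y x) w u, ha.rot u (C.derV v Y x) w]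

variable (hbr : ∀ u v, C.br u v = 0)
include hbr

theorem der_comm_of_br_eq_zero (u v : V) {f : B → ℝ} (hf : f ∈ A) {x : B} (hx : x ∈ S) :
    C.derS u (C.derS v f) x = C.derS v (C.derS u f) x := by
  have := hC.der_comm u v hf x hx
  rw [hbr, hC.der_zero_left hf hx] at this
  linarith

theorem derV_comm_of_br_eq_zero (u v : V) {Y : B → V} (hY : VecIn A Y) {x : B} (hx : x ∈ S) :
    C.derV u (C.derV v Y) x = C.derV v (C.derV u Y) x := by
  have := hC.derV_comm u v hY hx
  rwa [hbr, (hC.derV_isLinear hY hx).map_zero, sub_eq_zero] at this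

/-- The Lie derivative commutes with the exterior derivative. -/
theorem dTwo_lieTwo {Q : B → V → V → ℝ} (hQ : IsTwoForm S A Q) {Y : B → V} (hY : VecIn A Y) {x : B}
    (hx : x ∈ S) (u v w : V) :
    dTwo C (lieTwo C Y Q) x u v w = lieThree C Y (dTwo C Q) x u v w := by
  have key : ∀ u v w, C.derS u (fun y => lieTwo C Y Q y v w) x
      = C.derS (Y x) (C.derS u fun y => Q y v w) x + C.derS (C.derV u Y x) (fun y => Q y v w) x
        + (C.derS u (fun y => Q y (C.derV v Y x) w) x + Q x (C.derV u (C.derV v Y) x) w)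
        + (C.derS u (fun y => Q y v (C.derV w Y x)) x + Q x v (C.derV u (C.derV w Y) x)) := by
    intro u v w
    have m1 := hC.der_field_mem (hQ.mem v w) hY
    have m2 := hC.apply_mem (fun y hy => hQ.lin y hy w) (fun u => hQ.mem u w) (hC.vecIn_derV v hY)
    have m3 := hC.apply_mem (F := fun y z => Q y v z) (fun y hy => hQ.lin2 hy v)
      (fun z => hQ.mem v z) (hC.vecIn_derV w hY)
    have e1 := hC.der_add u (fun_add_mem m1 m2) m3 x hx
    have e2 := hC.der_add u m1 m2 x hx
    have e3 := hC.der_apply u (fun y hy => hQ.lin y hy w) (fun u => hQ.mem u w)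
      (hC.vecIn_derV v hY) hx
    have e4 := hC.der_apply u (F := fun y z => Q y v z) (fun y hy => hQ.lin2 hy v)
      (fun z => hQ.mem v z) (hC.vecIn_derV w hY) hx
    have e5 := hC.der_der_field u (hQ.mem v w) hY hx
    rw [hC.der_comm_of_br_eq_zero hbr u _ (hQ.mem v w) hx] at e5
    refine e1.trans ?_
    rw [e2, e3, e4, e5]
  have h1 : C.derS (Y x) (fun y => dTwo C Q y u v w) x = C.derS (Y x) (C.derS u fun y => Q y v w) x
      + C.derS (Y x) (C.derS v fun y => Q y w u) x + C.derS (Y x) (C.derS w fun y => Q y u v) x := by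
    have := hC.der_add (Y x) (fun_add_mem (hC.der_mem u (hQ.mem v w)) (hC.der_mem v (hQ.mem w u)))
      (hC.der_mem w (hQ.mem u v)) x hx
    rw [hC.der_add (Y x) (hC.der_mem u (hQ.mem v w)) (hC.der_mem v (hQ.mem w u)) x hx] at this
    exact this
  rw [lieThree, h1]
  simp only [dTwo]
  rw [key, key, key]
  have c := fun a b => hC.derV_comm_of_br_eq_zero hbr a b hY hx
  linarith [congrArg (fun t => Q x t w) (c u v), congrArg (fun t => Q x t u) (c v w),
    congrArg (fun t => Q x t v) (c w u), hQ.skew x hx (C.derV v (C.derV u Y) x) w,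
    hQ.skew x hx (C.derV w (C.derV v Y) x) u, hQ.skew x hx (C.derV u (C.derV w Y) x) v]

theorem dTwo_dOne {θ : B → V → ℝ} (hθ : ∀ v, (fun y => θ y v) ∈ A) {x : B} (hx : x ∈ S) (u v w : V) :
    dTwo C (fun y a b => C.derS a (fun z => θ z b) y - C.derS b (fun z => θ z a) y) x u v w = 0 := by
  have key : ∀ u v w, C.derS u (fun y => C.derS v (fun z => θ z w) y - C.derS w (fun z => θ z v) y) x
      = C.derS u (C.derS v fun z => θ z w) x - C.derS u (C.derS w fun z => θ z v) x := fun u v w =>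
    hC.der_sub u (hC.der_mem v (hθ w)) (hC.der_mem w (hθ v)) hx
  rw [dTwo, key, key, key, hC.der_comm_of_br_eq_zero hbr u v (hθ w) hx,
    hC.der_comm_of_br_eq_zero hbr v w (hθ u) hx, hC.der_comm_of_br_eq_zero hbr w u (hθ v) hx]
  ring

end SmoothCalculus

end CommutingFrame

/-! ### Types of exterior derivatives on a complex manifold -/

section ComplexTypes

variable {B V : Type*} [AddCommGroup V] [Module ℝ V] [FiniteDimensional ℝ V]

/-- The covariant derivative `(∇_u Q)(v, w)` of a `2`-tensor. -/
def nab2 (C : FrameCalculus B V) (L : B → V → V → V) (Q : B → V → V → ℝ) (x : B) (u v w : V) : ℝ :=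
  C.derS u (fun y => Q y v w) x - Q x (L x u v) w - Q x v (L x u w)

variable {C : FrameCalculus B V} {S : Set B} {A : Subalgebra ℝ (B → ℝ)}
  {J : B → Module.End ℝ V}

namespace SmoothCalculus

variable (hC : SmoothCalculus C S A)
include hC

theorem dTwo_eq_nab2 {Q : B → V → V → ℝ} (hQ : IsTwoForm S A Q) {L K : B → V → V → V} {x : B}
    (hx : x ∈ S) (hK : ∀ u v, L x u v - L x v u = K x u v) (u v w : V) :
    dTwo C Q x u v w = nab2 C L Q x u v w + nab2 C L Q x v w u + nab2 C L Q x w u v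
      + Q x (K x u v) w + Q x (K x v w) u + Q x (K x w u) v := by
  simp only [dTwo, nab2, ← hK, (hQ.lin x hx _).map_sub]
  linarith [hQ.skew x hx v (L x u w), hQ.skew x hx w (L x v u), hQ.skew x hx u (L x w v)]

theorem nab2_skew {Q : B → V → V → ℝ} (hQ : IsTwoForm S A Q) (L : B → V → V → V) {x : B}
    (hx : x ∈ S) (u v w : V) : nab2 C L Q x u w v = -nab2 C L Q x u v w := by
  rw [nab2, nab2, hC.der_congr u (fun y hy => hQ.skew y hy v w) x hx, hC.der_neg u (hQ.mem v w) hx,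
    hQ.skew x hx v, hQ.skew x hx _ w]
  ring

theorem nab2_neg_right {L : B → V → V → V} (hL : IsConnection S A L) {Q : B → V → V → ℝ}
    (hQ : IsTwoForm S A Q) {x : B}
    (hx : x ∈ S) (u v w : V) : nab2 C L Q x u v (-w) = -nab2 C L Q x u v w := by
  rw [nab2, nab2, hC.der_congr u (fun y hy => (hQ.lin2 hy v).map_neg w) x hx,
    hC.der_neg u (hQ.mem v w) hx, (hQ.lin2 hx _).map_neg,
    ((hL.bilin x hx).right u).map_neg, (hQ.lin2 hx v).map_neg]
  ring

variable {L : B → V → V → V} (hJm : ∀ v, VecIn A fun y => J y v) (hp : IsParallelEnd C S J L)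
include hJm hp

theorem nab2_J {Q : B → V → V → ℝ} (hQ : IsTwoForm S A Q) {x : B} (hx : x ∈ S) (u v w : V) :
    nab2 C L (fun y a b => Q y a (J y b)) x u v w = nab2 C L Q x u v (J x w) := by
  have h := hC.der_apply u (F := fun y z => Q y v z) (fun y hy => hQ.lin2 hy v)
    (fun z => hQ.mem v z) (hJm w) hx
  rw [nab2, nab2, h, ← hp x hx, (hQ.lin2 hx v).map_add]
  ring

theorem nab2_J_invariant {Q : B → V → V → ℝ} (hQ : IsTwoForm S A Q)
    (h : ∀ y ∈ S, ∀ u v, Q y (J y u) v = -Q y u (J y v)) {x : B} (hx : x ∈ S) (u v w : V) :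
    nab2 C L Q x u (J x v) w = -nab2 C L Q x u v (J x w) := by
  have hs : ∀ y ∈ S, ∀ a b, Q y a (J y b) = Q y b (J y a) := fun y hy a b => by
    rw [hQ.skew y hy, h y hy, neg_neg]
  rw [← hC.nab2_J hJm hp hQ hx, hC.nab2_skew hQ L hx, ← hC.nab2_J hJm hp hQ hx, nab2, nab2,
    hC.der_congr u (fun y hy => hs y hy w v) x hx, hs x hx, hs x hx w]
  ring

theorem nab2_J_antiinvariant {Q : B → V → V → ℝ} (hQ : IsTwoForm S A Q)
    (h : ∀ y ∈ S, ∀ u v, Q y (J y u) v = Q y u (J y v)) {x : B} (hx : x ∈ S) (u v w : V) :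
    nab2 C L Q x u (J x v) w = nab2 C L Q x u v (J x w) := by
  have hs : ∀ y ∈ S, ∀ a b, Q y a (J y b) = -Q y b (J y a) := fun y hy a b => by
    rw [hQ.skew y hy, h y hy]
  have hm : ∀ a b, (fun y => Q y a (J y b)) ∈ A := fun a b =>
    hC.apply_mem (F := fun y z => Q y a z) (fun y hy => hQ.lin2 hy a) (fun z => hQ.mem a z) (hJm b)
  rw [← hC.nab2_J hJm hp hQ hx, hC.nab2_skew hQ L hx, ← hC.nab2_J hJm hp hQ hx, nab2, nab2,
    hC.der_congr u (fun y hy => hs y hy w v) x hx, hs x hx (L x u w), hs x hx w,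
    hC.der_neg u (hm v w) hx]
  ring

omit hp in
theorem twoForm_J {Q : B → V → V → ℝ} (hQ : IsTwoForm S A Q)
    (h : ∀ y ∈ S, ∀ u v, Q y (J y u) v = Q y u (J y v)) :
    IsTwoForm S A fun y a b => Q y a (J y b) where
  lin y hy b := hQ.lin y hy _
  skew y hy u v := by rw [hQ.skew y hy, h y hy]
  mem a b := hC.apply_mem (F := fun y z => Q y a z) (fun y hy => hQ.lin2 hy a)
    (fun z => hQ.mem a z) (hJm b)

variable (hL : IsConnection S A L) {K : B → V → V → V} {x : B} (hx : x ∈ S)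
  (hK : ∀ u v, L x u v - L x v u = K x u v)
  (hsq : ∀ u, J x (J x u) = -u)
  (hKJ : ∀ u v, K x (J x u) (J x v) = K x u v + J x (K x (J x u) v) + J x (K x u (J x v)))
include hL hx hK hsq hKJ

/-- The exterior derivative of a `(1,1)`-form has no `(3,0)`-part: both sides are multiplication
by `i` on the `(2,1)`-part and by `-i` on the `(1,2)`-part. -/
theorem dTwo_J_invariant {Q : B → V → V → ℝ} (hQ : IsTwoForm S A Q)
    (h : ∀ y ∈ S, ∀ u v, Q y (J y u) v = -Q y u (J y v)) (u v w : V) :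
    dTwo C Q x (J x u) (J x v) (J x w)
      = dTwo C Q x (J x u) v w + dTwo C Q x u (J x v) w + dTwo C Q x u v (J x w) := by
  have hJJ : ∀ a b, Q x (J x a) (J x b) = Q x a b := fun a b => by
    rw [h x hx, hsq, (hQ.lin2 hx a).map_neg, neg_neg]
  have hN : ∀ a b c, nab2 C L Q x a (J x b) (J x c) = nab2 C L Q x a b c := fun a b c => by
    rw [hC.nab2_J_invariant hJm hp hQ h hx, hsq, hC.nab2_neg_right hL hQ hx, neg_neg]
  have hn := hC.nab2_J_invariant hJm hp hQ h hx
  simp only [hC.dTwo_eq_nab2 hQ hx hK, hKJ, (hQ.lin x hx _).map_add, hJJ, hN]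
  linarith [hn u v w, hn v w u, hn w u v]

/-- A real form `Q` of type `(2,0) + (0,2)` is the real part of the `(2,0)`-form `φ = Q - i Q(·, J·)`,
and `Q(·, J·)` is the real part of `i φ`. As `dφ` is of type `(3,0) + (2,1)`, the right-hand side is the
real part of `(-i + 3i) (dφ)^{3,0} + (i + i) (dφ)^{2,1} = 2i dφ`. -/
theorem dTwo_J_antiinvariant {Q : B → V → V → ℝ} (hQ : IsTwoForm S A Q)
    (h : ∀ y ∈ S, ∀ u v, Q y (J y u) v = Q y u (J y v)) (u v w : V) :
    2 * dTwo C (fun y a b => Q y a (J y b)) x u v w = dTwo C Q x (J x u) (J x v) (J x w)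
      + dTwo C Q x (J x u) v w + dTwo C Q x u (J x v) w + dTwo C Q x u v (J x w) := by
  have hJJ : ∀ a b, Q x (J x a) (J x b) = -Q x a b := fun a b => by
    rw [h x hx, hsq, (hQ.lin2 hx a).map_neg]
  have hN : ∀ a b c, nab2 C L Q x a (J x b) (J x c) = -nab2 C L Q x a b c := fun a b c => by
    rw [hC.nab2_J_antiinvariant hJm hp hQ h hx, hsq, hC.nab2_neg_right hL hQ hx]
  have hn := hC.nab2_J_antiinvariant hJm hp hQ h hx
  have hQ' := hC.twoForm_J hJm hQ h
  rw [hC.dTwo_eq_nab2 hQ' hx hK]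
  simp only [hC.dTwo_eq_nab2 hQ hx hK, hKJ, (hQ.lin x hx _).map_add, hJJ, hN,
    hC.nab2_J hJm hp hQ hx]
  linarith [hn u v w, hn v w u, hn w u v]

end SmoothCalculus

end ComplexTypes

/-! ### Closedness of the Bismut-Ricci form, and holomorphic vector fields -/

section RicciFormClosed

variable {B V : Type*} [AddCommGroup V] [Module ℝ V] [FiniteDimensional ℝ V]
  {C : FrameCalculus B V} {S : Set B} {A : Subalgebra ℝ (B → ℝ)} {J : B → Module.End ℝ V}

namespace SmoothCalculus

variable (hC : SmoothCalculus C S A)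
include hC

theorem vecIn_curvature {L : B → V → V → V} (hL : IsConnection S A L) (u v w : V) :
    VecIn A fun y => curvature C L y u v w :=
  ((hC.vecIn_covD hL u (hL.mem v w)).sub (hC.vecIn_covD hL v (hL.mem u w))).sub (hL.mem _ w)

theorem tr_J_curvature_mem {L : B → V → V → V} (hL : IsConnection S A L)
    (hJm : ∀ v, VecIn A fun y => J y v) (u v : V) :
    (fun y => tr fun w => J y (curvature C L y u v w)) ∈ A :=
  fun_sum_mem _ fun _ _ => hC.vecIn_end_apply hJm (hC.vecIn_curvature hL u v _) _

theorem tr_J_curvature_twoForm {L : B → V → V → V} (hL : IsConnection S A L)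
    (hJm : ∀ v, VecIn A fun y => J y v) :
    IsTwoForm S A fun y u v => tr fun w => J y (curvature C L y u v w) where
  lin x hx v := by
    refine ⟨fun a b => ?_, fun c a => ?_⟩
    · simp only [(hC.curvature_linear_left hL v _ hx).map_add, map_add, tr, Finset.sum_add_distrib]
    · simp only [(hC.curvature_linear_left hL v _ hx).map_smul, map_smul, tr, smul_eq_mul,
        Finset.mul_sum]
  skew x hx u v := by
    simp only [hC.curvature_swap hL u v _ hx, map_neg, tr, Finset.sum_neg_distrib]
  mem u v := hC.tr_J_curvature_mem hL hJm u v

theorem covD_sub {L : B → V → V → V} (hL : IsConnection S A L) (u : V) {Y Z : B → V}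
    (hY : VecIn A Y) (hZ : VecIn A Z) {x : B} (hx : x ∈ S) :
    covD C L u (fun y => Y y - Z y) x = covD C L u Y x - covD C L u Z x := by
  rw [covD, covD, covD, hC.derV_sub u hY hZ hx, ((hL.bilin x hx).right u).map_sub]
  abel

variable (hbr : ∀ u v, C.br u v = 0)
include hbr

/-- The second Bianchi identity in a frame of commuting vector fields; no condition on the torsion
is needed. -/
theorem curvature_bianchi_second {L : B → V → V → V} (hL : IsConnection S A L) (u v w a : V) {x : B}
    (hx : x ∈ S) :
    (covD C L u (fun y => curvature C L y v w a) x - curvature C L x v w (L x u a))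
      + (covD C L v (fun y => curvature C L y w u a) x - curvature C L x w u (L x v a))
      + (covD C L w (fun y => curvature C L y u v a) x - curvature C L x u v (L x w a)) = 0 := by
  have hz : ∀ y ∈ S, ∀ Y : B → V, VecIn A Y → covD C L 0 Y y = 0 := fun y hy Y hY => by
    rw [covD, (hC.derV_isLinear hY hy).map_zero, ((hL.bilin y hy).left _).map_zero, add_zero]
  have hR : ∀ u v, ∀ Y : B → V, VecIn A Y → ∀ y ∈ S, curvature C L y u v (Y y)
      = covD C L u (covD C L v Y) y - covD C L v (covD C L u Y) y := fun u v Y hY y hy => by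
    rw [← hC.covD_covD hL u v hY hy, hbr, hz y hy Y hY, sub_zero]
  have hc := VecIn.const (A := A) (B := B) a
  have h0 : ∀ u, ∀ y ∈ S, covD C L u (fun _ => a) y = L y u a := fun u y hy => by
    rw [covD, hC.derV_const u a hy, zero_add]
  have h1 : ∀ u v w, covD C L u (fun y => curvature C L y v w a) x
      = covD C L u (covD C L v (covD C L w fun _ => a)) x
        - covD C L u (covD C L w (covD C L v fun _ => a)) x := by
    intro u v w
    have hvw := hC.vecIn_covD hL v (hC.vecIn_covD hL w hc)
    have hwv := hC.vecIn_covD hL w (hC.vecIn_covD hL v hc)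
    rw [hC.covD_congr u (hC.vecIn_curvature hL v w a) (fun y hy => hR v w _ hc y hy) hx,
      hC.covD_sub hL u hvw hwv hx]
  have h2 : ∀ u v w, curvature C L x v w (L x u a)
      = covD C L v (covD C L w (covD C L u fun _ => a)) x
        - covD C L w (covD C L v (covD C L u fun _ => a)) x := by
    intro u v w
    rw [← h0 u x hx, hR v w _ (hC.vecIn_covD hL u hc) x hx]
  rw [h1, h1, h1, h2, h2, h2]
  abel

/-- The Ricci form of a connection which preserves `J` is closed. -/
theorem dTwo_tr_J_curvature {L : B → V → V → V} (hL : IsConnection S A L)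
    (hJm : ∀ v, VecIn A fun y => J y v) (hp : IsParallelEnd C S J L) {x : B} (hx : x ∈ S)
    (u v w : V) : dTwo C (fun y a b => tr fun z => J y (curvature C L y a b z)) x u v w = 0 := by
  set b := Module.finBasis ℝ V
  have key : ∀ u v w, C.derS u (fun y => tr fun z => J y (curvature C L y v w z)) x
      = tr fun a => J x (covD C L u (fun y => curvature C L y v w a) x
        - curvature C L x v w (L x u a)) := by
    intro u v w
    have e1 : C.derS u (fun y => tr fun z => J y (curvature C L y v w z)) x
        = ∑ i, b.coord i (J x (covD C L u (fun y => curvature C L y v w (b i)) x)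
          - L x u (J x (curvature C L x v w (b i)))) := by
      refine (hC.der_sum u _ (fun i _ => hC.vecIn_end_apply hJm
        (hC.vecIn_curvature hL v w (b i)) (b.coord i)) hx).trans ?_
      refine Finset.sum_congr rfl fun i _ => ?_
      rw [← hC.derV_apply u (hC.vecIn_end_apply hJm (hC.vecIn_curvature hL v w (b i))) x hx,
        ← hC.covD_parallel hJm hp u (hC.vecIn_curvature hL v w (b i)) hx, covD, add_sub_cancel_right]
    -- the connection contributes the trace of a commutator
    have e2 : tr (fun a => L x u (J x (curvature C L x v w a)))
        = tr fun a => J x (curvature C L x v w (L x u a)) := by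
      let N : Module.End ℝ V := ((hL.bilin x hx).right u).mk' _
      let R : Module.End ℝ V := (hC.curvature_linear_right hL v w hx).mk' _
      have t := LinearMap.trace_mul_comm ℝ N (J x * R)
      rw [← tr_eq_trace, ← tr_eq_trace] at t
      exact t
    rw [e1]
    simp only [tr, map_sub, Finset.sum_sub_distrib] at e2 ⊢
    rw [e2]
  rw [dTwo, key, key, key]
  have hB := fun a => hC.curvature_bianchi_second hbr hL u v w a hx
  simp only [tr, ← Finset.sum_add_distrib, ← map_add, hB, map_zero, Finset.sum_const_zero]

end SmoothCalculus

end RicciFormClosed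

section LieDerivativeJ

variable {B V : Type*} [AddCommGroup V] [Module ℝ V] [FiniteDimensional ℝ V]
  {C : FrameCalculus B V} {S : Set B} {A : Subalgebra ℝ (B → ℝ)}
  {G : B → LinearMap.BilinForm ℝ V} {J : B → Module.End ℝ V}

/-- `L_Y J = 0`, in a frame of commuting vector fields. -/
def IsHolomorphicField (C : FrameCalculus B V) (S : Set B) (J : B → Module.End ℝ V) (Y : B → V) :
    Prop :=
  ∀ x ∈ S, ∀ u, C.derV (Y x) (fun y => J y u) x - C.derV (J x u) Y x + J x (C.derV u Y x) = 0

namespace SmoothCalculus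

variable (hC : SmoothCalculus C S A)
include hC

theorem three_apply_mem {T : B → V → V → V → ℝ} (hT : IsThreeForm S A T) {a b c : B → V}
    (ha : VecIn A a) (hb : VecIn A b) (hc : VecIn A c) : (fun y => T y (a y) (b y) (c y)) ∈ A :=
  hC.apply_mem (F := fun y w => T y (a y) (b y) w) (fun y hy => (hT.alt y hy).lin3 _ _)
    (fun w => hC.apply_mem (F := fun y v => T y (a y) v w) (fun y hy => (hT.alt y hy).lin2 _ _)
      (fun v => hC.apply_mem (F := fun y u => T y u v w) (fun y hy => (hT.alt y hy).lin _ _)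
        (fun u => hT.mem u v w) ha) hb) hc

theorem der_three {T : B → V → V → V → ℝ} (hT : IsThreeForm S A T) (z : V) {a b c : B → V}
    (ha : VecIn A a) (hb : VecIn A b) (hc : VecIn A c) {x : B} (hx : x ∈ S) :
    C.derS z (fun y => T y (a y) (b y) (c y)) x
      = C.derS z (fun y => T y (a x) (b x) (c x)) x + T x (C.derV z a x) (b x) (c x)
        + T x (a x) (C.derV z b x) (c x) + T x (a x) (b x) (C.derV z c x) := by
  rw [hC.der_apply z (F := fun y w => T y (a y) (b y) w) (fun y hy => (hT.alt y hy).lin3 _ _)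
      (fun w => hC.three_apply_mem hT ha hb (VecIn.const w)) hc hx,
    hC.der_apply z (F := fun y v => T y (a y) v (c x)) (fun y hy => (hT.alt y hy).lin2 _ _)
      (fun v => hC.three_apply_mem hT ha (VecIn.const v) (VecIn.const _)) hb hx,
    hC.der_apply z (F := fun y u => T y u (b x) (c x)) (fun y hy => (hT.alt y hy).lin _ _)
      (fun u => hT.mem u _ _) ha hx]

theorem lieThree_J {T : B → V → V → V → ℝ} (hT : IsThreeForm S A T)
    (hJm : ∀ v, VecIn A fun y => J y v) {Y : B → V} (hY : IsHolomorphicField C S J Y) {x : B}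
    (hx : x ∈ S) (u v w : V) :
    lieThree C Y (fun y a b c => T y (J y a) (J y b) (J y c)) x u v w
      = lieThree C Y T x (J x u) (J x v) (J x w) := by
  have hD : ∀ u, C.derV (J x u) Y x = C.derV (Y x) (fun y => J y u) x + J x (C.derV u Y x) :=
    fun u => by
      have := hY x hx u
      rw [sub_add_eq_add_sub, sub_eq_zero] at this
      exact this.symm
  have ha := hT.alt x hx
  rw [lieThree, lieThree, hC.der_three hT (Y x) (hJm u) (hJm v) (hJm w) hx, hD, hD, hD,
    (ha.lin _ _).map_add, (ha.lin2 _ _).map_add, (ha.lin3 _ _).map_add]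
  ring

/-- The Lie derivative of `ω` along a holomorphic vector field corresponds to that of the metric. -/
theorem lieTwo_omega (hG : IsMetricField S A G) (hJm : ∀ v, VecIn A fun y => J y v) {Y : B → V}
    (hY : IsHolomorphicField C S J Y) {x : B} (hx : x ∈ S) (u v : V) :
    lieTwo C Y (fun y a b => G y (J y a) b) x u v = lieTwo C Y (fun y a b => G y a b) x (J x u) v := by
  have hD : C.derV (J x u) Y x = C.derV (Y x) (fun y => J y u) x + J x (C.derV u Y x) := by
    have := hY x hx u
    rw [sub_add_eq_add_sub, sub_eq_zero] at this
    exact this.symm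
  have h := hC.der_metric_apply hG (Y x) (hJm u) (VecIn.const v) hx
  rw [hC.derV_const _ v hx, map_zero, add_zero] at h
  rw [lieTwo, lieTwo, h, hD]
  simp only [map_add, LinearMap.add_apply]
  ring

end SmoothCalculus

end LieDerivativeJ

/-! ### The metric equation of a soliton -/

section SolitonInFrame

variable {B V : Type*} [AddCommGroup V] [Module ℝ V] [FiniteDimensional ℝ V]
  {C : FrameCalculus B V} {S : Set B} {A : Subalgebra ℝ (B → ℝ)}
  {G : B → LinearMap.BilinForm ℝ V} {J : B → Module.End ℝ V}

theorem eta_vec2 (v : Fin 2 → V) : v = ![v 0, v 1] := by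
  funext i; fin_cases i <;> rfl

theorem eta_vec3 (v : Fin 3 → V) : v = ![v 0, v 1, v 2] := by
  funext i; fin_cases i <;> rfl

omit [FiniteDimensional ℝ V] in
theorem extD_of_br_eq_zero (hbr : ∀ u v, C.br u v = 0) {k : ℕ} (α : B → (Fin k → V) → ℝ) {x : B}
    (h0 : ∀ v i, v i = 0 → α x v = 0) (v : Fin (k + 1) → V) :
    extD C α x v = ∑ j : Fin (k + 1), (-1) ^ (j : ℕ) *
      C.derS (v j) (fun y => α y (j.removeNth v)) x := by
  rw [extD]
  refine Finset.sum_congr rfl fun j _ => ?_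
  rw [Finset.sum_eq_zero fun i hi => ?_, add_zero]
  obtain ⟨l, rfl⟩ := Fin.exists_succAbove_eq (Finset.mem_filter.1 hi).2.ne
  exact h0 _ l (by simp [Fin.removeNth, hbr])

namespace SmoothCalculus

variable (hC : SmoothCalculus C S A)
include hC

theorem extD_eq_dTwo (hbr : ∀ u v, C.br u v = 0) {α : B → (Fin 2 → V) → ℝ} {Q : B → V → V → ℝ}
    (hQ : IsTwoForm S A Q) (h : ∀ x ∈ S, ∀ u v, α x ![u, v] = Q x u v) {x : B} (hx : x ∈ S)
    (u v w : V) : extD C α x ![u, v, w] = dTwo C Q x u v w := by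
  have h0 : ∀ v i, v i = 0 → α x v = 0 := by
    intro v i hi
    rw [eta_vec2 v, h x hx]
    fin_cases i
    · rw [show v 0 = 0 from hi, (hQ.lin x hx _).map_zero]
    · rw [show v 1 = 0 from hi, (hQ.lin2 hx _).map_zero]
  rw [extD_of_br_eq_zero hbr α h0, Fin.sum_univ_three, (removeNth_vec3 u v w).1,
    (removeNth_vec3 u v w).2.1, (removeNth_vec3 u v w).2.2, dTwo,
    ← hC.der_congr u (fun y hy => h y hy v w) x hx, ← hC.der_congr w (fun y hy => h y hy u v) x hx]
  have e : C.derS v (fun y => α y ![u, w]) x = -C.derS v (fun y => Q y w u) x := by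
    rw [← hC.der_neg v (hQ.mem w u) hx]
    exact hC.der_congr v (fun y hy => by rw [h y hy, hQ.skew y hy]) x hx
  simp [e]

theorem lieTwo_sub {Q : B → V → V → ℝ} (hQ : ∀ x ∈ S, IsBilin (Q x))
    (hm : ∀ u v, (fun y => Q y u v) ∈ A) {Y Z : B → V}
    (hY : VecIn A Y) (hZ : VecIn A Z) {x : B} (hx : x ∈ S) (u v : V) :
    lieTwo C (fun y => Y y - Z y) Q x u v = lieTwo C Y Q x u v - lieTwo C Z Q x u v := by
  have hb := hQ x hx
  rw [lieTwo, lieTwo, lieTwo, (hC.der_isLinear (hm u v) hx).map_sub, hC.derV_sub u hY hZ hx,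
    hC.derV_sub v hY hZ hx, (hb.left _).map_sub, (hb.right _).map_sub]
  ring

theorem lieThree_sub {T : B → V → V → V → ℝ} (hT : IsThreeForm S A T) {Y Z : B → V}
    (hY : VecIn A Y) (hZ : VecIn A Z) {x : B} (hx : x ∈ S) (u v w : V) :
    lieThree C (fun y => Y y - Z y) T x u v w = lieThree C Y T x u v w - lieThree C Z T x u v w := by
  have ha := hT.alt x hx
  rw [lieThree, lieThree, lieThree, (hC.der_isLinear (hT.mem u v w) hx).map_sub,
    hC.derV_sub u hY hZ hx, hC.derV_sub v hY hZ hx, hC.derV_sub w hY hZ hx, (ha.lin _ _).map_sub,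
    (ha.lin2 _ _).map_sub, (ha.lin3 _ _).map_sub]
  ring

theorem lieThree_neg {T T' : B → V → V → V → ℝ} (hT : IsThreeForm S A T) (Y : B → V)
    (h : ∀ x ∈ S, ∀ u v w, T' x u v w = -T x u v w) {x : B} (hx : x ∈ S) (u v w : V) :
    lieThree C Y T' x u v w = -lieThree C Y T x u v w := by
  simp only [lieThree, h x hx]
  rw [hC.der_congr _ (fun y hy => h y hy u v w) x hx, hC.der_neg _ (hT.mem u v w) hx]
  ring

theorem metric_isBilin (G : B → LinearMap.BilinForm ℝ V) (x : B) : IsBilin fun a b => G x a b :=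
  ⟨fun v => ⟨by simp, by simp⟩, fun u => ⟨by simp, by simp⟩⟩

theorem omega_twoForm (hG : IsMetricField S A G) (hJ : IsHermitianField S A G J) :
    IsTwoForm S A fun y a b => G y (J y a) b where
  lin x hx v := ⟨by simp, by simp⟩
  skew x hx u v := hC.omegaBil_skew hG hJ hx u v
  mem u v := hC.metric_apply_mem hG (hJ.mem u) (VecIn.const v)

end SmoothCalculus

namespace IsPluriclosed

variable {H : B → V [⋀^Fin 3]→ₗ[ℝ] ℝ} (h : IsPluriclosed C S A G J H)
include h

theorem rhoB_twoForm : IsTwoForm S A fun y u v =>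
    rhoB C (fun y a b => G y a b) (fun y a => J y a) y u v :=
  (h.smooth.tr_J_curvature_twoForm (h.smooth.torsConn_isConnection h.metric h.threeForm)
    h.herm.mem).smul (1 / 2)

theorem rhoB11_J_left {x : B} (hx : x ∈ S) (u v : V) :
    rhoB11 C (fun y a b => G y a b) (fun y a => J y a) x (J x u) v
      = -rhoB11 C (fun y a b => G y a b) (fun y a => J y a) x u (J x v) := by
  rw [rhoB11, rhoB11, h.herm.sq x hx, h.herm.sq x hx, (h.rhoB_twoForm.lin x hx _).map_neg,
    (h.rhoB_twoForm.lin2 hx _).map_neg]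
  ring

/-- The type of the torsion of the Bismut connection. -/
theorem tors_J {x : B} (hx : x ∈ S) (u v : V) :
    tors G (bismutTors C G J) x (J x u) (J x v) = tors G (bismutTors C G J) x u v
      + J x (tors G (bismutTors C G J) x (J x u) v) + J x (tors G (bismutTors C G J) x u (J x v)) := by
  refine (h.metric.inner x hx).ext fun w => ?_
  have hs : ∀ a b, G x (J x a) b = -G x a (J x b) := fun a b => by
    rw [h.herm.skew hx, neg_neg]
  simp only [map_add, LinearMap.add_apply, hs, tors_apply h.metric h.threeForm hx]
  have hJJ := fun a b => h.smooth.nablaJ_J h.metric h.herm a b hx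
  have hJl := fun a b => h.smooth.nablaJ_J_left h.metric h.herm h.integrable a b hx
  have hn : ∀ a b, nablaJ C G J x (-a) b = -nablaJ C G J x a b := fun a b =>
    ((h.smooth.nablaJ_bilin h.metric h.herm hx).left b).map_neg a
  simp only [h.smooth.bismutTors_eq h.metric h.herm h.integrable _ _ _ hx, hJJ, hJl, hn, h.herm.sq x hx,
    map_neg,
    LinearMap.neg_apply, hs]
  ring

variable (hbr : ∀ u v, C.br u v = 0)
include hbr

theorem lieTwo_leeVec {x : B} (hx : x ∈ S) (u v : V) :
    lieTwo C (leeVec C G J) (fun y a b => G y a b) x u v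
      = nablaOne C G (leeTrace G J (bismutTors C G J)) x u v
        + nablaOne C G (leeTrace G J (bismutTors C G J)) x v u := by
  have hs := h.smooth.covD_symm h.metric (leeVec C G J) u v hx
  rw [hbr, hbr, add_zero, add_zero] at hs
  rw [h.nablaOne_lee u v hx, h.nablaOne_lee v u hx, (h.metric.inner x hx).symm _ u, hs, lieTwo]

/-- The equation of a pluriclosed soliton is the metric part of the equations of a soliton of the
generalized Ricci flow. -/
theorem soliton_metric_iff {Y : B → V} (hY : VecIn A Y) (hYJ : IsHolomorphicField C S J Y) (lam : ℝ)
    {x : B} (hx : x ∈ S) :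
    (∀ u v, rhoB11 C (fun y a b => G y a b) (fun y a => J y a) x u v
        = lam * G x (J x u) v + (1 / 2) * lieTwo C Y (fun y a b => G y (J y a) b) x u v) ↔
      ∀ u v, ricB C (fun y a b => G y a b) (fun y => H y) x u v = lam * G x u v
        + (1 / 2) * lieTwo C (fun y => Y y - leeVec C G J y) (fun y a b => G y a b) x u v := by
  have hω := h.smooth.lieTwo_twoForm (h.smooth.omega_twoForm h.metric h.herm) hY
  have hL : ∀ u v, lieTwo C Y (fun y a b => G y (J y a) b) x u (J x v)
      = lieTwo C Y (fun y a b => G y a b) x u v := by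
    intro u v
    rw [hω.skew x hx, h.smooth.lieTwo_omega h.metric h.herm.mem hYJ hx, h.herm.sq x hx, lieTwo,
      lieTwo, h.smooth.der_congr _ (fun y hy => (h.metric.inner y hy).symm u v) x hx,
      (h.metric.inner x hx).symm _ v, (h.metric.inner x hx).symm u _,
      h.smooth.der_congr (Y x) (f := fun y => G y (-v) u) (g := fun y => -G y v u)
        (fun y hy => by simp) x hx, h.smooth.der_neg _ (h.metric.mem v u) hx,
      ((h.smooth.derV_isLinear hY hx)).map_neg]
    simp only [map_neg, LinearMap.neg_apply]
    ring
  have hρ : ∀ u v, rhoB11 C (fun y a b => G y a b) (fun y a => J y a) x u (J x v)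
      = ricB C (fun y a b => G y a b) (fun y => H y) x u v
        + (1 / 2) * lieTwo C (leeVec C G J) (fun y a b => G y a b) x u v := fun u v => by
    rw [h.rho11_J u v hx, h.lieTwo_leeVec hbr hx]
  have hS : ∀ u v, lieTwo C (fun y => Y y - leeVec C G J y) (fun y a b => G y a b) x u v
      = lieTwo C Y (fun y a b => G y a b) x u v
        - lieTwo C (leeVec C G J) (fun y a b => G y a b) x u v := fun u v =>
    h.smooth.lieTwo_sub (fun y _ => h.smooth.metric_isBilin G y) h.metric.mem hY h.vecIn_leeVec hx u v
  constructor
  · intro hs u v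
    have := hs u (J x v)
    rw [hρ, hL, h.herm.herm x hx] at this
    rw [hS]
    linarith
  · intro hs u v
    have hv : v = J x (-J x v) := by rw [map_neg, h.herm.sq x hx, neg_neg]
    have := hs u (-J x v)
    rw [hv, hρ, hL, h.herm.herm x hx, this, hS]
    ring

end IsPluriclosed

end SolitonInFrame

/-! ### The equation of a soliton for the three-form -/

section SolitonForm

variable {B V : Type*} [AddCommGroup V] [Module ℝ V] [FiniteDimensional ℝ V]
  {C : FrameCalculus B V} {S : Set B} {A : Subalgebra ℝ (B → ℝ)}
  {G : B → LinearMap.BilinForm ℝ V} {J : B → Module.End ℝ V}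

namespace IsPluriclosed

variable {H : B → V [⋀^Fin 3]→ₗ[ℝ] ℝ} (h : IsPluriclosed C S A G J H)
include h

theorem form_threeForm : IsThreeForm S A fun y u v w => H y ![u, v, w] := by
  have hT := h.threeForm
  refine ⟨fun x hx => ⟨fun v w => ⟨fun a b => ?_, fun c a => ?_⟩, fun u v w => ?_, fun u v w => ?_⟩,
    fun u v w => h.form_mem _⟩
  · simp only [h.form_vec hx, ((hT.alt x hx).lin v w).map_add]; ring
  · simp only [h.form_vec hx, ((hT.alt x hx).lin v w).map_smul, smul_eq_mul]; ring
  · simp only [h.form_vec hx, (hT.alt x hx).swap12 u v]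
  · simp only [h.form_vec hx, (hT.alt x hx).swap23 u v]

theorem codiff_extD (v : Fin 3 → V) {x : B} (hx : x ∈ S) :
    codiff C (fun y a b => G y a b) (extD C fun y => H y) x v = 0 := by
  rw [codiff, neg_eq_zero]
  refine Finset.sum_eq_zero fun i _ => Finset.sum_eq_zero fun j _ => ?_
  rw [nabla, h.smooth.der_congr _ (g := fun _ => 0) (fun y hy => h.closed y hy _) x hx,
    h.smooth.der_const _ _ x hx]
  simp [h.closed x hx]

variable (hbr : ∀ u v, C.br u v = 0)
include hbr

theorem closed_frame {x : B} (hx : x ∈ S) (u v w z : V) :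
    C.derS u (fun y => H y ![v, w, z]) x - C.derS v (fun y => H y ![u, w, z]) x
      + C.derS w (fun y => H y ![u, v, z]) x - C.derS z (fun y => H y ![u, v, w]) x = 0 := by
  have h1 := h.closed x hx ![u, v, w, z]
  rw [extD_of_br_eq_zero hbr (fun y => H y) fun v i hi => (H x).map_coord_zero i hi,
    Fin.sum_univ_four, (removeNth_vec4 u v w z).1,
    (removeNth_vec4 u v w z).2.1, (removeNth_vec4 u v w z).2.2.1, (removeNth_vec4 u v w z).2.2.2] at h1
  simp [pow_succ] at h1
  linarith

theorem bismutTors_eq_dTwo {x : B} (hx : x ∈ S) (u v w : V) :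
    bismutTors C G J x u v w = dTwo C (fun y a b => G y (J y a) b) x (J x u) (J x v) (J x w) :=
  h.smooth.extD_eq_dTwo hbr (h.smooth.omega_twoForm h.metric h.herm) (fun _ _ _ _ => rfl) hx _ _ _

theorem nablaOne_skew {x : B} (hx : x ∈ S) (u v : V) :
    nablaOne C G (leeTrace G J (bismutTors C G J)) x u v
        - nablaOne C G (leeTrace G J (bismutTors C G J)) x v u
      = C.derS u (fun y => leeTrace G J (bismutTors C G J) y v) x
        - C.derS v (fun y => leeTrace G J (bismutTors C G J) y u) x := by
  have h1 := h.smooth.lc_torsionFree h.metric x hx u v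
  rw [hbr, sub_eq_zero] at h1
  rw [nablaOne, nablaOne, h1]
  ring

theorem dLee_twoForm : IsTwoForm S A fun x u v =>
    C.derS u (fun y => leeTrace G J (bismutTors C G J) y v) x
      - C.derS v (fun y => leeTrace G J (bismutTors C G J) y u) x where
  lin x hx v := by
    have hl := fun y hy => h.leeTrace_isLinear (x := y) hy
    refine ⟨fun a b => ?_, fun c a => ?_⟩
    · rw [(h.smooth.der_isLinear (h.leeTrace_mem v) hx).map_add,
        h.smooth.der_congr v (fun y hy => (hl y hy).map_add a b) x hx,
        h.smooth.der_add v (h.leeTrace_mem a) (h.leeTrace_mem b) x hx]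
      ring
    · rw [(h.smooth.der_isLinear (h.leeTrace_mem v) hx).map_smul,
        h.smooth.der_congr v (fun y hy => (hl y hy).map_smul c a) x hx]
      simp only [smul_eq_mul]
      rw [h.smooth.der_const_mul v c (h.leeTrace_mem a) hx]
      ring
  skew x hx u v := by ring
  mem u v := fun_sub_mem (h.smooth.der_mem u (h.leeTrace_mem v)) (h.smooth.der_mem v (h.leeTrace_mem u))

/-- The form part of the equations of a soliton of the generalized Ricci flow, for a pluriclosed
soliton. It is obtained from the closedness of `ρ`: the part of `dρ` of type `(2,1) + (1,2)` relates
the derivative of the `(1,1)`-part of `ρ`, which is `lam ω + L_Y ω / 2`, to that of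
`(d^*H + dθ + ι_{θ^♯} H) / 2`. -/
theorem soliton_form {Y : B → V} (hY : VecIn A Y) (hYJ : IsHolomorphicField C S J Y) (lam : ℝ)
    (hs : ∀ x ∈ S, ∀ u v, rhoB11 C (fun y a b => G y a b) (fun y a => J y a) x u v
      = lam * G x (J x u) v + (1 / 2) * lieTwo C Y (fun y a b => G y (J y a) b) x u v)
    {x : B} (hx : x ∈ S) (u v w : V) :
    laplacian C (fun y a b => G y a b) (fun y => H y) x ![u, v, w] = -2 * lam * H x ![u, v, w]
      - lieThree C (fun y => Y y - leeVec C G J y) (fun y a b c => H y ![a, b, c]) x u v w := by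
  have hC := h.smooth
  have hL := hC.torsConn_isConnection h.metric h.threeForm
  set g := fun y a b => G y a b
  set ρ : B → V → V → ℝ := fun y a b => rhoB C g (fun y a => J y a) y a b with hρdef
  have hρ : IsTwoForm S A ρ := h.rhoB_twoForm
  have hω := hC.omega_twoForm h.metric h.herm
  have hLω := hC.lieTwo_twoForm hω hY
  -- `β` is the `(1,1)`-part of `ρ`, and `σ` is the part of type `(2,0) + (0,2)`
  set β : B → V → V → ℝ := fun y a b => lam * G y (J y a) b
    + (1 / 2) * lieTwo C Y (fun y a b => G y (J y a) b) y a b with hβdef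
  have hβ : IsTwoForm S A β := (hω.smul lam).add (hLω.smul (1 / 2))
  set σ : B → V → V → ℝ := fun y a b => ρ y a b + (-1) * β y a b with hσdef
  have hσ : IsTwoForm S A σ := hρ.add (hβ.smul (-1))
  have hβJ : ∀ y ∈ S, ∀ a b, β y (J y a) b = -β y a (J y b) := fun y hy a b => by
    simp only [hβdef, ← hs y hy]
    exact h.rhoB11_J_left hy a b
  have hσ' : ∀ y ∈ S, ∀ a b, σ y a b = (1 / 2) * (ρ y a b - ρ y (J y a) (J y b)) :=
    fun y hy a b => by
      simp only [hσdef, hβdef, ← hs y hy, rhoB11, hρdef]; ring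
  have hσJ : ∀ y ∈ S, ∀ a b, σ y (J y a) b = σ y a (J y b) := fun y hy a b => by
    rw [hσ' y hy, hσ' y hy, h.herm.sq y hy, h.herm.sq y hy, (hρ.lin y hy _).map_neg,
      (hρ.lin2 hy _).map_neg]
    ring
  have hdρ : ∀ u v w, dTwo C ρ x u v w = 0 := fun u v w => by
    have := hC.dTwo_smul (hC.tr_J_curvature_twoForm hL h.herm.mem) (1 / 2) hx u v w
    rw [hC.dTwo_tr_J_curvature hbr hL h.herm.mem h.parallel hx, mul_zero] at this
    exact this
  have hdσ : ∀ u v w, dTwo C σ x u v w = -dTwo C β x u v w := fun u v w => by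
    rw [hC.dTwo_add hρ (hβ.smul (-1)) hx, hC.dTwo_smul hβ (-1) hx, hdρ]; ring
  have hK : ∀ u v, torsConn C G (bismutTors C G J) x u v - torsConn C G (bismutTors C G J) x v u
      = tors G (bismutTors C G J) x u v := fun u v => by
    rw [torsConn, torsConn, tors_swap h.metric h.threeForm hx u v,
      ← sub_eq_zero.1 ((hC.lc_torsionFree h.metric x hx u v).trans (hbr u v))]
    module
  have ha := hC.dTwo_J_antiinvariant h.herm.mem h.parallel hL hx hK (h.herm.sq x hx) (h.tors_J hx)
    hσ hσJ u v w
  have hb := hC.dTwo_J_invariant h.herm.mem h.parallel hL hx hK (h.herm.sq x hx) (h.tors_J hx)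
    hβ hβJ u v w
  have hdβ : dTwo C β x (J x u) (J x v) (J x w) = -lam * H x ![u, v, w]
      - (1 / 2) * lieThree C Y (fun y a b c => H y ![a, b, c]) x u v w := by
    rw [hC.dTwo_add (hω.smul lam) (hLω.smul (1 / 2)) hx, hC.dTwo_smul hω _ hx,
      hC.dTwo_smul hLω _ hx, ← h.bismutTors_eq_dTwo hbr hx, hC.dTwo_lieTwo hbr hω hY hx,
      ← hC.lieThree_J (hC.dTwo_threeForm hω) h.herm.mem hYJ hx, h.form_vec hx,
      hC.lieThree_neg (T' := fun y a b c => H y ![a, b, c])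
        (T := fun y a b c => dTwo C (fun y a b => G y (J y a) b) y (J y a) (J y b) (J y c))
        (hC.threeForm_congr h.threeForm fun y hy a b c => h.bismutTors_eq_dTwo hbr hy a b c) Y
        (fun y hy a b c => by rw [h.form_vec hy, h.bismutTors_eq_dTwo hbr hy]) hx]
    ring
  -- the terms of `ha` with a single `J` are removed by `hb`, because `dσ = -dβ`
  have hda : dTwo C (fun y a b => σ y a (J y b)) x u v w = lam * H x ![u, v, w]
      + (1 / 2) * lieThree C Y (fun y a b c => H y ![a, b, c]) x u v w := by
    rw [hdσ, hdσ, hdσ, hdσ] at ha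
    linarith
  have hT := h.form_threeForm
  have hι := hC.interior_twoForm hT h.vecIn_leeVec
  have hθ := h.dLee_twoForm hbr
  have hσσ := hC.twoForm_J h.herm.mem hσ hσJ
  have hco : ∀ y ∈ S, ∀ a b, codiff C g (fun y => H y) y ![a, b] = 2 * σ y a (J y b)
      + ((-1) * (C.derS a (fun y => leeTrace G J (bismutTors C G J) y b) y
      - C.derS b (fun y => leeTrace G J (bismutTors C G J) y a) y)
      + (-1) * H y ![a, b, leeVec C G J y]) := fun y hy a b => by
    have h1 := h.rho_anti a b hy
    have h2 : 2 * σ y a (J y b) = ρ y a (J y b) - ρ y b (J y a) := by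
      rw [hσ' y hy, h.herm.sq y hy, (hρ.lin2 hy _).map_neg, hρ.skew y hy b]; ring
    rw [h.nablaOne_skew hbr hy] at h1
    rw [h2]
    linarith
  have hext : extD C (codiff C g fun y => H y) x ![u, v, w] = 2 * lam * H x ![u, v, w]
      + lieThree C Y (fun y a b c => H y ![a, b, c]) x u v w
      - lieThree C (leeVec C G J) (fun y a b c => H y ![a, b, c]) x u v w := by
    rw [hC.extD_eq_dTwo hbr ((hσσ.smul 2).add ((hθ.smul (-1)).add (hι.smul (-1)))) hco hx,
      hC.dTwo_add (hσσ.smul 2) ((hθ.smul (-1)).add (hι.smul (-1))) hx,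
      hC.dTwo_add (hθ.smul (-1)) (hι.smul (-1)) hx, hC.dTwo_smul hσσ _ hx, hC.dTwo_smul hθ _ hx,
      hC.dTwo_smul hι _ hx, hda, hC.dTwo_dOne hbr h.leeTrace_mem hx,
      hC.dTwo_interior hT h.vecIn_leeVec hx (h.closed_frame hbr hx)]
    ring
  rw [laplacian, h.codiff_extD _ hx, hext, hC.lieThree_sub hT hY h.vecIn_leeVec hx]
  ring

end IsPluriclosed

end SolitonForm

/-! ### Charts and left-invariant frames -/

section Chart

variable {E : Type*} [NormedAddCommGroup E] [NormedSpace ℝ E]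

/-- The functions which are smooth on `U`. -/
def smoothOn (U : Set E) : Subalgebra ℝ (E → ℝ) where
  carrier := {f | ContDiffOn ℝ ∞ f U}
  mul_mem' hf hg := ContDiffOn.mul hf hg
  add_mem' hf hg := ContDiffOn.add hf hg
  algebraMap_mem' c := contDiffOn_const (c := c)

theorem mem_smoothOn {U : Set E} {f : E → ℝ} : f ∈ smoothOn U ↔ ContDiffOn ℝ ∞ f U := Iff.rfl

variable [FiniteDimensional ℝ E]

theorem vecIn_smoothOn {U : Set E} {Y : E → E} : VecIn (smoothOn U) Y ↔ ContDiffOn ℝ ∞ Y U := by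
  constructor
  · intro h
    set b := Module.finBasis ℝ E
    have : Y = fun y => ∑ i, b.coord i (Y y) • b i := by
      funext y; simp
    rw [this]
    exact ContDiffOn.sum fun i _ => (mem_smoothOn.1 (h (b.coord i))).smul contDiffOn_const
  · intro h l
    exact (LinearMap.toContinuousLinearMap l).contDiff.comp_contDiffOn h

/-- Coordinate vector fields on an open subset of a normed space. -/
theorem smoothCalculus_chartCalc {U : Set E} (hU : IsOpen U) :
    SmoothCalculus (chartCalc E) U (smoothOn U) where
  mem_congr hf h := ContDiffOn.congr hf fun x hx => (h x hx).symm
  inv_mem hf h := ContDiffOn.inv hf h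
  der_mem u f hf :=
    (ContDiffOn.fderiv_of_isOpen hf hU (m := ∞) (by simp)).clm_apply contDiffOn_const
  der_congr u f g h x hx := by
    have : f =ᶠ[nhds x] g := Filter.eventually_of_mem (hU.mem_nhds hx) h
    change fderiv ℝ f x u = fderiv ℝ g x u
    rw [this.fderiv_eq]
  der_const u c x _ := by simp [chartCalc]
  der_add u f g hf hg x hx := by
    have hf' := (hf.contDiffAt (hU.mem_nhds hx)).differentiableAt (by simp)
    have hg' := (hg.contDiffAt (hU.mem_nhds hx)).differentiableAt (by simp)
    simp [chartCalc, fderiv_fun_add hf' hg']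
  der_mul u f g hf hg x hx := by
    have hf' := (hf.contDiffAt (hU.mem_nhds hx)).differentiableAt (by simp)
    have hg' := (hg.contDiffAt (hU.mem_nhds hx)).differentiableAt (by simp)
    simp [chartCalc, fderiv_fun_mul hf' hg']
    ring
  der_add_left u v f _ x _ := by simp [chartCalc]
  der_smul_left c u f _ x _ := by simp [chartCalc]
  der_comm u v f hf x hx := by
    have h2 : ContDiffAt ℝ ∞ f x := hf.contDiffAt (hU.mem_nhds hx)
    have hs : IsSymmSndFDerivAt ℝ f x := h2.isSymmSndFDerivAt (by
      rw [minSmoothness_of_isRCLikeNormedField]; exact WithTop.coe_le_coe.2 (le_top : (2 : ℕ∞) ≤ ⊤))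
    have hd : DifferentiableAt ℝ (fderiv ℝ f) x :=
      (h2.fderiv_right (m := 1) (by norm_cast)).differentiableAt (by simp)
    have e : ∀ u v, fderiv ℝ (fun y => fderiv ℝ f y v) x u = fderiv ℝ (fderiv ℝ f) x u v := by
      intro u v
      rw [fderiv_clm_apply hd (differentiableAt_const v)]
      simp
    change fderiv ℝ (fun y => fderiv ℝ f y v) x u - fderiv ℝ (fun y => fderiv ℝ f y u) x v
      = fderiv ℝ f x 0
    rw [e, e, hs.eq, sub_self, map_zero]
  br_add_left _ _ _ := by simp [chartCalc]
  br_smul_left _ _ _ := by simp [chartCalc]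
  br_skew _ _ := by simp [chartCalc]
  jacobi _ _ _ := by simp [chartCalc]
  derV_apply u Y hY x hx l := by
    have hd : DifferentiableAt ℝ Y x :=
      ((vecIn_smoothOn.1 hY).contDiffAt (hU.mem_nhds hx)).differentiableAt (by simp)
    have := (LinearMap.toContinuousLinearMap l).hasFDerivAt.comp x hd.hasFDerivAt
    change l (fderiv ℝ Y x u) = fderiv ℝ (fun y => l (Y y)) x u
    have e : fderiv ℝ (fun y => l (Y y)) x = (LinearMap.toContinuousLinearMap l).comp (fderiv ℝ Y x) :=
      this.fderiv
    rw [e]; rfl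

end Chart

section Lie

variable {𝔤 : Type*} [LieRing 𝔤] [LieAlgebra ℝ 𝔤]

/-- Left-invariant vector fields and constant functions. -/
theorem smoothCalculus_lieCalc : SmoothCalculus (lieCalc 𝔤) Set.univ (⊤ : Subalgebra ℝ (Unit → ℝ)) where
  mem_congr _ _ := trivial
  inv_mem _ _ := trivial
  der_mem _ _ _ := trivial
  der_congr _ _ _ _ _ _ := rfl
  der_const _ _ _ _ := rfl
  der_add _ _ _ _ _ _ _ := by simp [lieCalc]
  der_mul _ _ _ _ _ _ _ := by simp [lieCalc]
  der_add_left _ _ _ _ _ _ := by simp [lieCalc]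
  der_smul_left _ _ _ _ _ _ := by simp [lieCalc]
  der_comm _ _ _ _ _ _ := by simp [lieCalc]
  br_add_left _ _ _ := add_lie _ _ _
  br_smul_left _ _ _ := smul_lie _ _ _
  br_skew u v := (lie_skew v u).symm
  jacobi u v w := lie_jacobi u v w
  derV_apply _ _ _ _ _ _ := by simp [lieCalc]

end Lie

/-! ### Tensor fields read in a chart -/

section ManifoldCharts

variable {E : Type*} [NormedAddCommGroup E] [NormedSpace ℝ E]
  {M : Type*} [TopologicalSpace M] [ChartedSpace E M]

section Frame

variable [IsManifold 𝓘(ℝ, E) ∞ M]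

theorem exists_frame_equiv (p : M) {x : E} (hx : x ∈ (chartAt E p).target) :
    ∃ e : E ≃L[ℝ] TangentSpace 𝓘(ℝ, E) ((chartAt E p).symm x), (e : E →L[ℝ] _) = frame p x :=
  have : IsManifold 𝓘(ℝ, E) 1 M := IsManifold.of_le (n := ∞) (by simp)
  ⟨(mdifferentiable_chart (I := 𝓘(ℝ, E)) p).symm.mfderiv hx, rfl⟩

theorem frame_inverse_frame (p : M) {x : E} (hx : x ∈ (chartAt E p).target) (u : E) :
    (frame p x).inverse (frame p x u) = u := by
  obtain ⟨e, he⟩ := exists_frame_equiv p hx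
  rw [← he, ContinuousLinearMap.inverse_equiv]
  exact e.symm_apply_apply u

theorem frame_frame_inverse (p : M) {x : E} (hx : x ∈ (chartAt E p).target)
    (w : TangentSpace 𝓘(ℝ, E) ((chartAt E p).symm x)) : frame p x ((frame p x).inverse w) = w := by
  obtain ⟨e, he⟩ := exists_frame_equiv p hx
  rw [← he, ContinuousLinearMap.inverse_equiv]
  exact e.apply_symm_apply w

end Frame

/-- The components of a bilinear form field, as a field of bilinear forms. -/
noncomputable def chartBilForm (g : ∀ q : M, LinearMap.BilinForm ℝ (TangentSpace 𝓘(ℝ, E) q)) (p : M)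
    (x : E) : LinearMap.BilinForm ℝ E :=
  (g ((chartAt E p).symm x)).compl₁₂ (frame p x : E →ₗ[ℝ] _) (frame p x : E →ₗ[ℝ] _)

/-- The components of an endomorphism field, as a field of endomorphisms. -/
noncomputable def chartEndo (J : ∀ q : M, Module.End ℝ (TangentSpace 𝓘(ℝ, E) q)) (p : M)
    (x : E) : Module.End ℝ E :=
  ((frame p x).inverse : _ →ₗ[ℝ] E) ∘ₗ J ((chartAt E p).symm x) ∘ₗ (frame p x : E →ₗ[ℝ] _)

/-- The components of a differential form, as a field of alternating maps. -/
noncomputable def chartAlt {k : ℕ} (H : ∀ q : M, (TangentSpace 𝓘(ℝ, E) q) [⋀^Fin k]→ₗ[ℝ] ℝ)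
    (p : M) (x : E) : E [⋀^Fin k]→ₗ[ℝ] ℝ :=
  (H ((chartAt E p).symm x)).compLinearMap (frame p x : E →ₗ[ℝ] _)

variable [FiniteDimensional ℝ E] [IsManifold 𝓘(ℝ, E) ∞ M]
  {J : ∀ q : M, Module.End ℝ (TangentSpace 𝓘(ℝ, E) q)}
  {g : ∀ q : M, LinearMap.BilinForm ℝ (TangentSpace 𝓘(ℝ, E) q)}
  {θ : ∀ q : M, Module.Dual ℝ (TangentSpace 𝓘(ℝ, E) q)}
  {H : ∀ q : M, (TangentSpace 𝓘(ℝ, E) q) [⋀^Fin 3]→ₗ[ℝ] ℝ}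

theorem smoothCalculus_chart (p : M) :
    SmoothCalculus (chartCalc E) (chartAt E p).target (smoothOn (chartAt E p).target) :=
  smoothCalculus_chartCalc (chartAt E p).open_target

theorem IsSKT.isMetricField (hg : IsSKT J g) (p : M) :
    IsMetricField (chartAt E p).target (smoothOn (chartAt E p).target) (chartBilForm g p) where
  inner x hx := ⟨fun u v => hg.symm _ _ _, fun u hu => hg.pos _ _ fun h0 => hu (by
    rw [← frame_inverse_frame p hx u]
    exact (congrArg _ h0).trans (map_zero _))⟩
  mem u v := hg.smooth p u v

theorem IsSKT.isHermitianField (hJ : IsComplexStructure J) (hg : IsSKT J g) (p : M) :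
    IsHermitianField (chartAt E p).target (smoothOn (chartAt E p).target) (chartBilForm g p)
      (chartEndo J p) where
  sq x hx u := by
    change (frame p x).inverse (J _ (frame p x ((frame p x).inverse (J _ (frame p x u))))) = -u
    rw [frame_frame_inverse p hx, hJ.sq, map_neg, frame_inverse_frame p hx]
  herm x hx u v := by
    change g _ (frame p x ((frame p x).inverse (J _ (frame p x u))))
      (frame p x ((frame p x).inverse (J _ (frame p x v)))) = _
    rw [frame_frame_inverse p hx, frame_frame_inverse p hx, hg.hermitian]
    rfl
  mem v := vecIn_smoothOn.2 (hJ.smooth p v)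

/-- A pluriclosed Hermitian metric, read in a chart. -/
theorem IsSKT.isPluriclosed (hJ : IsComplexStructure J) (hg : IsSKT J g) (hH : IsSmoothForm H)
    (hd : IsDcOmega J g H) (p : M) :
    IsPluriclosed (chartCalc E) (chartAt E p).target (smoothOn (chartAt E p).target)
      (chartBilForm g p) (chartEndo J p) (chartAlt H p) where
  smooth := smoothCalculus_chart p
  metric := hg.isMetricField p
  herm := hg.isHermitianField hJ p
  integrable := hJ.integrable p
  form_mem v := hH p v
  form_eq := hd p
  closed x hx v := by
    rw [← hg.skt p x hx v]
    simp only [extD]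
    refine Finset.sum_congr rfl fun j _ => ?_
    congr 2
    · exact (smoothCalculus_chart p).der_congr _ (fun y hy => hd p y hy _) x hx
    · exact Finset.sum_congr rfl fun i _ => hd p x hx _

theorem IsLeeForm.chartOne_eq {n : ℕ} (hn : Module.finrank ℝ E = 2 * n) (hJ : IsComplexStructure J)
    (hg : IsSKT J g) (hθ : IsLeeForm n J g θ) (p : M) {x : E} (hx : x ∈ (chartAt E p).target) (u : E) :
    chartOne θ p x u = leeTrace (chartBilForm g p) (chartEndo J p)
      (bismutTors (chartCalc E) (chartBilForm g p) (chartEndo J p)) x u :=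
  let l : Module.Dual ℝ E := (θ ((chartAt E p).symm x)).comp (frame p x : E →ₗ[ℝ] _)
  (smoothCalculus_chart p).lee_eq_leeTrace (hg.isMetricField p) (hg.isHermitianField hJ p) hn hx
    l.isLinear (hθ.eq p x hx) u

theorem IsLeeForm.chartVec_sharpField {n : ℕ} (hn : Module.finrank ℝ E = 2 * n)
    (hJ : IsComplexStructure J) (hg : IsSKT J g) (hθ : IsLeeForm n J g θ) (p : M) {x : E}
    (hx : x ∈ (chartAt E p).target) : chartVec (sharpField g θ) p x
      = leeVec (chartCalc E) (chartBilForm g p) (chartEndo J p) x := by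
  refine (((hg.isMetricField p).inner x hx).sharp_eq fun w => ?_).symm
  rw [← hθ.chartOne_eq hn hJ hg p hx]
  change g _ (frame p x ((frame p x).inverse (sharpField g θ _))) (frame p x w) = _
  rw [frame_frame_inverse p hx]
  let b : LinearMap.BilinForm ℝ E := g ((chartAt E p).symm x)
  let l : Module.Dual ℝ E := θ ((chartAt E p).symm x)
  have hi : IsInner b := ⟨hg.symm _, hg.pos _⟩
  exact hi.sharp_apply l.isLinear _

end ManifoldCharts

/-! ### Solitons on a complex manifold -/

section ChartLieDerivative

variable {E : Type*} [NormedAddCommGroup E] [NormedSpace ℝ E] [FiniteDimensional ℝ E]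

theorem lieD_two (X : E → E) (α : E → (Fin 2 → E) → ℝ) (x u v : E) :
    lieD X α x ![u, v] = lieTwo (chartCalc E) X (fun y a b => α y ![a, b]) x u v := by
  rw [lieD, Fin.sum_univ_two, (update_vec2 _ _ _).1, (update_vec2 _ _ _).2, ← add_assoc]
  rfl

theorem lieD_three (X : E → E) (α : E → (Fin 3 → E) → ℝ) (x u v w : E) :
    lieD X α x ![u, v, w] = lieThree (chartCalc E) X (fun y a b c => α y ![a, b, c]) x u v w := by
  rw [lieD, Fin.sum_univ_three, (update_vec3 _ _ _ _).1, (update_vec3 _ _ _ _).2.1,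
    (update_vec3 _ _ _ _).2.2, ← add_assoc, ← add_assoc]
  rfl

end ChartLieDerivative

section Congr

variable {B V : Type*} [AddCommGroup V] [Module ℝ V] [FiniteDimensional ℝ V]
  {C : FrameCalculus B V} {S : Set B} {A : Subalgebra ℝ (B → ℝ)}

theorem SmoothCalculus.lieTwo_congr (hC : SmoothCalculus C S A) {Y Z : B → V} (hY : VecIn A Y)
    (h : ∀ x ∈ S, Y x = Z x) (Q : B → V → V → ℝ) {x : B} (hx : x ∈ S) (u v : V) :
    lieTwo C Y Q x u v = lieTwo C Z Q x u v := by
  rw [lieTwo, lieTwo, h x hx, hC.derV_congr u hY h hx, hC.derV_congr v hY h hx]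

theorem SmoothCalculus.lieThree_congr (hC : SmoothCalculus C S A) {Y Z : B → V} (hY : VecIn A Y)
    (h : ∀ x ∈ S, Y x = Z x) (T : B → V → V → V → ℝ) {x : B} (hx : x ∈ S) (u v w : V) :
    lieThree C Y T x u v w = lieThree C Z T x u v w := by
  rw [lieThree, lieThree, h x hx, hC.derV_congr u hY h hx, hC.derV_congr v hY h hx,
    hC.derV_congr w hY h hx]

end Congr

section Manifold

variable {E : Type*} [NormedAddCommGroup E] [NormedSpace ℝ E] [FiniteDimensional ℝ E]
  {M : Type*} [TopologicalSpace M] [ChartedSpace E M] [IsManifold 𝓘(ℝ, E) ∞ M]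
  {J : ∀ q : M, Module.End ℝ (TangentSpace 𝓘(ℝ, E) q)}
  {g : ∀ q : M, LinearMap.BilinForm ℝ (TangentSpace 𝓘(ℝ, E) q)}
  {θ : ∀ q : M, Module.Dual ℝ (TangentSpace 𝓘(ℝ, E) q)}
  {H : ∀ q : M, (TangentSpace 𝓘(ℝ, E) q) [⋀^Fin 3]→ₗ[ℝ] ℝ}
  {X Y : ∀ q : M, TangentSpace 𝓘(ℝ, E) q}

theorem IsDcOmega.isSmoothForm (hJ : IsComplexStructure J) (hg : IsSKT J g)
    (hd : IsDcOmega J g H) : IsSmoothForm H := by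
  intro p v
  have hC := smoothCalculus_chart (E := E) p
  have hω := hC.omega_twoForm (hg.isMetricField p) (hg.isHermitianField hJ p)
  have hJm := (hg.isHermitianField hJ p).mem
  refine hC.mem_congr (fun_neg_mem (hC.three_apply_mem (hC.dTwo_threeForm hω) (hJm (v 0))
    (hJm (v 1)) (hJm (v 2)))) fun x hx => ?_
  rw [hd p x hx, dcOmega, ← hC.extD_eq_dTwo (α := omega (chartBil g p) (chartEnd J p)) (fun _ _ => rfl)
    hω (fun _ _ _ _ => rfl) hx]
  congr 2
  exact (eta_vec3 (fun i => chartEndo J p x (v i))).symm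

theorem chartVec_sub_lee {n : ℕ} (hn : Module.finrank ℝ E = 2 * n) (hJ : IsComplexStructure J)
    (hg : IsSKT J g) (hθ : IsLeeForm n J g θ) (hX : ∀ q, X q = Y q - sharpField g θ q) (p : M) {x : E}
    (hx : x ∈ (chartAt E p).target) : chartVec Y p x
        - leeVec (chartCalc E) (chartBilForm g p) (chartEndo J p) x = chartVec X p x := by
  rw [← hθ.chartVec_sharpField hn hJ hg p hx, chartVec, chartVec, chartVec, hX, map_sub]

theorem isSmoothVec_sub_lee {n : ℕ} (hn : Module.finrank ℝ E = 2 * n) (hJ : IsComplexStructure J)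
    (hg : IsSKT J g) (hθ : IsLeeForm n J g θ) (hX : ∀ q, X q = Y q - sharpField g θ q)
    (hd : IsDcOmega J g H) (hY : IsSmoothVec Y) : IsSmoothVec X := by
  intro p
  have h := hg.isPluriclosed hJ (hd.isSmoothForm hJ hg) hd p
  exact vecIn_smoothOn.1 (h.smooth.vecIn_congr ((vecIn_smoothOn.2 (hY p)).sub h.vecIn_leeVec)
    fun x hx => chartVec_sub_lee hn hJ hg hθ hX p hx)

theorem soliton_metric_chart {n : ℕ} (hn : Module.finrank ℝ E = 2 * n) (hJ : IsComplexStructure J)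
    (hg : IsSKT J g) (hθ : IsLeeForm n J g θ) (hX : ∀ q, X q = Y q - sharpField g θ q)
    (hd : IsDcOmega J g H) (hY : IsHolomorphic J Y) (lam : ℝ) (p : M) {x : E}
    (hx : x ∈ (chartAt E p).target) :
    (∀ u v, rhoB11 (chartCalc E) (chartBil g p) (chartEnd J p) x u v
      = lam * omega (chartBil g p) (chartEnd J p) x ![u, v]
        + (1 / 2) * lieD (chartVec Y p) (omega (chartBil g p) (chartEnd J p)) x ![u, v]) ↔
    ∀ u v, ricB (chartCalc E) (chartBil g p) (chartForm H p) x u v = lam * chartBil g p x u v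
      + (1 / 2) * lieD (chartVec X p) (fun y w => chartBil g p y (w 0) (w 1)) x ![u, v] := by
  have h := hg.isPluriclosed hJ (hd.isSmoothForm hJ hg) hd p
  have hYv := vecIn_smoothOn.2 (hY.smooth p)
  have e := fun u v => h.smooth.lieTwo_congr (hYv.sub h.vecIn_leeVec)
    (fun x hx => chartVec_sub_lee hn hJ hg hθ hX p hx) (chartBil g p) hx u v
  have key := h.soliton_metric_iff (fun _ _ => rfl) hYv (hY.lie p) lam hx
  simp only [lieD_two]
  refine Iff.trans key (forall_congr' fun u => forall_congr' fun v => ?_)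
  rw [show ricB (chartCalc E) (chartBil g p) (chartForm H p) x u v
      = ricB (chartCalc E) (fun y a b => chartBilForm g p y a b) (fun y => chartAlt H p y) x u v
      from rfl]
  exact (congrArg (fun t => _ = lam * chartBil g p x u v + 1 / 2 * t) (e u v)).to_iff

theorem IsPluriclosedTriple.isGenSoliton {n : ℕ} (hn : Module.finrank ℝ E = 2 * n)
    (hJ : IsComplexStructure J) (hg : IsSKT J g) (hθ : IsLeeForm n J g θ) {lam : ℝ}
    (hs : IsPluriclosedTriple J g θ H X lam) : IsGenSoliton g H X lam := by
  obtain ⟨Y, hY, hd, hX⟩ := hs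
  have hH := hd.isSmoothForm hJ hg
  refine ⟨hH, isSmoothVec_sub_lee hn hJ hg hθ hX hd hY.holomorphic.smooth,
    fun p => (hg.isPluriclosed hJ hH hd p).closed,
    fun p x hx => (soliton_metric_chart hn hJ hg hθ hX hd hY.holomorphic lam p hx).1 (hY.eq p x hx),
    fun p x hx v => ?_⟩
  have h := hg.isPluriclosed hJ hH hd p
  have hYv := vecIn_smoothOn.2 (hY.holomorphic.smooth p)
  have e := h.smooth.lieThree_congr (hYv.sub h.vecIn_leeVec)
    (fun x hx => chartVec_sub_lee hn hJ hg hθ hX p hx)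
    (fun y a b c => chartForm H p y ![a, b, c]) hx (v 0) (v 1) (v 2)
  rw [eta_vec3 v, lieD_three, ← e]
  refine h.soliton_form (fun _ _ => rfl) hYv (hY.holomorphic.lie p) lam (fun y hy a b => ?_) hx _ _ _
  have := hY.eq p y hy a b
  rw [lieD_two] at this
  exact this

theorem isPluriclosedTriple_iff {n : ℕ} (hn : Module.finrank ℝ E = 2 * n)
    (hJ : IsComplexStructure J) (hg : IsSKT J g) (hθ : IsLeeForm n J g θ) {lam : ℝ}
    (hs : IsGenSoliton g H X lam) : (∃ lam : ℝ, IsPluriclosedTriple J g θ H X lam) ↔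
      IsDcOmega J g H ∧ IsHolomorphic J fun q => X q + sharpField g θ q := by
  constructor
  · rintro ⟨_, Y, hY, hd, hX⟩
    have : (fun q => X q + sharpField g θ q) = Y := by
      funext q; rw [hX, sub_add_cancel]
    exact ⟨hd, this ▸ hY.holomorphic⟩
  · rintro ⟨hd, hY⟩
    have hX : ∀ q, X q = (X q + sharpField g θ q) - sharpField g θ q := fun q => by
      rw [add_sub_cancel_right]
    exact ⟨lam, _, ⟨hY, fun p x hx =>
      (soliton_metric_chart hn hJ hg hθ hX hd hY lam p hx).2 (hs.metric p x hx)⟩, hd, hX⟩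

end Manifold

/-! ### Algebraic solitons on a Lie algebra -/

section LieAlgebra

variable {𝔤 : Type*} [LieRing 𝔤] [LieAlgebra ℝ 𝔤] [FiniteDimensional ℝ 𝔤]
  {J : Module.End ℝ 𝔤} {g : LinearMap.BilinForm ℝ 𝔤} {θ : Module.Dual ℝ 𝔤}
  {H : 𝔤 [⋀^Fin 3]→ₗ[ℝ] ℝ}

theorem IsLieSKT.isMetricField (hg : IsLieSKT J g) :
    IsMetricField Set.univ (⊤ : Subalgebra ℝ (Unit → ℝ)) fun _ => g :=
  ⟨fun _ _ => ⟨hg.symm, hg.pos⟩, fun _ _ => trivial⟩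

theorem IsLieSKT.isHermitianField (hg : IsLieSKT J g) :
    IsHermitianField Set.univ (⊤ : Subalgebra ℝ (Unit → ℝ)) (fun _ => g) fun _ => J :=
  ⟨fun _ _ => hg.sq, fun _ _ => hg.hermitian, fun _ _ => trivial⟩

/-- A left-invariant pluriclosed Hermitian metric, read in a left-invariant frame. -/
theorem IsLieSKT.isPluriclosed (hg : IsLieSKT J g) (hd : IsLieDcOmega J g H) :
    IsPluriclosed (lieCalc 𝔤) Set.univ (⊤ : Subalgebra ℝ (Unit → ℝ)) (fun _ => g) (fun _ => J)
      fun _ => H where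
  smooth := smoothCalculus_lieCalc
  metric := hg.isMetricField
  herm := hg.isHermitianField
  integrable _ _ := hg.integrable
  form_mem _ := trivial
  form_eq _ _ := hd
  closed _ _ v := by
    rw [← hg.skt v]
    exact congrArg (fun α => extD (lieCalc 𝔤) α () v) (funext fun _ => funext hd)

theorem IsLieLeeForm.lieSharp_eq {n : ℕ} (hn : Module.finrank ℝ 𝔤 = 2 * n) (hg : IsLieSKT J g)
    (hθ : IsLieLeeForm n J g θ) :
    lieSharp g θ = leeVec (lieCalc 𝔤) (fun _ => g) (fun _ => J) () := by
  have h := smoothCalculus_lieCalc.lee_eq_leeTrace hg.isMetricField hg.isHermitianField hn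
    (Set.mem_univ ()) θ.isLinear hθ
  rw [lieSharp, leeVec]
  congr 1
  funext u; exact h u

/-- `(ρ^B)^{1,1}(u, Jv) = Ric^B(u, v) + (L_{θ^♯} g)(u, v) / 2` on a Lie algebra. -/
theorem IsLieSKT.rhoB11_J {n : ℕ} (hn : Module.finrank ℝ 𝔤 = 2 * n) (hg : IsLieSKT J g)
    (hθ : IsLieLeeForm n J g θ) (hd : IsLieDcOmega J g H) (u v : 𝔤) :
    rhoB11 (lieCalc 𝔤) (fun _ a b => g a b) (fun _ => J) () u (J v)
      = ricB (lieCalc 𝔤) (fun _ a b => g a b) (fun _ => H) () u v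
        + (1 / 2) * (g ⁅u, lieSharp g θ⁆ v + g u ⁅v, lieSharp g θ⁆) := by
  have h := hg.isPluriclosed hd
  have hx := Set.mem_univ ()
  have h1 := h.rho11_J u v hx
  have h2 := h.smooth.covD_symm h.metric (leeVec (lieCalc 𝔤) (fun _ => g) fun _ => J) u v hx
  rw [h.nablaOne_lee u v hx, h.nablaOne_lee v u hx, (h.metric.inner _ hx).symm _ u, h2,
    ← hθ.lieSharp_eq hn hg] at h1
  refine h1.trans ?_
  simp [lieCalc]

theorem IsLieSKT.lieRicB_apply {n : ℕ} (hn : Module.finrank ℝ 𝔤 = 2 * n) (hg : IsLieSKT J g)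
    (hθ : IsLieLeeForm n J g θ) (hd : IsLieDcOmega J g H) (u v : 𝔤) :
    g (lieRicB g H u) v = ricB (lieCalc 𝔤) (fun _ a b => g a b) (fun _ => H) () u v := by
  have h := hg.isPluriclosed hd
  have hx := Set.mem_univ ()
  have hi := h.metric.inner () hx
  refine hi.sharp_apply ?_ v
  have e : ∀ v, ricB (lieCalc 𝔤) (fun _ a b => g a b) (fun _ => H) () u v
      = (1 / 2) * (rhoB (lieCalc 𝔤) (fun _ a b => g a b) (fun _ => J) () u (J v)
        + rhoB (lieCalc 𝔤) (fun _ a b => g a b) (fun _ => J) () (J u) (J (J v)))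
        - (1 / 2) * (g ⁅u, lieSharp g θ⁆ v + g u ⁅v, lieSharp g θ⁆) := fun v => by
    rw [eq_sub_iff_add_eq, ← hg.rhoB11_J hn hθ hd, rhoB11]
  have l : ∀ u, IsLinearMap ℝ (rhoB (lieCalc 𝔤) (fun _ a b => g a b) (fun _ => J) () u) :=
    fun u => h.rhoB_twoForm.lin2 hx u
  refine ⟨fun a b => ?_, fun c a => ?_⟩
  · simp only [e, map_add, (l _).map_add, add_lie]; ring
  · simp only [e, map_smul, (l _).map_smul, smul_lie, smul_eq_mul]; ring

theorem isAlgPluriclosedTriple_iff {n : ℕ} (hn : Module.finrank ℝ 𝔤 = 2 * n) (hg : IsLieSKT J g)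
    (hθ : IsLieLeeForm n J g θ) {D : LieDerivation ℝ 𝔤 𝔤} {lam : ℝ}
    (hs : IsAlgGenSoliton g H D lam) : (∃ lam : ℝ, IsAlgPluriclosedTriple J g θ H D lam) ↔
      (∀ u, (D - LieDerivation.ad ℝ 𝔤 (lieSharp g θ)) (J u)
        = J ((D - LieDerivation.ad ℝ 𝔤 (lieSharp g θ)) u)) ∧ IsLieDcOmega J g H := by
  constructor
  · rintro ⟨_, D', ⟨hD', _⟩, hd, rfl⟩
    rw [add_sub_cancel_right]
    exact ⟨hD', hd⟩
  · rintro ⟨hJ, hd⟩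
    have h := hg.isPluriclosed hd
    have hx := Set.mem_univ ()
    have hi := h.metric.inner () hx
    set t := lieSharp g θ with ht
    set D' := D - LieDerivation.ad ℝ 𝔤 t with hD'
    refine ⟨lam, D', ⟨hJ, ?_⟩, hd, by rw [hD', sub_add_cancel]⟩
    have hDD : ∀ u, D u = D' u + ⁅t, u⁆ := fun u => by simp [hD']
    -- `D` is symmetric, because `Ric^B` is
    have hR : ∀ u v, ricB (lieCalc 𝔤) (fun _ a b => g a b) (fun _ => H) () u v
        = lam * g u v + g (D u) v := fun u v => by
      rw [← hg.lieRicB_apply hn hθ hd, hs.2.1]; simp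
    have hsymm : ∀ u v, g (D u) v = g u (D v) := fun u v => by
      have h1 := h.ricB_symm u v hx
      have h2 := hR u v
      have h3 := hR v u
      rw [hg.symm v u, hg.symm (D v)] at h3
      have : lam * g u v + g (D u) v = lam * g u v + g u (D v) := h2.symm.trans (h1.trans h3)
      linarith
    -- `T` is the transpose of `D'`
    have hQ : IsBilin fun u w => g u (D' w) :=
      ⟨fun w => ⟨by simp, by simp⟩, fun u => ⟨by simp, by simp⟩⟩
    let T : Module.End ℝ 𝔤 := hQ.endo g
    have hT : ∀ u w, g (T u) w = g u (D' w) := hi.endo_apply hQ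
    refine ⟨lam • 1 + (1 / 2 : ℝ) • ((D' : 𝔤 →ₗ[ℝ] 𝔤) + T), fun u v => ?_, fun u => rfl⟩
    obtain ⟨w, rfl⟩ : ∃ w, v = J w := ⟨-J v, by rw [map_neg, hg.sq, neg_neg]⟩
    rw [hg.rhoB11_J hn hθ hd, hR, omega_vec, hg.hermitian, ← ht]
    have e1 := hsymm u w
    rw [hDD, hDD] at e1
    rw [hDD]
    simp [hT] at e1 ⊢
    have a1 : g ⁅u, t⁆ w = -g ⁅t, u⁆ w := by rw [← lie_skew u t, map_neg, LinearMap.neg_apply]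
    have a2 : g u ⁅w, t⁆ = -g u ⁅t, w⁆ := by rw [← lie_skew w t, map_neg]
    linarith

end LieAlgebra

end PluriSol

theorem mainTheorem12
    {E : Type*} [NormedAddCommGroup E] [NormedSpace ℝ E] [FiniteDimensional ℝ E]
    {M : Type*} [TopologicalSpace M] [ChartedSpace E M] [IsManifold 𝓘(ℝ, E) ∞ M]
    {𝔤 : Type*} [LieRing 𝔤] [LieAlgebra ℝ 𝔤] [FiniteDimensional ℝ 𝔤] :
    (∀ (n : ℕ), Module.finrank ℝ E = 2 * n →
      ∀ (J : ∀ q : M, Module.End ℝ (TangentSpace 𝓘(ℝ, E) q))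
        (g : ∀ q : M, LinearMap.BilinForm ℝ (TangentSpace 𝓘(ℝ, E) q))
        (θ : ∀ q : M, Module.Dual ℝ (TangentSpace 𝓘(ℝ, E) q)),
        IsComplexStructure J → IsSKT J g → IsLeeForm n J g θ →
      ∀ (H : ∀ q : M, (TangentSpace 𝓘(ℝ, E) q) [⋀^Fin 3]→ₗ[ℝ] ℝ)
        (X : ∀ q : M, TangentSpace 𝓘(ℝ, E) q),
        ((∃ lam : ℝ, IsGenSoliton g H X lam) →
          ((∃ lam : ℝ, IsPluriclosedTriple J g θ H X lam) ↔
            IsDcOmega J g H ∧ IsHolomorphic J (fun q => X q + sharpField g θ q))) ∧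
        (∀ lam : ℝ, IsPluriclosedTriple J g θ H X lam → IsGenSoliton g H X lam)) ∧
    (∀ (n : ℕ), Module.finrank ℝ 𝔤 = 2 * n →
      ∀ (J : Module.End ℝ 𝔤) (g : LinearMap.BilinForm ℝ 𝔤) (θ : Module.Dual ℝ 𝔤),
        IsLieSKT J g → IsLieLeeForm n J g θ →
      ∀ (H : 𝔤 [⋀^Fin 3]→ₗ[ℝ] ℝ) (D : LieDerivation ℝ 𝔤 𝔤),
        (∃ lam : ℝ, IsAlgGenSoliton g H D lam) →
          ((∃ lam : ℝ, IsAlgPluriclosedTriple J g θ H D lam) ↔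
            (∀ u, (D - LieDerivation.ad ℝ 𝔤 (lieSharp g θ)) (J u)
              = J ((D - LieDerivation.ad ℝ 𝔤 (lieSharp g θ)) u)) ∧
            IsLieDcOmega J g H)) := by
  refine ⟨fun n hn J g θ hJ hg hθ H X => ⟨fun ⟨_, hs⟩ => isPluriclosedTriple_iff hn hJ hg hθ hs,
    fun _ hs => hs.isGenSoliton hn hJ hg hθ⟩, fun n hn J g θ hg hθ H D ⟨_, hs⟩ =>
    isAlgPluriclosedTriple_iff hn hg hθ hs⟩
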